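/- \textbf{Definitions.} A \emph{generalized quiver} is a triple $Q=(V,A,K)$ with $V$ a finite set, $A:V\times V\to\mathbb Z$, $K:V\to\mathbb Z_{>0}$, such that (i) for every $x$, $A(x,x)=-2+2g_x$ with $g_x\in\mathbb Z_{\ge 0}$, and $A(x,x)=-2$ if $K(x)=1$; (ii) $A(x,y)\ge 0$ for $x\ne y$; (iii) there is $L:V\to\mathbb Z_{>0}$ with $A(x,y)L(y)=A(y,x)L(x)$ for all $x,y$. A pair $x\neq y$ with $A(x,y)=p>0$, $A(y,x)=q>0$ is a $(p,q)$-edge from $x$ to $y$, written $x\overset{p,q}{-}y$; $x-y$ denotes a $(1,1)$-edge. Connectedness refers to the graph whose edges are the pairs $x\neq y$ with $A(x,y)\ne 0$. Isomorphisms are bijections of vertices preserving $A$ and $K$. $N\cdot Q=(V,A,NK)$. A \emph{subquiver} of $Q$ is given by $V'\subseteq V$ and $K':V'\to\mathbb Z_{>0}$ with $K'\le K|_{V'}$; its matrix is $A|_{V'\times V'}$, except that $A'(x,x)=-2$ if $K'(x)=1$. For $m=(m_{x,a})\in\Lambda=\prod_{x}\mathbb Z^{K(x)}$ let $$\Delta(m)=\tfrac12\sum_{x,y\in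 V}\operatorname{sgn}(A(x,y))\sum_{a=1}^{K(x)}\sum_{b=1}^{K(y)}\bigl|m_{x,a}A(x,y)-m_{y,b}A(y,x)\bigr| .$$ For $Q$ connected let $\lambda:V\to\mathbb Z_{>0}$ be the vector with $\gcd$ of entries $1$ and $\lambda(x)A(x,y)=\lambda(y)A(y,x)$ for all $x,y$, and let $\mathbf L\in\Lambda$ be given by $\mathbf L_{x,a}=\lambda(x)$, so that $\Delta(m+\mathbf L)=\Delta(m)$. With $W=\prod_x S_{K(x)}$ acting on $\Lambda$ by permutation matrices and $W(m)$ the stabilizer of $m$, the Hilbert series is $$\mathrm{HS}_Q(t)=\frac{1-t^2}{|W|}\sum_{m\in\Lambda/\mathbb Z\mathbf L}\ \sum_{w\in W(m)}\frac{t^{\Delta(m)}}{\det(1-t^2w)},\qquad 0<t<1 .$$ A connected non-empty $Q$ is \emph{good} if either $\mathrm{HS}_Q$ converges on $(0,1)$, is non-constant, and has a power series expansion in $t$ there with vanishing coefficient of $t$; or $Q$ is isomorphic to a single vertex of weight $N\ge2$ with one loop ($A=0$), or to $N\cdot X$ with $N\ge1$ and $X$ one of the simply laced affine Dynkin quivers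 $A^{(1)}_n$ ($n\ge1$), $D^{(1)}_n$ ($n\ge4$), $E^{(1)}_{6,7,8}$ with weights the Dynkin marks. A non-empty quiver is good if all its connected components are good. A \emph{decay product} of $Q$ is a good connected subquiver of $Q$. \textbf{Theorem.} Every good generalized quiver has a decay product isomorphic to a quiver of the following list. All parameters are positive integers, and there are no loops unless stated. In the pictures vertices are denoted by their weights, and $\cdots$ stands for a chain, possibly of a single vertex, of vertices of weight $2$ joined by $(1,1)$-edges; two leaves attached to the same end vertex are joined by $\vee$. \emph{Abelian quivers (all weights $1$).} (1) $A_{N-1}$: $1\overset{N\ell,N}{-}1$, $N\ge2$. (2) $h_n$, $n\ge1$: linear, vertices $0,\dots,n$, with an $(\ell_i,k_i)$-edge from $i-1$ to $i$; $\gcd(\ell_1,k_n)>1$ and $\gcd(\ell_i,k_j)=1$ for all other $1\le i\le j\le n$. (3) $\overline h_n$, $n\ge2$: cyclic, vertices $i\in\mathbb Z_{n+1}$, with an $(\ell_i,k_i)$-edge from $i$ to $i+1$; $\prod_i k_i=\prod_i\ell_i$, and $\gcd(\ell_i,k_j)=1$ whenever $i-j\not\equiv1,2 \bmod n+1$. \emph{Affine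 Dynkin-type quivers.} (4) $A^{(2)}_{2n}$, $n\ge2$: $2\overset{2,1}{-}2\cdots2\overset{2,a}{-}1$, $a$ odd. (5) $A^{(2)}_{2n-1}$, $n\ge3$: $(1\overset{a,1}{-})\vee(1\overset{b,1}{-})\,2\cdots2\overset{1,2}{-}2$, $a,b$ odd and coprime. (6) $B^{(1)}_n$, $n\ge3$: $(1\overset{a,1}{-})\vee(1\overset{b,1}{-})\,2\cdots2\overset{2,c}{-}1$, $a,b,c$ pairwise coprime, $c$ odd. (7) $D^{(1)}_n$, $n\ge4$: $(1\overset{a,1}{-})\vee(1\overset{b,1}{-})\,2\cdots2\,(\overset{1,c}{-}1)\vee(\overset{1,d}{-}1)$, $a,b,c,d$ pairwise coprime. (8) $D^{(2)}_{n+1}$, $n\ge2$: $1\overset{a,2}{-}2\cdots2\overset{2,b}{-}1$, $a,b$ odd and coprime. (9) $D^{(3)}_4$: $1\overset{a,1}{-}2\overset{1,3}{-}3$, $\gcd(a,3)=1$. (10) $E^{(1)}_6$: central vertex of weight $3$ with three legs $3-2\overset{1,a_i}{-}1$, $a_1,a_2,a_3$ pairwise coprime. (11) $E^{(2)}_6$: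 $2-4\overset{2,1}{-}3-2\overset{1,a}{-}1$, $a$ odd. (12) $E^{(1)}_7$: $1\overset{a,1}{-}2-3-4-3-2\overset{1,b}{-}1$ and a vertex of weight $2$ joined to that of weight $4$ by a $(1,1)$-edge, $\gcd(a,b)=1$. (13) $E^{(1)}_8$: $1\overset{a,1}{-}2-3-4-5-6-4-2$ and a vertex of weight $3$ joined to that of weight $6$ by a $(1,1)$-edge. (14) $F^{(1)}_4$: $1\overset{a,1}{-}2-3\overset{2,1}{-}2\overset{1,b}{-}1$, $\gcd(a,b)=1$, $b$ odd. (15) $G^{(1)}_2$: $1\overset{a,1}{-}2\overset{3,b}{-}1$, $\gcd(a,b)=\gcd(b,3)=1$. \emph{Other non-Abelian quivers.} (16) $D_{g+1}$: one vertex of weight $2$ with $g\ge1$ loops. (17) $\mathcal Y(\ell)$, $\ell\ge4$: $1\overset{a,\ell}{-}2$, $\gcd(a,\ell)=1$. (18) $gc_n$, $n\ge2$: $2\overset{3,1}{-}2\cdots2\overset{1,2}{-}2$; and $gc_1$: $2\overset{3,2}{-}2$. (19) $gb_n$, $n\ge2$: $2\overset{3,1}{-}2\cdots2\overset{2,a}{-}1$,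 $\gcd(a,6)=1$. (20) $gd_n$, $n\ge3$: $2\overset{3,1}{-}2\cdots2\,(\overset{1,a}{-}1)\vee(\overset{1,b}{-}1)$, $\gcd(a,b)=\gcd(a,3)=\gcd(b,3)=1$. (21) $\mathcal J_{2,3}$: $1\overset{a,2}{-}2\overset{3,b}{-}1$, $\gcd(a,2)=\gcd(b,3)=\gcd(a,b)=1$. (22) $\mathcal J_{3,3}$: $1\overset{a,3}{-}2\overset{3,b}{-}1$, $\gcd(a,3)=\gcd(b,3)=\gcd(a,b)=1$. In (4)--(8) and (18)--(20) the quiver has $n+1$ vertices, except that $gc_1$ has two, as displayed. -/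

import Mathlib

noncomputable section

namespace CoulombQuiver

/-- Raw data of a quiver: adjacency matrix `A` and weight function `K` (no laws imposed). -/
structure QuiverData (V : Type*) where
  A : V → V → ℤ
  K : V → ℕ

/-- A generalized quiver with vertex set `V` (finiteness of `V` is required where it is used).
`A x y` and `A y x` are the two labels `p` and `q` of a `(p,q)`-edge from `x` to `y`; an arrow of
lacedness `ℓ` with source `x` and target `y` is a `(ℓ,1)`-edge. -/
structure GenQuiver (V : Type*) extends QuiverData V where
  K_pos : ∀ x, 0 < K x
  loops : ∀ x, ∃ g : ℕ, A x x = -2 + 2 * (g : ℤ)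
  abelian_no_loop : ∀ x, K x = 1 → A x x = -2
  offdiag_nonneg : ∀ x y, x ≠ y → 0 ≤ A x y
  length : ∃ L : V → ℕ, (∀ x, 0 < L x) ∧ ∀ x y, A x y * (L y : ℤ) = A y x * (L x : ℤ)

/-- Isomorphism of quivers (given by their data): a bijection of the vertices preserving the
adjacency matrices and the weights. -/
def QuiverData.Iso {V W : Type*} (Q : QuiverData V) (R : QuiverData W) : Prop :=
  ∃ e : V ≃ W, (∀ x y, R.A (e x) (e y) = Q.A x y) ∧ ∀ x, R.K (e x) = Q.K x

/-- The quiver `N · Q`: all weights are multiplied by `N`. -/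
def QuiverData.mul {V : Type*} (N : ℕ) (Q : QuiverData V) : QuiverData V where
  A := Q.A
  K x := N * Q.K x

namespace GenQuiver

variable {V : Type*}

theorem zero_of_zero (Q : GenQuiver V) {x y : V} (h : Q.A x y = 0) : Q.A y x = 0 := by
  obtain ⟨L, hpos, hL⟩ := Q.length
  have h1 := hL x y
  rw [h, zero_mul] at h1
  rcases mul_eq_zero.1 h1.symm with h2 | h2
  · exact h2
  · have := hpos x
    omega

/-- The underlying graph. -/
def graph (Q : GenQuiver V) : SimpleGraph V where
  Adj x y := x ≠ y ∧ Q.A x y ≠ 0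
  symm := ⟨fun _ _ h => ⟨h.1.symm, fun h0 => h.2 (Q.zero_of_zero h0)⟩⟩
  loopless := ⟨fun _ h => h.1 rfl⟩

/-- The subquiver with weight function `K'`: its vertex set `V'` is the support of `K'`
(the pairs `(V', K')` with `K'` positive on `V'` are the same as functions `K' : V → ℕ`).
Vertices of weight one lose their loops. -/
def sub [DecidableEq V] (Q : GenQuiver V) (K' : V → ℕ) : GenQuiver {x : V // K' x ≠ 0} where
  A x y := if x = y ∧ K' x = 1 then -2 else Q.A x y
  K x := K' x
  K_pos x := Nat.pos_of_ne_zero x.2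
  loops x := by
    by_cases h : K' x = 1
    · exact ⟨0, by simp [h]⟩
    · obtain ⟨g, hg⟩ := Q.loops x
      exact ⟨g, by simp [h, hg]⟩
  abelian_no_loop x h := by simp [h]
  offdiag_nonneg x y h := by
    have h' : (x : V) ≠ y := fun h0 => h (Subtype.ext h0)
    simpa [h] using Q.offdiag_nonneg x y h'
  length := by
    obtain ⟨L, hpos, hL⟩ := Q.length
    refine ⟨fun x => L x, fun x => hpos x, fun x y => ?_⟩
    by_cases h : x = y
    · subst h; rfl
    · simpa [h, Ne.symm h] using hL x y

section HilbertSeries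

variable [Fintype V]

/-- Indices of the coordinates of `Λ = ∏ x, ℤ ^ K x`. -/
abbrev Index (Q : GenQuiver V) : Type _ := (x : V) × Fin (Q.K x)

/-- The magnetic lattice `Λ = ∏ x, ℤ ^ K x`. -/
abbrev Lattice (Q : GenQuiver V) : Type _ := Q.Index → ℤ

/-- The conformal dimension. -/
def confDim (Q : GenQuiver V) (m : Q.Lattice) : ℝ :=
  (1 / 2) * ∑ x, ∑ y, ((Q.A x y).sign : ℝ) *
    ∑ a : Fin (Q.K x), ∑ b : Fin (Q.K y),
      ((|m ⟨x, a⟩ * Q.A x y - m ⟨y, b⟩ * Q.A y x| : ℤ) : ℝ)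

/-- The Weyl group `∏ x, S_{K x}`. -/
abbrev Weyl (Q : GenQuiver V) : Type _ := (x : V) → Equiv.Perm (Fin (Q.K x))

/-- The action of a Weyl group element on the coordinates. -/
def Weyl.perm {Q : GenQuiver V} (w : Q.Weyl) : Equiv.Perm Q.Index := Equiv.sigmaCongrRight w

/-- The primitive positive vector `L` whose shift `m ↦ m + L` leaves the conformal dimension
invariant (unique for a connected quiver). -/
structure Shift (Q : GenQuiver V) where
  L : V → ℕ
  pos : ∀ x, 0 < L x
  eq : ∀ x y, (L x : ℤ) * Q.A x y = (L y : ℤ) * Q.A y x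
  primitive : Finset.univ.gcd L = 1

/-- The lattice vector equal to `L x` on all the coordinates that belong to `x`. -/
def Shift.vec {Q : GenQuiver V} (S : Q.Shift) : Q.Lattice := fun i => (S.L i.1 : ℤ)

theorem confDim_add_shift (Q : GenQuiver V) (S : Q.Shift) (k : ℤ) (m : Q.Lattice) :
    Q.confDim (k • S.vec + m) = Q.confDim m := by
  unfold confDim
  congr 1
  refine Finset.sum_congr rfl fun x _ => Finset.sum_congr rfl fun y _ => ?_
  congr 1
  refine Finset.sum_congr rfl fun a _ => Finset.sum_congr rfl fun b _ => ?_
  congr 2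
  have h := S.eq x y
  simp only [Pi.add_apply, Pi.smul_apply, Shift.vec, smul_eq_mul]
  linear_combination k * h

variable [DecidableEq V]

/-- The stabilizer of `m` in the Weyl group, as a finite set. -/
def stab (Q : GenQuiver V) (m : Q.Lattice) : Finset Q.Weyl :=
  Finset.univ.filter fun w => ∀ i, m (w.perm i) = m i

theorem stab_add_shift (Q : GenQuiver V) (S : Q.Shift) (k : ℤ) (m : Q.Lattice) :
    Q.stab (k • S.vec + m) = Q.stab m := by
  unfold stab
  refine Finset.filter_congr fun w _ => ?_
  simp [Shift.vec, Weyl.perm, Equiv.sigmaCongrRight]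

/-- Summand `(1 / |W|) ∑_{w ∈ W(m)} t^Δ(m) / det (1 - t² w)` of the monopole formula. -/
def monopoleTerm (Q : GenQuiver V) (t : ℝ) (m : Q.Lattice) : ℝ :=
  (1 / (Fintype.card Q.Weyl : ℝ)) *
    ∑ w ∈ Q.stab m, t ^ (Q.confDim m) / (1 - t ^ 2 • (w.perm.permMatrix ℝ)).det

/-- The summand of the monopole formula as a function on `Λ / Lℤ`. -/
def monopoleTermQuot (Q : GenQuiver V) (S : Q.Shift) (t : ℝ) :
    Q.Lattice ⧸ AddSubgroup.zmultiples S.vec → ℝ :=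
  Quotient.lift (Q.monopoleTerm t) fun m m' h => by
    have h' : -m + m' ∈ AddSubgroup.zmultiples S.vec := QuotientAddGroup.leftRel_apply.1 h
    obtain ⟨k, hk⟩ := AddSubgroup.mem_zmultiples_iff.1 h'
    have hm : m' = k • S.vec + m := by rw [hk]; abel
    unfold monopoleTerm
    rw [hm, confDim_add_shift, stab_add_shift]

/-- The Hilbert series of the Coulomb branch, as a function of `t` (meaningful if the sum
converges). -/
def hilbertSeries (Q : GenQuiver V) (S : Q.Shift) (t : ℝ) : ℝ :=
  (1 - t ^ 2) * ∑' m, Q.monopoleTermQuot S t m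

/-- The Hilbert series converges, is non-constant, and its expansion `∑ a n * t ^ n` has no term
of order `t`. -/
def HilbertGood (Q : GenQuiver V) : Prop :=
  ∃ S : Q.Shift,
    (∀ t ∈ Set.Ioo (0 : ℝ) 1, Summable (Q.monopoleTermQuot S t)) ∧
    ∃ a : ℕ → ℝ,
      (∀ t ∈ Set.Ioo (0 : ℝ) 1, HasSum (fun n => a n * t ^ n) (Q.hilbertSeries S t)) ∧
      (∃ n, 1 ≤ n ∧ a n ≠ 0) ∧ a 1 = 0

end HilbertSeries

end GenQuiver

/-! ### Explicit quivers -/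

/-- `edge i j p q`: the edge between the vertices `i` and `j` with `A i j = p`, `A j i = q`. -/
structure Edge where
  edge ::
  src : ℕ
  tgt : ℕ
  p : ℕ
  q : ℕ

open Edge

/-- The quiver without loops on the vertices `0, 1, …` with the listed weights and edges. -/
def ofEdges (K : List ℕ) (E : List Edge) : QuiverData (Fin K.length) where
  A x y := if x = y then -2 else
    (E.map fun e => if e.src = x.val ∧ e.tgt = y.val then (e.p : ℤ)
      else if e.src = y.val ∧ e.tgt = x.val then (e.q : ℤ) else 0).sum
  K x := K.get x

/-- Simple edges joining `0 - 1 - ⋯ - r`. -/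
def chain (r : ℕ) : List Edge := (List.range r).map fun i => edge i (i + 1) 1 1

/-- A single vertex of weight `k` with `g` loops. -/
def oneVertex (k g : ℕ) : QuiverData (Fin 1) where
  A _ _ := -2 + 2 * (g : ℤ)
  K _ := k

/-- Linear quiver of weights one with `n + 1` vertices, the `i`-th edge being a
`(ℓ i, k i)`-edge from `i` to `i + 1`. -/
def abelianPath (n : ℕ) (ℓ k : ℕ → ℕ) : QuiverData (Fin (List.replicate (n + 1) 1).length) :=
  ofEdges (List.replicate (n + 1) 1) ((List.range n).map fun i => edge i (i + 1) (ℓ i) (k i))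

/-- Cyclic quiver of weights one with `n + 1` vertices, the `i`-th edge being a
`(ℓ i, k i)`-edge from `i` to `i + 1` (modulo `n + 1`). -/
def abelianCycle (n : ℕ) (ℓ k : ℕ → ℕ) : QuiverData (Fin (List.replicate (n + 1) 1).length) :=
  ofEdges (List.replicate (n + 1) 1)
    ((List.range (n + 1)).map fun i => edge i ((i + 1) % (n + 1)) (ℓ i) (k i))

/-- Affine `D_{r+4}`: spine `0 - ⋯ - r` of weights `2`, two leaves of weight one at each end. -/
def affD (r a b c d : ℕ) : QuiverData (Fin (List.replicate (r + 1) 2 ++ [1, 1, 1, 1]).length) :=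
  ofEdges (List.replicate (r + 1) 2 ++ [1, 1, 1, 1])
    (chain r ++ [edge (r + 1) 0 a 1, edge (r + 2) 0 b 1, edge (r + 3) r c 1, edge (r + 4) r d 1])

/-- Affine `E_6`. -/
def affE6 (a b c : ℕ) : QuiverData (Fin 7) :=
  ofEdges [1, 2, 3, 2, 1, 2, 1]
    [edge 0 1 a 1, edge 1 2 1 1, edge 2 3 1 1, edge 4 3 b 1, edge 2 5 1 1, edge 6 5 c 1]

/-- Affine `E_7`. -/
def affE7 (a b : ℕ) : QuiverData (Fin 8) :=
  ofEdges [1, 2, 3, 4, 3, 2, 1, 2]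
    [edge 0 1 a 1, edge 1 2 1 1, edge 2 3 1 1, edge 3 4 1 1, edge 4 5 1 1, edge 6 5 b 1,
      edge 3 7 1 1]

/-- Affine `E_8`. -/
def affE8 (a : ℕ) : QuiverData (Fin 9) :=
  ofEdges [1, 2, 3, 4, 5, 6, 4, 2, 3]
    [edge 0 1 a 1, edge 1 2 1 1, edge 2 3 1 1, edge 3 4 1 1, edge 4 5 1 1, edge 5 6 1 1,
      edge 6 7 1 1, edge 5 8 1 1]

/-! In the next families the vertices `0, …, r` form a simply laced spine of weights `2`. -/

/-- `2 ⇒ 2 - ⋯ - 2 ⇒ 1`, with `r + 3 = n + 1` vertices (`A_{2n}^{(2)}`). -/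
def twA2even (r a : ℕ) : QuiverData (Fin (List.replicate (r + 1) 2 ++ [2, 1]).length) :=
  ofEdges (List.replicate (r + 1) 2 ++ [2, 1])
    (chain r ++ [edge (r + 1) 0 2 1, edge r (r + 2) 2 a])

/-- Two leaves of weight one at `0`, and `r ⇐ 2`, with `r + 4 = n + 1` vertices
(`A_{2n-1}^{(2)}`). -/
def twA2odd (r a b : ℕ) : QuiverData (Fin (List.replicate (r + 1) 2 ++ [1, 1, 2]).length) :=
  ofEdges (List.replicate (r + 1) 2 ++ [1, 1, 2])
    (chain r ++ [edge (r + 1) 0 a 1, edge (r + 2) 0 b 1, edge (r + 3) r 2 1])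

/-- Two leaves of weight one at `0`, and `r ⇒ 1`, with `r + 4 = n + 1` vertices (`B_n^{(1)}`). -/
def affB (r a b c : ℕ) : QuiverData (Fin (List.replicate (r + 1) 2 ++ [1, 1, 1]).length) :=
  ofEdges (List.replicate (r + 1) 2 ++ [1, 1, 1])
    (chain r ++ [edge (r + 1) 0 a 1, edge (r + 2) 0 b 1, edge r (r + 3) 2 c])

/-- `1 ⇐ 2 - ⋯ - 2 ⇒ 1`, with `r + 3 = n + 1` vertices (`D_{n+1}^{(2)}`). -/
def twD (r a b : ℕ) : QuiverData (Fin (List.replicate (r + 1) 2 ++ [1, 1]).length) :=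
  ofEdges (List.replicate (r + 1) 2 ++ [1, 1])
    (chain r ++ [edge 0 (r + 1) 2 a, edge r (r + 2) 2 b])

/-- `2 ⇛ 2 - ⋯ - 2 ⇐ 2`, with `r + 3 = n + 1` vertices (`gc_n`, `n ≥ 2`). -/
def gc (r : ℕ) : QuiverData (Fin (List.replicate (r + 1) 2 ++ [2, 2]).length) :=
  ofEdges (List.replicate (r + 1) 2 ++ [2, 2])
    (chain r ++ [edge (r + 1) 0 3 1, edge (r + 2) r 2 1])

/-- Two vertices of weight `2` joined by a `(3,2)`-edge. -/
def gc1 : QuiverData (Fin 2) := ofEdges [2, 2] [edge 0 1 3 2]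

/-- `2 ⇛ 2 - ⋯ - 2 ⇒ 1`, with `r + 3 = n + 1` vertices (`gb_n`). -/
def gb (r a : ℕ) : QuiverData (Fin (List.replicate (r + 1) 2 ++ [2, 1]).length) :=
  ofEdges (List.replicate (r + 1) 2 ++ [2, 1])
    (chain r ++ [edge (r + 1) 0 3 1, edge r (r + 2) 2 a])

/-- `2 ⇛ 0`, and two leaves of weight one at `r`, with `r + 4 = n + 1` vertices (`gd_n`). -/
def gd (r a b : ℕ) : QuiverData (Fin (List.replicate (r + 1) 2 ++ [2, 1, 1]).length) :=
  ofEdges (List.replicate (r + 1) 2 ++ [2, 1, 1])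
    (chain r ++ [edge (r + 1) 0 3 1, edge (r + 2) r a 1, edge (r + 3) r b 1])

/-- The quivers `A_n^{(1)}` (`n ≥ 1`), `D_n^{(1)}` (`n ≥ 4`), `E_n^{(1)}` (`n = 6, 7, 8`). -/
inductive IsSimplyLacedAffine : {W : Type} → QuiverData W → Prop
  | A1 : IsSimplyLacedAffine (ofEdges [1, 1] [edge 0 1 2 2])
  | A (n : ℕ) (hn : 2 ≤ n) : IsSimplyLacedAffine (abelianCycle n (fun _ => 1) (fun _ => 1))
  | D (r : ℕ) : IsSimplyLacedAffine (affD r 1 1 1 1)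
  | E6 : IsSimplyLacedAffine (affE6 1 1 1)
  | E7 : IsSimplyLacedAffine (affE7 1 1)
  | E8 : IsSimplyLacedAffine (affE8 1)

/-- The classification list. The parameters on edges that meet a vertex of weight one and are
directed away from it are subject to the coprimality conditions shown. -/
inductive IsListed : {W : Type} → QuiverData W → Prop
  -- Abelian quivers
  | A (N ℓ : ℕ) (hN : 2 ≤ N) (hℓ : 1 ≤ ℓ) : IsListed (ofEdges [1, 1] [edge 0 1 (N * ℓ) N])
  | h (n : ℕ) (ℓ k : ℕ → ℕ) (hn : 1 ≤ n) (pos : ∀ i < n, 1 ≤ ℓ i ∧ 1 ≤ k i)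
      (hδ : 1 < Nat.gcd (ℓ 0) (k (n - 1)))
      (cop : ∀ i j, i ≤ j → j < n → ¬(i = 0 ∧ j = n - 1) → Nat.Coprime (ℓ i) (k j)) :
      IsListed (abelianPath n ℓ k)
  | hbar (n : ℕ) (ℓ k : ℕ → ℕ) (hn : 2 ≤ n) (pos : ∀ i ≤ n, 1 ≤ ℓ i ∧ 1 ≤ k i)
      (len : ∏ i ∈ Finset.range (n + 1), k i = ∏ i ∈ Finset.range (n + 1), ℓ i)
      (cop : ∀ i ≤ n, ∀ j ≤ n, ¬(i ≡ j + 1 [MOD n + 1]) → ¬(i ≡ j + 2 [MOD n + 1]) →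
        Nat.Coprime (ℓ i) (k j)) :
      IsListed (abelianCycle n ℓ k)
  -- Affine Dynkin quivers
  | twA2even (r a : ℕ) (ha : Nat.Coprime a 2) : IsListed (twA2even r a)
  | twA2odd (r a b : ℕ) (ha : Nat.Coprime a 2) (hb : Nat.Coprime b 2) (hab : Nat.Coprime a b) :
      IsListed (twA2odd r a b)
  | affB (r a b c : ℕ) (pos : 1 ≤ a ∧ 1 ≤ b) (hc : Nat.Coprime c 2)
      (cop : [a, b, c].Pairwise Nat.Coprime) : IsListed (affB r a b c)
  | affD (r a b c d : ℕ) (pos : 1 ≤ a ∧ 1 ≤ b ∧ 1 ≤ c ∧ 1 ≤ d)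
      (cop : [a, b, c, d].Pairwise Nat.Coprime) : IsListed (affD r a b c d)
  | twD (r a b : ℕ) (ha : Nat.Coprime a 2) (hb : Nat.Coprime b 2) (hab : Nat.Coprime a b) :
      IsListed (twD r a b)
  | twD4 (a : ℕ) (ha : Nat.Coprime a 3) :
      IsListed (ofEdges [1, 2, 3] [edge 0 1 a 1, edge 2 1 3 1])
  | affE6 (a b c : ℕ) (pos : 1 ≤ a ∧ 1 ≤ b ∧ 1 ≤ c) (cop : [a, b, c].Pairwise Nat.Coprime) :
      IsListed (affE6 a b c)
  | twE6 (a : ℕ) (ha : Nat.Coprime a 2) :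
      IsListed (ofEdges [2, 4, 3, 2, 1] [edge 0 1 1 1, edge 1 2 2 1, edge 2 3 1 1, edge 4 3 a 1])
  | affE7 (a b : ℕ) (pos : 1 ≤ a ∧ 1 ≤ b) (cop : Nat.Coprime a b) : IsListed (affE7 a b)
  | affE8 (a : ℕ) (pos : 1 ≤ a) : IsListed (affE8 a)
  | affF4 (a b : ℕ) (pos : 1 ≤ a) (hb : Nat.Coprime b 2) (cop : Nat.Coprime a b) :
      IsListed (ofEdges [1, 2, 3, 2, 1] [edge 0 1 a 1, edge 1 2 1 1, edge 2 3 2 1, edge 4 3 b 1])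
  | affG2 (a b : ℕ) (pos : 1 ≤ a) (hb : Nat.Coprime b 3) (cop : Nat.Coprime a b) :
      IsListed (ofEdges [1, 2, 1] [edge 0 1 a 1, edge 1 2 3 b])
  -- Other non-Abelian quivers
  | D (g : ℕ) (hg : 1 ≤ g) : IsListed (oneVertex 2 g)
  | Y (ℓ a : ℕ) (hℓ : 4 ≤ ℓ) (ha : Nat.Coprime a ℓ) : IsListed (ofEdges [1, 2] [edge 0 1 a ℓ])
  | gc (r : ℕ) : IsListed (gc r)
  | gc1 : IsListed gc1
  | gb (r a : ℕ) (ha : Nat.Coprime a 6) : IsListed (gb r a)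
  | gd (r a b : ℕ) (ha : Nat.Coprime a 3) (hb : Nat.Coprime b 3) (hab : Nat.Coprime a b) :
      IsListed (gd r a b)
  | J23 (a b : ℕ) (ha : Nat.Coprime a 2) (hb : Nat.Coprime b 3) (hab : Nat.Coprime a b) :
      IsListed (ofEdges [1, 2, 1] [edge 0 1 a 2, edge 1 2 3 b])
  | J33 (a b : ℕ) (ha : Nat.Coprime a 3) (hb : Nat.Coprime b 3) (hab : Nat.Coprime a b) :
      IsListed (ofEdges [1, 2, 1] [edge 0 1 a 3, edge 1 2 3 b])

/-! ### Good quivers and decay products -/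

namespace GenQuiver

variable {V : Type*} [Fintype V] [DecidableEq V]

/-- `Q` is `N · A_0^{(1)}` with `N ≥ 2` (one vertex of weight `N` with one loop), or `N · X` with
`N ≥ 1` and `X` a simply laced affine Dynkin quiver. -/
def IsMultipleOfAffine (Q : GenQuiver V) : Prop :=
  (∃ N, 2 ≤ N ∧ Q.toQuiverData.Iso (oneVertex N 1)) ∨
  (∃ N, 1 ≤ N ∧ ∃ (W : Type) (X : QuiverData W), IsSimplyLacedAffine X ∧
    Q.toQuiverData.Iso (X.mul N))

/-- Good connected (in particular non-empty) quivers. -/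
def IsGoodConnected (Q : GenQuiver V) : Prop :=
  Q.graph.Connected ∧ (Q.HilbertGood ∨ Q.IsMultipleOfAffine)

open Classical in
/-- The weight function of the connected component of `x`. -/
def componentWeight (Q : GenQuiver V) (x : V) : V → ℕ :=
  fun y => if Q.graph.Reachable x y then Q.K y else 0

/-- A non-empty quiver is good if all its connected components are good. -/
def IsGood (Q : GenQuiver V) : Prop :=
  Nonempty V ∧ ∀ x, (Q.sub (Q.componentWeight x)).IsGoodConnected

/-- Fission products, as multisets of weight functions of subquivers. -/
def IsFissionProduct (Q : GenQuiver V) (s : Multiset (V → ℕ)) : Prop :=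
  (∀ K' ∈ s, K' ≤ Q.K ∧ (Q.sub K').IsGoodConnected) ∧ s.sum ≤ Q.K

/-- The subquiver with weight function `K'` is a decay product of `Q`. -/
def IsDecayProduct (Q : GenQuiver V) (K' : V → ℕ) : Prop := Q.IsFissionProduct {K'}

/-- `Q` has a decay product isomorphic to `R`. -/
def Decays {W : Type*} (Q : GenQuiver V) (R : QuiverData W) : Prop :=
  ∃ K' : V → ℕ, Q.IsDecayProduct K' ∧ (Q.sub K').toQuiverData.Iso R

end GenQuiver

end CoulombQuiver

end

noncomputable section

namespace CoulombQuiver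

open Filter Topology

/-! A connected component of `Q` is good, so it is enough to find a listed quiver inside a connected
good quiver and to know that listed quivers are good themselves (`isGoodConnected_of_isListed`). A
multiple of a simply laced affine quiver contains that affine quiver, and a vertex of weight at
least two with a loop contains `oneVertex 2 1`. The substance is therefore the case where the
Hilbert series satisfies the analytic condition.

Goodness is translated into values of Δ. All monopole terms are positive and Δ is homogeneous with
integral values. Convergence forces Δ > 0 off ℤL (`confDim_pos_of_summable`), and the missing linear
term then excludes Δ = 1 (`confDim_ne_one`), so Δ ≥ 2 there (`HilbertGood.two_le`). Conversely, Δ ≥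
2 together with linear growth modulo ℤL gives goodness (`hilbertGood_of_growth`).

Listed quivers are good because their balances ∑ A(x,y) K(y) are non-negative. Slicing a vector into
its level sets writes Δ as a sum of quadratic forms that are visibly non-negative and vanish only on
constant layers (`layer_bound`). This yields the growth, hence `hilbertGood_of_balance`, as soon as
Δ = 1 is excluded. When all balances are even, Δ is even by the parity formula `exists_confDim_eq`.
The remaining families are stars with a centre of weight two (`confDim_ne_one_of_star`) and Abelian
paths and cycles, where Δ = 1 would mean that exactly one edge is unbalanced, by one.

For the converse (`hasListed_of_hilbertGood`), suppose no listed quiver is contained. There are no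
loops, and Δ ≥ 2 on unit vectors makes the balance non-negative at weights at least two: this is
`IsBare`. Absence of the Abelian cycles and paths makes every walk without backtracking an induced
path (`IsNonBack.induced`) whose inward end labels are coprime (`coprime_of_induced`). So the graph
is a forest, and any locally injective map of a labelled tree is an embedding (`contains_of_tree`);
the arithmetic conditions of the list come for free. A fork or a multiple edge at a vertex is a
"feature", and two features at the ends of a spine close up to a classical family
(`not_isFeature_isFeature`).

Along a chain leaving a feature, non-negative balance makes the weights convex. They must drop
strictly at the first step, since otherwise the chain never ends (`weight_lt`), and the later drops
are no larger, so the chain is as long as the first drop permits (`exists_leg`). Comparing drops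
produces the exceptional affine quivers (`not_in3`, `not_in2`, `not_fork_of_le`). With those
excluded, a vertex of maximal weight at least two would start an endless walk, so all weights are
one (`weight_eq_one`). On an Abelian tree a Bézout relation at a leaf gives a vector with Δ = 1
(`IsBare.exists_confDim_eq_one`), a contradiction. -/

theorem hasSum_of_eq {α β : Type*} [AddCommMonoid α] [TopologicalSpace α] {f g : β → α} {a : α}
    (h : ∀ b, g b = f b) (hf : HasSum f a) : HasSum g a := by
  rwa [show g = f from funext h]

/-! ### Functions given by power series on (0, 1) -/

/-- `φ` is the sum of a power series on `(0, 1)`. -/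
def HasSeries (φ : ℝ → ℝ) : Prop :=
  ∃ c : ℕ → ℝ, ∀ x ∈ Set.Ioo (0 : ℝ) 1, HasSum (fun j => c j * x ^ j) (φ x)

namespace HasSeries

theorem const (r : ℝ) : HasSeries fun _ => r := by
  refine ⟨fun j => if j = 0 then r else 0, fun x _ => ?_⟩
  convert hasSum_ite_eq (0 : ℕ) r using 2 with j
  by_cases h : j = 0 <;> simp [h]

theorem id : HasSeries fun x => x := by
  refine ⟨fun j => if j = 1 then 1 else 0, fun x _ => ?_⟩
  convert hasSum_ite_eq (1 : ℕ) x using 2 with j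
  by_cases h : j = 1 <;> simp [h]

theorem add {φ ψ : ℝ → ℝ} (hφ : HasSeries φ) (hψ : HasSeries ψ) :
    HasSeries fun x => φ x + ψ x := by
  obtain ⟨c, hc⟩ := hφ
  obtain ⟨d, hd⟩ := hψ
  refine ⟨fun j => c j + d j, fun x hx => ?_⟩
  simpa [add_mul] using (hc x hx).add (hd x hx)

theorem mul {φ ψ : ℝ → ℝ} (hφ : HasSeries φ) (hψ : HasSeries ψ) :
    HasSeries fun x => φ x * ψ x := by
  obtain ⟨c, hc⟩ := hφ
  obtain ⟨d, hd⟩ := hψ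
  refine ⟨fun n => ∑ p ∈ Finset.HasAntidiagonal.antidiagonal n, c p.1 * d p.2, fun x hx => ?_⟩
  have h1 := (hc x hx).summable.norm
  have h2 := (hd x hx).summable.norm
  have h3 := (summable_norm_sum_mul_antidiagonal_of_summable_norm h1 h2).of_norm.hasSum
  rw [← tsum_mul_tsum_eq_tsum_sum_antidiagonal_of_summable_norm h1 h2, (hc x hx).tsum_eq,
    (hd x hx).tsum_eq] at h3
  have h4 : (fun n => (∑ p ∈ Finset.HasAntidiagonal.antidiagonal n, c p.1 * d p.2) * x ^ n) =
      fun n => ∑ p ∈ Finset.HasAntidiagonal.antidiagonal n,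
        c p.1 * x ^ p.1 * (d p.2 * x ^ p.2) := by
    funext n
    rw [Finset.sum_mul]
    refine Finset.sum_congr rfl fun p hp => ?_
    rw [← Finset.HasAntidiagonal.mem_antidiagonal.1 hp, pow_add]
    ring
  rw [h4]
  exact h3

theorem congr {φ ψ : ℝ → ℝ} (hφ : HasSeries φ) (h : ∀ x ∈ Set.Ioo (0 : ℝ) 1, ψ x = φ x) :
    HasSeries ψ := by
  obtain ⟨c, hc⟩ := hφ
  exact ⟨c, fun x hx => by rw [h x hx]; exact hc x hx⟩

theorem pow {φ : ℝ → ℝ} (hφ : HasSeries φ) (n : ℕ) : HasSeries fun x => φ x ^ n := by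
  induction n with
  | zero => simpa using const 1
  | succ n ih => simpa [pow_succ] using ih.mul hφ

theorem sum {ι : Type*} (s : Finset ι) {φ : ι → ℝ → ℝ} (h : ∀ i ∈ s, HasSeries (φ i)) :
    HasSeries fun x => ∑ i ∈ s, φ i x := by
  classical
  induction s using Finset.induction_on with
  | empty => simpa using const 0
  | insert a s ha ih =>
    simp only [Finset.sum_insert ha]
    exact (h a (by simp)).add (ih fun i hi => h i (by simp [hi]))

theorem prod {ι : Type*} (s : Finset ι) {φ : ι → ℝ → ℝ} (h : ∀ i ∈ s, HasSeries (φ i)) :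
    HasSeries fun x => ∏ i ∈ s, φ i x := by
  classical
  induction s using Finset.induction_on with
  | empty => simpa using const 1
  | insert a s ha ih =>
    simp only [Finset.prod_insert ha]
    exact (h a (by simp)).mul (ih fun i hi => h i (by simp [hi]))

theorem inv_one_sub_pow {N : ℕ} (hN : 0 < N) : HasSeries fun x => (1 - x ^ N)⁻¹ := by
  refine ⟨fun j => if N ∣ j then 1 else 0, fun x hx => ?_⟩
  have h1 : x ^ N < 1 := pow_lt_one₀ hx.1.le hx.2 hN.ne'
  have h2 := hasSum_geometric_of_lt_one (pow_nonneg hx.1.le N) h1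
  have hinj : Function.Injective fun n : ℕ => N * n := fun a b h =>
    Nat.eq_of_mul_eq_mul_left hN h
  rw [← hinj.hasSum_iff (f := fun j => (if N ∣ j then (1 : ℝ) else 0) * x ^ j)]
  · convert h2 using 2 with n
    simp [pow_mul]
  · intro j hj
    rw [if_neg, zero_mul]
    rintro ⟨k, rfl⟩
    exact hj ⟨k, rfl⟩

theorem det {ι : Type*} [Fintype ι] [DecidableEq ι] {M : ℝ → Matrix ι ι ℝ}
    (h : ∀ i j, HasSeries fun x => M x i j) : HasSeries fun x => (M x).det := by
  simp only [Matrix.det_apply']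
  exact sum _ fun σ _ => (const _).mul (prod _ fun i _ => h _ _)

end HasSeries

/-! ### Determinants of `1 - x w` for permutation matrices -/

section Perm

variable {ι : Type*} [Fintype ι] [DecidableEq ι]

theorem permMatrix_pow_card (w : Equiv.Perm ι) :
    (w.permMatrix ℝ) ^ Fintype.card (Equiv.Perm ι) = 1 := by
  have key : ∀ n : ℕ, (w.permMatrix ℝ) ^ n = (w ^ n).permMatrix ℝ := by
    intro n
    induction n with
    | zero => simp
    | succ n ih => rw [pow_succ, ih, pow_succ', Matrix.permMatrix_mul]
  rw [key, pow_card_eq_one, Matrix.permMatrix_one]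

/-- Telescoping geometric sum, using w ^ N = 1 for N the order of the symmetric group. It exhibits 1
/ det(1 - x w) as a polynomial times a power of the geometric series 1 / (1 - x ^ N). -/
theorem det_mul_det_geom (w : Equiv.Perm ι) (x : ℝ) :
    (1 - x • w.permMatrix ℝ).det *
      (∑ i ∈ Finset.range (Fintype.card (Equiv.Perm ι)), (x • w.permMatrix ℝ) ^ i).det =
      (1 - x ^ Fintype.card (Equiv.Perm ι)) ^ Fintype.card ι := by
  rw [← Matrix.det_mul, mul_neg_geom_sum, smul_pow, permMatrix_pow_card]
  rw [show (1 : Matrix ι ι ℝ) - x ^ Fintype.card (Equiv.Perm ι) • 1 =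
    (1 - x ^ Fintype.card (Equiv.Perm ι)) • 1 by rw [sub_smul, one_smul]]
  rw [Matrix.det_smul, Matrix.det_one, mul_one]

theorem one_sub_pow_card_pos {x : ℝ} (h0 : 0 ≤ x) (h1 : x < 1) :
    0 < (1 - x ^ Fintype.card (Equiv.Perm ι)) := by
  have := pow_lt_one₀ h0 h1 (Fintype.card_ne_zero (α := Equiv.Perm ι))
  linarith

theorem continuous_det_perm (w : Equiv.Perm ι) :
    Continuous fun x : ℝ => (1 - x • w.permMatrix ℝ).det := by
  fun_prop

/-- By `det_mul_det_geom` the determinant has no zero on [0, 1), and it equals 1 at 0; the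
intermediate value theorem does the rest. -/
theorem det_perm_pos (w : Equiv.Perm ι) {x : ℝ} (h0 : 0 ≤ x) (h1 : x < 1) :
    0 < (1 - x • w.permMatrix ℝ).det := by
  have hne : ∀ y : ℝ, 0 ≤ y → y < 1 → (1 - y • w.permMatrix ℝ).det ≠ 0 := by
    intro y hy0 hy1 h
    have := det_mul_det_geom w y
    rw [h, zero_mul] at this
    exact (pow_pos (one_sub_pow_card_pos (ι := ι) hy0 hy1) _).ne this
  by_contra hneg
  push Not at hneg
  have hcont := (continuous_det_perm w).continuousOn (s := Set.Icc 0 x)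
  have := intermediate_value_Icc' h0 hcont
  obtain ⟨y, hy, hy0⟩ := this ⟨hneg, by simp⟩
  exact hne y hy.1 (hy.2.trans_lt h1) hy0

theorem hasSeries_inv_det (w : Equiv.Perm ι) :
    HasSeries fun x => 1 / (1 - x • w.permMatrix ℝ).det := by
  set N := Fintype.card (Equiv.Perm ι) with hN
  have h1 : HasSeries fun x =>
      (∑ i ∈ Finset.range N, (x • w.permMatrix ℝ) ^ i).det := by
    refine HasSeries.det fun i j => ?_
    simp only [Matrix.sum_apply, smul_pow, Matrix.smul_apply, smul_eq_mul]
    exact HasSeries.sum _ fun k _ => (HasSeries.id.pow k).mul (HasSeries.const _)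
  have h2 := (HasSeries.inv_one_sub_pow (N := N) Fintype.card_pos).pow (Fintype.card ι)
  refine (h1.mul h2).congr fun x hx => ?_
  have h3 := det_mul_det_geom w x
  have h4 := (det_perm_pos w hx.1.le hx.2).ne'
  have h5 := (pow_pos (one_sub_pow_card_pos (ι := ι) hx.1.le hx.2) (Fintype.card ι)).ne'
  rw [inv_pow, ← hN] at *
  field_simp
  rw [← h3]

end Perm

/-! ### Coefficients read off near zero -/

/-- The tail at t is dominated by (2t) ^ n times the absolute tail at 1/2. -/
theorem series_tail_bound {a : ℕ → ℝ} {f : ℝ → ℝ}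
    (h : ∀ t ∈ Set.Ioo (0 : ℝ) 1, HasSum (fun n => a n * t ^ n) (f t)) (n : ℕ) :
    ∃ M : ℝ, 0 ≤ M ∧ ∀ t : ℝ, 0 < t → t ≤ 1 / 2 →
      |f t - ∑ k ∈ Finset.range n, a k * t ^ k| ≤ M * t ^ n := by
  have h1 := (h (1 / 2) ⟨by norm_num, by norm_num⟩).summable.norm
  have h2 := (summable_nat_add_iff n).2 h1
  refine ⟨2 ^ n * ∑' j, ‖a (j + n) * (1 / 2) ^ (j + n)‖,
    mul_nonneg (by positivity) (tsum_nonneg fun _ => norm_nonneg _), fun t ht0 ht1 => ?_⟩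
  have h3 := (hasSum_nat_add_iff' n).2 (h t ⟨ht0, by linarith⟩)
  rw [← h3.tsum_eq, ← Real.norm_eq_abs]
  have h4 : ∀ j, ‖a (j + n) * t ^ (j + n)‖ ≤
      (2 ^ n * t ^ n) * ‖a (j + n) * (1 / 2) ^ (j + n)‖ := by
    intro j
    rw [norm_mul, norm_mul, norm_pow, norm_pow, Real.norm_of_nonneg ht0.le,
      Real.norm_of_nonneg (by norm_num : (0 : ℝ) ≤ 1 / 2), pow_add, pow_add]
    have h5 : t ^ j ≤ (1 / 2) ^ j := pow_le_pow_left₀ ht0.le ht1 j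
    have h6 : (2 : ℝ) ^ n * (1 / 2) ^ n = 1 := by rw [← mul_pow]; norm_num
    calc ‖a (j + n)‖ * (t ^ j * t ^ n) ≤ ‖a (j + n)‖ * ((1 / 2) ^ j * t ^ n) := by gcongr
      _ = (2 ^ n * (1 / 2) ^ n) * (‖a (j + n)‖ * ((1 / 2) ^ j * t ^ n)) := by rw [h6, one_mul]
      _ = _ := by ring
  have h7 := tsum_of_norm_bounded ((h2.mul_left (2 ^ n * t ^ n)).hasSum) h4
  rw [tsum_mul_left] at h7
  linarith

/-- Uniqueness of coefficients by strong induction: once the earlier terms cancel, the defect of the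
n-th coefficient times t ^ n is O(t ^ (n + 1)). -/
theorem eq_zero_of_hasSum_const {a : ℕ → ℝ} {r : ℝ}
    (h : ∀ t ∈ Set.Ioo (0 : ℝ) 1, HasSum (fun n => a n * t ^ n) r) :
    ∀ n, 1 ≤ n → a n = 0 := by
  have key : ∀ n, a n = if n = 0 then r else 0 := by
    intro n
    induction n using Nat.strong_induction_on with
    | _ n ih =>
      obtain ⟨M, hM, hb⟩ := series_tail_bound h (n + 1)
      have h1 : ∀ t : ℝ, 0 < t → t ≤ 1 / 2 →
          |(if n = 0 then r else 0) - a n| ≤ M * t := by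
        intro t h0 ht
        have h2 := hb t h0 ht
        rw [Finset.sum_range_succ] at h2
        have h3 : r - (∑ k ∈ Finset.range n, a k * t ^ k + a n * t ^ n) =
            ((if n = 0 then r else 0) - a n) * t ^ n := by
          rcases Nat.eq_zero_or_pos n with rfl | hn
          · simp
          · have : ∑ k ∈ Finset.range n, a k * t ^ k = r := by
              rw [Finset.sum_eq_single_of_mem 0 (by simpa using hn)]
              · rw [ih 0 hn]; simp
              · intro b hb hb0
                rw [ih b (by simpa using hb), if_neg hb0, zero_mul]
            rw [this, if_neg hn.ne']
            ring
        rw [h3, abs_mul, abs_of_pos (pow_pos h0 n), pow_succ] at h2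
        have h4 : 0 < t ^ n := pow_pos h0 n
        refine le_of_mul_le_mul_right ?_ h4
        linarith
      by_contra hne
      have h5 : 0 < |(if n = 0 then r else 0) - a n| := abs_pos.2 (sub_ne_zero.2 (Ne.symm hne))
      set d := |(if n = 0 then r else 0) - a n|
      have h6 := h1 (min (1 / 2) (d / (2 * (M + 1)))) (by positivity) (min_le_left _ _)
      have h7 : M * min (1 / 2) (d / (2 * (M + 1))) ≤ M * (d / (2 * (M + 1))) :=
        mul_le_mul_of_nonneg_left (min_le_right _ _) hM
      have h8 : M * (d / (2 * (M + 1))) < d := by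
        rw [← mul_div_assoc, div_lt_iff₀ (by positivity)]
        nlinarith
      linarith
  intro n hn
  rw [key n, if_neg (by omega)]

end CoulombQuiver
end

noncomputable section

namespace CoulombQuiver

/-! ### Monopole terms: homogeneity, positivity, summability -/

namespace GenQuiver

variable {V : Type*}

theorem perm_one (Q : GenQuiver V) : Weyl.perm (1 : Q.Weyl) = 1 := by
  ext i : 1
  rfl

variable [Fintype V]

theorem confDim_nsmul (Q : GenQuiver V) (k : ℕ) (m : Q.Lattice) :
    Q.confDim (k • m) = k * Q.confDim m := by
  unfold confDim
  rw [mul_left_comm]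
  congr 1
  simp only [Finset.mul_sum]
  refine Finset.sum_congr rfl fun x _ => Finset.sum_congr rfl fun y _ => ?_
  refine Finset.sum_congr rfl fun a _ => Finset.sum_congr rfl fun b _ => ?_
  have : (k • m) ⟨x, a⟩ * Q.A x y - (k • m) ⟨y, b⟩ * Q.A y x =
      k * (m ⟨x, a⟩ * Q.A x y - m ⟨y, b⟩ * Q.A y x) := by
    simp only [Pi.smul_apply, nsmul_eq_mul]
    ring
  rw [this, abs_mul]
  push_cast
  simp only [Nat.abs_cast]
  ring

theorem confDim_zero (Q : GenQuiver V) : Q.confDim 0 = 0 := by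
  have := Q.confDim_nsmul 0 0
  simpa using this

/-- The subgroup ℤL is saturated because the entries of L have gcd 1. Hence the multiples of a
vector outside ℤL stay distinct modulo ℤL. -/
theorem Shift.mem_of_nsmul_mem {Q : GenQuiver V} (S : Q.Shift) {k : ℕ} (hk : k ≠ 0)
    {m : Q.Lattice} (h : k • m ∈ AddSubgroup.zmultiples S.vec) :
    m ∈ AddSubgroup.zmultiples S.vec := by
  obtain ⟨j, hj⟩ := AddSubgroup.mem_zmultiples_iff.1 h
  have hj' : ∀ i : Q.Index, j * (S.L i.1 : ℤ) = k * m i := fun i => by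
    have := congrFun hj i
    simpa [Shift.vec] using this
  have h1 : k ∣ j.natAbs := by
    have h2 : k ∣ Finset.univ.gcd fun x => j.natAbs * S.L x := by
      refine Finset.dvd_gcd fun x _ => ?_
      have h3 := hj' ⟨x, ⟨0, Q.K_pos x⟩⟩
      have h4 : (k : ℤ) ∣ j * S.L x := ⟨_, h3⟩
      have h5 := Int.natAbs_dvd_natAbs.2 h4
      simpa [Int.natAbs_mul] using h5
    rw [Finset.gcd_mul_left, S.primitive] at h2
    simpa using h2
  obtain ⟨i, rfl⟩ : (k : ℤ) ∣ j := Int.natCast_dvd.2 h1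
  refine AddSubgroup.mem_zmultiples_iff.2 ⟨i, funext fun x => ?_⟩
  have h2 := hj' x
  have h3 : (k : ℤ) ≠ 0 := by exact_mod_cast hk
  have h4 : i * (S.L x.1 : ℤ) = m x := mul_left_cancel₀ h3 (by rw [← h2]; ring)
  simpa [Shift.vec] using h4

variable [DecidableEq V]

/-- The factor `(1 / |W|) ∑_{w ∈ H} 1 / det (1 - x w)`. -/
def classicalFactor (Q : GenQuiver V) (H : Finset Q.Weyl) (x : ℝ) : ℝ :=
  (1 / (Fintype.card Q.Weyl : ℝ)) * ∑ w ∈ H, 1 / (1 - x • (w.perm.permMatrix ℝ)).det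

theorem monopoleTerm_eq (Q : GenQuiver V) (t : ℝ) (m : Q.Lattice) :
    Q.monopoleTerm t m = t ^ Q.confDim m * Q.classicalFactor (Q.stab m) (t ^ 2) := by
  unfold monopoleTerm classicalFactor
  rw [mul_left_comm]
  congr 1
  rw [Finset.mul_sum]
  exact Finset.sum_congr rfl fun w _ => (mul_one_div _ _).symm

theorem one_mem_stab (Q : GenQuiver V) (m : Q.Lattice) : (1 : Q.Weyl) ∈ Q.stab m :=
  Finset.mem_filter.2 ⟨Finset.mem_univ _, fun _ => rfl⟩

/-- Only the summand of the identity is kept; the others are positive by `det_perm_pos`. -/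
theorem le_classicalFactor (Q : GenQuiver V) {H : Finset Q.Weyl} (h1 : 1 ∈ H) {x : ℝ}
    (hx0 : 0 ≤ x) (hx1 : x < 1) :
    (1 / (Fintype.card Q.Weyl : ℝ)) * (1 / (1 - x) ^ Fintype.card Q.Index) ≤
      Q.classicalFactor H x := by
  unfold classicalFactor
  refine mul_le_mul_of_nonneg_left ?_ (by positivity)
  refine le_trans (le_of_eq ?_) (Finset.single_le_sum
    (f := fun w : Q.Weyl => 1 / (1 - x • (w.perm.permMatrix ℝ)).det)
    (fun w _ => (one_div_pos.2 (det_perm_pos _ hx0 hx1)).le) h1)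
  rw [perm_one, Matrix.permMatrix_one, show (1 : Matrix Q.Index Q.Index ℝ) - x • 1 =
    (1 - x) • 1 by rw [sub_smul, one_smul], Matrix.det_smul, Matrix.det_one, mul_one]

theorem inv_card_le_classicalFactor (Q : GenQuiver V) {H : Finset Q.Weyl} (h1 : 1 ∈ H) {x : ℝ}
    (hx0 : 0 ≤ x) (hx1 : x < 1) :
    1 / (Fintype.card Q.Weyl : ℝ) ≤ Q.classicalFactor H x := by
  refine le_trans ?_ (Q.le_classicalFactor h1 hx0 hx1)
  refine le_mul_of_one_le_right (by positivity) ?_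
  rw [le_div_iff₀ (pow_pos (by linarith) _), one_mul]
  exact pow_le_one₀ (by linarith) (by linarith)

theorem card_weyl_pos (Q : GenQuiver V) : 0 < 1 / (Fintype.card Q.Weyl : ℝ) :=
  one_div_pos.2 (by exact_mod_cast Fintype.card_pos)

theorem classicalFactor_mono (Q : GenQuiver V) (H : Finset Q.Weyl) {x : ℝ}
    (hx0 : 0 ≤ x) (hx1 : x < 1) : Q.classicalFactor H x ≤ Q.classicalFactor Finset.univ x := by
  unfold classicalFactor
  refine mul_le_mul_of_nonneg_left ?_ (by positivity)
  exact Finset.sum_le_sum_of_subset_of_nonneg (Finset.subset_univ _)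
    fun w _ _ => (one_div_pos.2 (det_perm_pos _ hx0 hx1)).le

theorem classicalFactor_pos (Q : GenQuiver V) (m : Q.Lattice) {x : ℝ}
    (hx0 : 0 ≤ x) (hx1 : x < 1) : 0 < Q.classicalFactor (Q.stab m) x :=
  Q.card_weyl_pos.trans_le (Q.inv_card_le_classicalFactor (Q.one_mem_stab m) hx0 hx1)

theorem hasSeries_classicalFactor (Q : GenQuiver V) (H : Finset Q.Weyl) :
    HasSeries (Q.classicalFactor H) :=
  (HasSeries.const _).mul (HasSeries.sum _ fun w _ => hasSeries_inv_det w.perm)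

theorem sq_mem_Ioo {t : ℝ} (ht : t ∈ Set.Ioo (0 : ℝ) 1) : t ^ 2 ∈ Set.Ioo (0 : ℝ) 1 :=
  ⟨pow_pos ht.1 2, pow_lt_one₀ ht.1.le ht.2 two_ne_zero⟩

theorem monopoleTerm_pos (Q : GenQuiver V) {t : ℝ} (ht : t ∈ Set.Ioo (0 : ℝ) 1)
    (m : Q.Lattice) : 0 < Q.monopoleTerm t m := by
  rw [monopoleTerm_eq]
  exact mul_pos (Real.rpow_pos_of_pos ht.1 _)
    (Q.classicalFactor_pos m (sq_mem_Ioo ht).1.le (sq_mem_Ioo ht).2)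

theorem monopoleTermQuot_mk (Q : GenQuiver V) (S : Q.Shift) (t : ℝ) (m : Q.Lattice) :
    Q.monopoleTermQuot S t (QuotientAddGroup.mk m) = Q.monopoleTerm t m := rfl

theorem monopoleTermQuot_pos (Q : GenQuiver V) (S : Q.Shift) {t : ℝ}
    (ht : t ∈ Set.Ioo (0 : ℝ) 1) (q : Q.Lattice ⧸ AddSubgroup.zmultiples S.vec) :
    0 < Q.monopoleTermQuot S t q := by
  obtain ⟨m, rfl⟩ := QuotientAddGroup.mk_surjective q
  exact Q.monopoleTerm_pos ht m

theorem summable_pow_natAbs {ρ : ℝ} (h0 : 0 ≤ ρ) (h1 : ρ < 1) :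
    Summable fun k : ℤ => ρ ^ k.natAbs := by
  have h2 := summable_geometric_of_lt_one h0 h1
  refine Summable.of_nat_of_neg ?_ ?_
  · exact h2
  · simpa only [Int.natAbs_neg, Int.natAbs_natCast] using h2

theorem summable_prod_of_nonneg {ι κ : Type*} [Fintype ι] {f : κ → ℝ} (h0 : ∀ k, 0 ≤ f k)
    (hs : Summable f) : Summable fun m : ι → κ => ∏ i, f (m i) := by
  classical
  refine summable_of_sum_le (c := ∏ _i : ι, ∑' k, f k)
    (fun m => Finset.prod_nonneg fun i _ => h0 _) fun s => ?_
  have h1 : ∑ m ∈ s, ∏ i, f (m i) ≤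
      ∑ m ∈ Fintype.piFinset (fun i => s.image fun m => m i), ∏ i, f (m i) := by
    refine Finset.sum_le_sum_of_subset_of_nonneg (fun m hm => ?_)
      fun m _ _ => Finset.prod_nonneg fun i _ => h0 _
    exact Fintype.mem_piFinset.2 fun i => Finset.mem_image_of_mem _ hm
  refine h1.trans ?_
  rw [← Finset.prod_univ_sum (fun i => s.image fun m => m i) fun _ k => f k]
  exact Finset.prod_le_prod (fun i _ => Finset.sum_nonneg fun k _ => h0 _)
    fun i _ => hs.sum_le_tsum _ fun k _ => h0 _

/-- Distinct representatives with coordinates linear in N q allow a comparison with a product of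
two-sided geometric series, one for each coordinate. -/
theorem summable_rpow_of_growth {ι κ : Type*} [Fintype ι] {rep : κ → ι → ℤ}
    (hinj : Function.Injective rep) {N : κ → ℕ} {C : ℝ}
    (hC : ∀ q i, |(rep q i : ℝ)| ≤ C * (N q + 1)) {t : ℝ} (ht : t ∈ Set.Ioo (0 : ℝ) 1) :
    Summable fun q => t ^ N q := by
  -- Large enough that the coordinates satisfy ∑ |rep q i| ≤ D (N q + 1), so t ^ (N q + 1) is at
  -- most ρ to that sum.
  set D : ℝ := (Fintype.card ι + 1) * (|C| + 1) with hD
  have hDpos : 0 < D := by positivity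
  set ρ : ℝ := t ^ (1 / D) with hρ
  have hρ0 : 0 < ρ := Real.rpow_pos_of_pos ht.1 _
  have hρ1 : ρ < 1 := Real.rpow_lt_one ht.1.le ht.2 (by positivity)
  have h1 := ((summable_prod_of_nonneg (ι := ι) (fun k => pow_nonneg hρ0.le _)
    (summable_pow_natAbs hρ0.le hρ1)).comp_injective hinj).mul_left t⁻¹
  refine Summable.of_nonneg_of_le (fun q => pow_nonneg ht.1.le _) (fun q => ?_) h1
  have h2 : ((∑ i, (rep q i).natAbs : ℕ) : ℝ) ≤ D * (N q + 1) := by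
    push_cast
    calc ∑ i, ((rep q i).natAbs : ℝ) ≤ ∑ _i : ι, (|C| + 1) * (N q + 1 : ℝ) := by
          refine Finset.sum_le_sum fun i _ => ?_
          have h3 := hC q i
          rw [Nat.cast_natAbs, Int.cast_abs]
          refine h3.trans (mul_le_mul_of_nonneg_right ?_ (by positivity))
          linarith [le_abs_self C]
      _ = Fintype.card ι * ((|C| + 1) * (N q + 1 : ℝ)) := by simp
      _ ≤ D * (N q + 1) := by
          rw [hD]
          have : 0 ≤ (|C| + 1) * (N q + 1 : ℝ) := by positivity
          nlinarith
  simp only [Function.comp]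
  rw [Finset.prod_pow_eq_pow_sum, inv_mul_eq_div, le_div_iff₀ ht.1, ← pow_succ,
    ← Real.rpow_natCast, ← Real.rpow_natCast, hρ, ← Real.rpow_mul ht.1.le]
  refine Real.rpow_le_rpow_of_exponent_ge ht.1 ht.2.le ?_
  rw [one_div, inv_mul_eq_div, div_le_iff₀ hDpos]
  push_cast at h2 ⊢
  linarith

end GenQuiver
-- Goodness in terms of the values of Δ
namespace GenQuiver

variable {V : Type*} [Fintype V] [DecidableEq V]

theorem monopoleTerm_eq_pow (Q : GenQuiver V) {m : Q.Lattice} {N : ℕ} (h : Q.confDim m = N)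
    (t : ℝ) : Q.monopoleTerm t m = t ^ N * Q.classicalFactor (Q.stab m) (t ^ 2) := by
  rw [monopoleTerm_eq, h, Real.rpow_natCast]

/-- This is the contribution of the zero vector alone. With at least two coordinates a pole at t = 1
survives the prefactor 1 - t ^ 2, so the series is unbounded and cannot be constant. -/
theorem one_le_mul_hilbertSeries {Q : GenQuiver V} {S : Q.Shift} {t : ℝ}
    (ht : t ∈ Set.Ioo (0 : ℝ) 1) (hs : Summable (Q.monopoleTermQuot S t))
    (hcard : 2 ≤ Fintype.card Q.Index) :
    (1 / (Fintype.card Q.Weyl : ℝ)) * (1 / (1 - t ^ 2)) ≤ Q.hilbertSeries S t := by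
  have hx := sq_mem_Ioo ht
  have h1 := hs.le_tsum (QuotientAddGroup.mk 0) fun q _ => (Q.monopoleTermQuot_pos S ht q).le
  rw [monopoleTermQuot_mk, Q.monopoleTerm_eq_pow (N := 0) (by simpa using Q.confDim_zero),
    pow_zero, one_mul] at h1
  have h2 := (Q.le_classicalFactor (Q.one_mem_stab 0) hx.1.le hx.2).trans h1
  have hpos : 0 < 1 - t ^ 2 := by linarith [hx.2]
  unfold hilbertSeries
  refine le_trans ?_ (mul_le_mul_of_nonneg_left h2 hpos.le)
  rw [mul_left_comm]
  refine mul_le_mul_of_nonneg_left ?_ (by positivity)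
  obtain ⟨d, hd⟩ := Nat.exists_eq_add_of_le hcard
  rw [hd, mul_one_div, div_le_div_iff₀ hpos (pow_pos hpos _), one_mul, pow_add, pow_two]
  have h3 : (1 - t ^ 2) ^ d ≤ 1 := pow_le_one₀ hpos.le (by linarith [hx.1])
  exact mul_le_of_le_one_right (mul_pos hpos hpos).le h3

/-- Each class contributes t ^ Δ times a power series in t ^ 2. The double series over classes and
powers converges absolutely, so it may be regrouped by the degree Δ + 2j, and degree one would
require Δ = 1. -/
theorem hilbertGood_of_growth (Q : GenQuiver V) (S : Q.Shift) (C : ℝ)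
    (hint : ∀ m, ∃ N : ℕ, Q.confDim m = N)
    (htwo : ∀ m ∉ AddSubgroup.zmultiples S.vec, 2 ≤ Q.confDim m)
    (hrep : ∀ m : Q.Lattice, ∃ m', -m + m' ∈ AddSubgroup.zmultiples S.vec ∧
      ∀ i, |(m' i : ℝ)| ≤ C * (Q.confDim m' + 1))
    (hcard : 2 ≤ Fintype.card Q.Index) : Q.HilbertGood := by
  classical
  have hrep' : ∀ q : Q.Lattice ⧸ AddSubgroup.zmultiples S.vec, ∃ m : Q.Lattice,
      QuotientAddGroup.mk m = q ∧ ∀ i, |(m i : ℝ)| ≤ C * (Q.confDim m + 1) := by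
    intro q
    obtain ⟨m, rfl⟩ := QuotientAddGroup.mk_surjective q
    obtain ⟨m', h1, h2⟩ := hrep m
    exact ⟨m', (QuotientAddGroup.eq.2 h1).symm, h2⟩
  choose rep hmk hbound using hrep'
  choose N hN using hint
  have hinj : Function.Injective rep := fun p q h => by rw [← hmk p, ← hmk q, h]
  have hpow : ∀ t ∈ Set.Ioo (0 : ℝ) 1, Summable fun q => t ^ N (rep q) := fun t ht =>
    summable_rpow_of_growth hinj (C := C) (fun q i => by rw [← hN]; exact hbound q i) ht
  have hterm : ∀ t q, Q.monopoleTermQuot S t q =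
      t ^ N (rep q) * Q.classicalFactor (Q.stab (rep q)) (t ^ 2) := by
    intro t q
    rw [← Q.monopoleTerm_eq_pow (hN _), ← monopoleTermQuot_mk Q S t, hmk]
  have hsum : ∀ t ∈ Set.Ioo (0 : ℝ) 1, Summable (Q.monopoleTermQuot S t) := by
    intro t ht
    refine Summable.of_nonneg_of_le (fun q => (Q.monopoleTermQuot_pos S ht q).le) (fun q => ?_)
      ((hpow t ht).mul_right (Q.classicalFactor Finset.univ (t ^ 2)))
    rw [hterm]
    exact mul_le_mul_of_nonneg_left
      (Q.classicalFactor_mono _ (sq_mem_Ioo ht).1.le (sq_mem_Ioo ht).2) (pow_nonneg ht.1.le _)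
  have hser : ∀ H : Finset Q.Weyl, HasSeries fun x => (1 - x) * Q.classicalFactor H x := by
    intro H
    refine (((HasSeries.const 1).add ((HasSeries.const (-1)).mul HasSeries.id)).mul
      (Q.hasSeries_classicalFactor H)).congr fun x _ => by ring
  choose c hc using hser
  let deg : (Q.Lattice ⧸ AddSubgroup.zmultiples S.vec) × ℕ → ℕ := fun p => N (rep p.1) + 2 * p.2
  let co : (Q.Lattice ⧸ AddSubgroup.zmultiples S.vec) × ℕ → ℝ :=
    fun p => c (Q.stab (rep p.1)) p.2
  have hmain : ∀ t ∈ Set.Ioo (0 : ℝ) 1,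
      HasSum (fun p => co p * t ^ deg p) (Q.hilbertSeries S t) := by
    intro t ht
    have hfib : ∀ q, HasSum (fun j => co (q, j) * t ^ deg (q, j))
        ((1 - t ^ 2) * Q.monopoleTermQuot S t q) := by
      intro q
      have h1 := (hc (Q.stab (rep q)) _ (sq_mem_Ioo ht)).mul_left (t ^ N (rep q))
      rw [hterm, mul_left_comm]
      refine hasSum_of_eq (fun j => ?_) h1
      simp only [co, deg, pow_add, pow_mul]
      ring
    -- Only finitely many stabilizers exist, so the sum over all of them is one majorant for the
    -- coefficients of every class.
    have hG : Summable fun j => ∑ H : Finset Q.Weyl, |c H j| * (t ^ 2) ^ j := by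
      refine summable_sum fun H _ => ?_
      have h1 := (hc H _ (sq_mem_Ioo ht)).summable.norm
      refine h1.congr fun j => ?_
      rw [norm_mul, Real.norm_eq_abs, norm_pow, Real.norm_of_nonneg (sq_mem_Ioo ht).1.le]
    have hs : Summable fun p => co p * t ^ deg p := by
      refine Summable.of_norm_bounded ((hpow t ht).mul_of_nonneg hG (fun q => pow_nonneg ht.1.le _)
        fun j => Finset.sum_nonneg fun H _ => mul_nonneg (abs_nonneg _) (by positivity)) ?_
      rintro ⟨q, j⟩
      simp only [co, deg]
      rw [norm_mul, Real.norm_eq_abs, norm_pow, Real.norm_of_nonneg ht.1.le, pow_add, pow_mul]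
      have h1 := Finset.single_le_sum (f := fun H : Finset Q.Weyl => |c H j| * (t ^ 2) ^ j)
        (fun H _ => mul_nonneg (abs_nonneg _) (by positivity))
        (Finset.mem_univ (Q.stab (rep q)))
      calc _ = t ^ N (rep q) * (|c (Q.stab (rep q)) j| * (t ^ 2) ^ j) := by ring
        _ ≤ _ := mul_le_mul_of_nonneg_left h1 (pow_nonneg ht.1.le _)
    have h2 := hs.hasSum.prod_fiberwise hfib
    unfold hilbertSeries
    rw [← tsum_mul_left, h2.tsum_eq]
    exact hs.hasSum
  have ha : ∀ t ∈ Set.Ioo (0 : ℝ) 1, HasSum (fun n => (∑' p : deg ⁻¹' {n}, co p) * t ^ n)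
      (Q.hilbertSeries S t) := by
    intro t ht
    have h1 := (hmain t ht).tsum_fiberwise deg
    refine hasSum_of_eq (fun n => ?_) h1
    rw [← tsum_mul_right]
    exact tsum_congr fun p => by rw [show deg p = n from p.2]
  refine ⟨S, hsum, _, ha, ?_, ?_⟩
  · by_contra! hzero
    set W : ℝ := (Fintype.card Q.Weyl : ℝ) with hW
    have hWpos : 0 < W := by
      rw [hW]
      exact_mod_cast Fintype.card_pos (α := Q.Weyl)
    set a0 := ∑' p : deg ⁻¹' {0}, co p
    have hconst : ∀ t ∈ Set.Ioo (0 : ℝ) 1, Q.hilbertSeries S t = a0 := by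
      intro t ht
      refine (ha t ht).unique ?_
      have := hasSum_single (f := fun n => (∑' p : deg ⁻¹' {n}, co p) * t ^ n) 0
        fun n hn => by simp only [hzero n (Nat.one_le_iff_ne_zero.2 hn), zero_mul]
      simpa using this
    -- For 1 - t ^ 2 = ε the lower bound 1 / (W ε) exceeds |a0|; the summand 2 only ensures ε < 1.
    set ε : ℝ := 1 / (2 + W * (|a0| + 1)) with hε
    have hden : 2 < 2 + W * (|a0| + 1) := by
      have : 0 < W * (|a0| + 1) := by positivity
      linarith
    have hε0 : 0 < ε := by positivity
    have hε1 : ε < 1 := by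
      rw [hε, div_lt_one (by linarith)]
      linarith
    have ht : √(1 - ε) ∈ Set.Ioo (0 : ℝ) 1 := by
      refine ⟨Real.sqrt_pos.2 (by linarith), ?_⟩
      rw [Real.sqrt_lt' one_pos]
      linarith
    have h1 := one_le_mul_hilbertSeries ht (hsum _ ht) hcard
    rw [hconst _ ht, Real.sq_sqrt (by linarith), sub_sub_cancel, hε, one_div_one_div, ← hW,
      one_div_mul_eq_div, div_le_iff₀ hWpos] at h1
    have h2 : a0 * W ≤ |a0| * W := mul_le_mul_of_nonneg_right (le_abs_self _) hWpos.le
    nlinarith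
  -- Classes in ℤL have Δ = 0 and all others Δ ≥ 2, so Δ + 2j = 1 has no solution.
  · have hempty : IsEmpty (deg ⁻¹' {1}) := by
      refine ⟨fun ⟨⟨q, j⟩, hp⟩ => ?_⟩
      have hp' : N (rep q) + 2 * j = 1 := hp
      by_cases hm : rep q ∈ AddSubgroup.zmultiples S.vec
      · obtain ⟨k, hk⟩ := AddSubgroup.mem_zmultiples_iff.1 hm
        have h1 := Q.confDim_add_shift S k 0
        rw [add_zero, hk, confDim_zero, hN] at h1
        have h2 : N (rep q) = 0 := by exact_mod_cast h1
        omega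
      · have h1 := htwo _ hm
        rw [hN] at h1
        have h2 : 2 ≤ N (rep q) := by exact_mod_cast h1
        omega
    exact tsum_empty

/-- If Δ(m) ≤ 0, homogeneity gives Δ ≤ 0 on all positive multiples of m. These are distinct modulo
ℤL and each contributes at least 1/|W|, so the terms do not tend to zero. -/
theorem confDim_pos_of_summable (Q : GenQuiver V) (S : Q.Shift) {t : ℝ}
    (ht : t ∈ Set.Ioo (0 : ℝ) 1) (hs : Summable (Q.monopoleTermQuot S t)) {m : Q.Lattice}
    (hm : m ∉ AddSubgroup.zmultiples S.vec) : 0 < Q.confDim m := by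
  by_contra! hneg
  let f : ℕ → Q.Lattice ⧸ AddSubgroup.zmultiples S.vec :=
    fun k => QuotientAddGroup.mk ((k + 1) • m)
  have haux : ∀ a b : ℕ, a < b → f a ≠ f b := by
    intro a b hab h
    have h1 := QuotientAddGroup.eq.1 h
    refine hm (S.mem_of_nsmul_mem (k := b - a) (by omega) ?_)
    convert h1 using 1
    obtain ⟨d, rfl⟩ := Nat.exists_eq_add_of_lt hab
    rw [show a + d + 1 - a = d + 1 by omega, show a + d + 1 + 1 = (a + 1) + (d + 1) by omega,
      add_nsmul (m) (a + 1)]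
    abel
  have hinj : Function.Injective f := by
    intro a b h
    rcases lt_trichotomy a b with h1 | h1 | h1
    · exact absurd h (haux a b h1)
    · exact h1
    · exact absurd h.symm (haux b a h1)
  have h1 := (hs.comp_injective hinj).tendsto_atTop_zero
  have h2 : ∀ k, 1 / (Fintype.card Q.Weyl : ℝ) ≤ (Q.monopoleTermQuot S t ∘ f) k := by
    intro k
    have hx := sq_mem_Ioo ht
    simp only [Function.comp, f]
    rw [monopoleTermQuot_mk, monopoleTerm_eq]
    refine (Q.inv_card_le_classicalFactor (Q.one_mem_stab ((k + 1) • m)) hx.1.le hx.2).trans ?_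
    refine le_mul_of_one_le_left (Q.classicalFactor_pos _ hx.1.le hx.2).le ?_
    refine Real.one_le_rpow_of_pos_of_le_one_of_nonpos ht.1 ht.2.le ?_
    rw [confDim_nsmul]
    exact mul_nonpos_of_nonneg_of_nonpos (by positivity) hneg
  have h3 := ge_of_tendsto' h1 h2
  linarith [Q.card_weyl_pos]

/-- The zero vector contributes a series in t ^ 2, and the whole series has no linear term. A vector
with Δ = 1 would add at least a positive multiple of t, which no O(t ^ 2) error can absorb once the
constant terms are compared. -/
theorem confDim_ne_one (Q : GenQuiver V) (S : Q.Shift)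
    (hpos : ∀ m ∉ AddSubgroup.zmultiples S.vec, 1 ≤ Q.confDim m)
    (hs : ∀ t ∈ Set.Ioo (0 : ℝ) 1, Summable (Q.monopoleTermQuot S t)) {a : ℕ → ℝ}
    (ha : ∀ t ∈ Set.Ioo (0 : ℝ) 1, HasSum (fun n => a n * t ^ n) (Q.hilbertSeries S t))
    (ha1 : a 1 = 0) {m : Q.Lattice} (hm : m ∉ AddSubgroup.zmultiples S.vec) :
    Q.confDim m ≠ 1 := by
  classical
  intro hone
  set κ : ℝ := 1 / (Fintype.card Q.Weyl : ℝ)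
  have hκ : 0 < κ := Q.card_weyl_pos
  obtain ⟨M, hM, hHS⟩ := series_tail_bound ha 2
  have hser0 : HasSeries fun x => (1 - x) * Q.classicalFactor (Q.stab 0) x :=
    (((HasSeries.const 1).add ((HasSeries.const (-1)).mul HasSeries.id)).mul
      (Q.hasSeries_classicalFactor _)).congr fun x _ => by ring
  obtain ⟨c, hc⟩ := hser0
  obtain ⟨M1, hM1, hc1⟩ := series_tail_bound hc 1
  obtain ⟨d, hd⟩ := Q.hasSeries_classicalFactor Finset.univ
  obtain ⟨M2, hM2, hd2⟩ := series_tail_bound hd 0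
  set Z := ∑' q, Q.monopoleTermQuot S (1 / 2) q with hZ
  have hhalf : (1 / 2 : ℝ) ∈ Set.Ioo (0 : ℝ) 1 := ⟨by norm_num, by norm_num⟩
  have hZ0 : 0 ≤ Z := tsum_nonneg fun q => (Q.monopoleTermQuot_pos S hhalf q).le
  have hmk0 : (QuotientAddGroup.mk 0 : Q.Lattice ⧸ AddSubgroup.zmultiples S.vec) ≠
      QuotientAddGroup.mk m := by
    intro h
    have := QuotientAddGroup.eq.1 h
    rw [neg_zero, zero_add] at this
    exact hm this
  -- Two-sided estimate of the contribution of all nonzero classes. The factor 3/4 bounds 1 - t ^ 2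
  -- from below for t ≤ 1/2.
  have hbounds : ∀ t : ℝ, 0 < t → t ≤ 1 / 2 →
      (3 / 4 * κ) * t ≤ (a 0 - c 0) + (M + M1) * t ^ 2 ∧
      a 0 - c 0 ≤ (2 * M2 * (1 / κ) * Z) * t + (M + M1) * t ^ 2 := by
    intro t ht0 ht1
    have ht : t ∈ Set.Ioo (0 : ℝ) 1 := ⟨ht0, by linarith⟩
    have hx := sq_mem_Ioo ht
    have hx4 : t ^ 2 ≤ 1 / 4 := by nlinarith
    have h1 := abs_le.1 (hHS t ht0 ht1)
    simp only [Finset.sum_range_succ, Finset.sum_range_zero, ha1, pow_zero, mul_one,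
      zero_add, zero_mul, add_zero] at h1
    have h2 := abs_le.1 (hc1 (t ^ 2) hx.1 (by linarith))
    simp only [Finset.sum_range_succ, Finset.sum_range_zero, pow_zero, mul_one,
      zero_add, pow_one] at h2
    have h3 := hd2 (t ^ 2) hx.1 (by linarith)
    simp only [Finset.sum_range_zero, pow_zero, mul_one, sub_zero] at h3
    have h3' := (le_abs_self _).trans h3
    have hT0 : Q.monopoleTermQuot S t (QuotientAddGroup.mk 0) =
        Q.classicalFactor (Q.stab 0) (t ^ 2) := by
      rw [monopoleTermQuot_mk, Q.monopoleTerm_eq_pow (N := 0) (by simpa using Q.confDim_zero),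
        pow_zero, one_mul]
    have hTm : t * κ ≤ Q.monopoleTermQuot S t (QuotientAddGroup.mk m) := by
      rw [monopoleTermQuot_mk, Q.monopoleTerm_eq_pow (N := 1) (by simpa using hone), pow_one]
      exact mul_le_mul_of_nonneg_left
        (Q.inv_card_le_classicalFactor (Q.one_mem_stab m) hx.1.le hx.2) ht0.le
    have hlow : Q.classicalFactor (Q.stab 0) (t ^ 2) + t * κ ≤
        ∑' q, Q.monopoleTermQuot S t q := by
      have h4 := (hs t ht).sum_le_tsum {QuotientAddGroup.mk 0, QuotientAddGroup.mk m}
        fun q _ => (Q.monopoleTermQuot_pos S ht q).le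
      rw [Finset.sum_pair hmk0, hT0] at h4
      linarith
    have hup : ∑' q, Q.monopoleTermQuot S t q ≤
        Q.classicalFactor (Q.stab 0) (t ^ 2) + (2 * M2 * (1 / κ) * t) * Z := by
      have h5 := (hasSum_ite_eq (QuotientAddGroup.mk 0 :
        Q.Lattice ⧸ AddSubgroup.zmultiples S.vec) (Q.classicalFactor (Q.stab 0) (t ^ 2))).add
        ((hs _ hhalf).hasSum.mul_left (2 * M2 * (1 / κ) * t))
      refine hasSum_le (fun q => ?_) (hs t ht).hasSum h5
      by_cases hq : q = QuotientAddGroup.mk 0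
      · rw [if_pos hq, hq, hT0]
        have := (Q.monopoleTermQuot_pos S hhalf (QuotientAddGroup.mk 0)).le
        have h6 : 0 ≤ 2 * M2 * (1 / κ) * t := by positivity
        nlinarith
      · rw [if_neg hq, zero_add]
        obtain ⟨m', rfl⟩ := QuotientAddGroup.mk_surjective q
        have hm' : m' ∉ AddSubgroup.zmultiples S.vec := by
          intro h
          refine hq (QuotientAddGroup.eq.2 ?_)
          rw [add_zero]
          exact neg_mem h
        have hΔ := hpos m' hm'
        rw [monopoleTermQuot_mk, monopoleTermQuot_mk, monopoleTerm_eq, monopoleTerm_eq]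
        -- Since Δ ≥ 1 and 2t ≤ 1, the term at t is at most 2t times the term at 1/2, so the nonzero
        -- classes contribute O(t).
        have h6 : t ^ Q.confDim m' ≤ (2 * t) * (1 / 2) ^ Q.confDim m' := by
          have h7 : t = (2 * t) * (1 / 2) := by ring
          nth_rewrite 1 [h7]
          rw [Real.mul_rpow (by positivity) (by norm_num)]
          refine mul_le_mul_of_nonneg_right ?_ (by positivity)
          nth_rewrite 2 [← Real.rpow_one (2 * t)]
          exact Real.rpow_le_rpow_of_exponent_ge (by positivity) (by linarith) hΔ
        have h8 : Q.classicalFactor (Q.stab m') (t ^ 2) ≤ M2 :=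
          (Q.classicalFactor_mono _ hx.1.le hx.2).trans h3'
        have h9 : κ ≤ Q.classicalFactor (Q.stab m') ((1 / 2) ^ 2) :=
          Q.inv_card_le_classicalFactor (Q.one_mem_stab m') (by norm_num) (by norm_num)
        calc t ^ Q.confDim m' * Q.classicalFactor (Q.stab m') (t ^ 2)
            ≤ ((2 * t) * (1 / 2) ^ Q.confDim m') * M2 := by
              refine mul_le_mul h6 h8 (Q.classicalFactor_pos _ hx.1.le hx.2).le (by positivity)
          _ = (2 * M2 * (1 / κ) * t) * ((1 / 2) ^ Q.confDim m' * κ) := by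
              field_simp
          _ ≤ _ := by
              refine mul_le_mul_of_nonneg_left ?_ (by positivity)
              exact mul_le_mul_of_nonneg_left h9 (by positivity)
    have hHSdef : Q.hilbertSeries S t = (1 - t ^ 2) * ∑' q, Q.monopoleTermQuot S t q := rfl
    have h10 := mul_le_mul_of_nonneg_left hlow (by linarith : 0 ≤ 1 - t ^ 2)
    have h11 := mul_le_mul_of_nonneg_left hup (by linarith : 0 ≤ 1 - t ^ 2)
    have h12 : 0 ≤ 2 * M2 * (1 / κ) * t * Z := by positivity
    have h13 : 0 < t * κ := by positivity
    constructor
    · nlinarith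
    · nlinarith
  set δ := a 0 - c 0 with hδ
  set E := 2 * M2 * (1 / κ) * Z with hE
  have hE0 : 0 ≤ E := by positivity
  -- Letting t tend to zero in the upper estimate. The lower estimate then fails as soon as t is
  -- small compared with κ / (M + M1).
  have hδ0 : δ ≤ 0 := by
    by_contra! hpos'
    have h0 : 0 < min (1 / 2) (δ / (2 * (E + (M + M1) + 1))) := by positivity
    have h1 := (hbounds _ h0 (min_le_left _ _)).2
    set t := min (1 / 2) (δ / (2 * (E + (M + M1) + 1))) with ht
    have h2 : t ≤ 1 / 2 := min_le_left _ _
    have h3 : t ≤ δ / (2 * (E + (M + M1) + 1)) := min_le_right _ _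
    rw [le_div_iff₀ (by positivity)] at h3
    have h4 : t ^ 2 ≤ t := by nlinarith
    have h5 : (M + M1) * t ^ 2 ≤ (M + M1) * t := mul_le_mul_of_nonneg_left h4 (by positivity)
    nlinarith
  have h0 : 0 < min (1 / 2) (κ / (2 * (M + M1 + 1))) := by positivity
  have h1 := (hbounds _ h0 (min_le_left _ _)).1
  set t := min (1 / 2) (κ / (2 * (M + M1 + 1))) with ht
  have h3 : t ≤ κ / (2 * (M + M1 + 1)) := min_le_right _ _
  rw [le_div_iff₀ (by positivity)] at h3
  have h4 : (3 / 4 * κ) * t ≤ ((M + M1) * t) * t := by nlinarith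
  have h5 := le_of_mul_le_mul_right h4 h0
  nlinarith

/-- For a single vertex of weight one the quotient by ℤL is a point and the series is the constant
1; the empty quiver has no shift vector because an empty gcd is 0. -/
theorem nontrivial_of_abelian {Q : GenQuiver V} (hQ : Q.HilbertGood) (hK : ∀ x, Q.K x = 1) :
    Nontrivial V := by
  by_contra hV
  rw [not_nontrivial_iff_subsingleton] at hV
  obtain ⟨S, hs, a, ha, ⟨n, hn, hne⟩, -⟩ := hQ
  have hx : ∃ x : V, True := by
    by_contra! h
    have : IsEmpty V := ⟨fun x => h x⟩
    have h1 := S.primitive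
    rw [Finset.univ_eq_empty, Finset.gcd_empty] at h1
    exact zero_ne_one h1
  obtain ⟨x, -⟩ := hx
  let u : Unique V := { default := x, uniq := fun _ => Subsingleton.elim _ _ }
  have hL : S.L x = 1 := by
    have h1 := S.primitive
    rw [Finset.univ_unique, Finset.gcd_singleton, normalize_eq] at h1
    exact h1
  have hI : ∀ i : Q.Index, i = ⟨x, ⟨0, Q.K_pos x⟩⟩ := by
    rintro ⟨y, k, hk⟩
    obtain rfl : y = x := Subsingleton.elim _ _
    have := hK y
    congr
    omega
  let uI : Unique Q.Index := { default := ⟨x, ⟨0, Q.K_pos x⟩⟩, uniq := hI }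
  have hW : ∀ w : Q.Weyl, w = 1 := by
    intro w
    funext y
    have : Subsingleton (Fin (Q.K y)) := by rw [hK y]; infer_instance
    exact Subsingleton.elim _ _
  have hq : ∀ q : Q.Lattice ⧸ AddSubgroup.zmultiples S.vec, q = QuotientAddGroup.mk 0 := by
    intro q
    obtain ⟨m, rfl⟩ := QuotientAddGroup.mk_surjective q
    refine QuotientAddGroup.eq.2 ?_
    rw [add_zero]
    refine neg_mem (AddSubgroup.mem_zmultiples_iff.2 ⟨m default, funext fun i => ?_⟩)
    rw [Unique.eq_default i]
    have : S.L (default : Q.Index).1 = 1 := hL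
    simp [Shift.vec, this]
  refine hne (eq_zero_of_hasSum_const (r := 1) (fun t ht => ?_) n hn)
  convert ha t ht using 1
  unfold hilbertSeries
  rw [tsum_eq_single (QuotientAddGroup.mk 0) fun q h => absurd (hq q) h, monopoleTermQuot_mk,
    Q.monopoleTerm_eq_pow (N := 0) (by simpa using Q.confDim_zero)]
  unfold classicalFactor
  have h1 : Q.stab 0 = {1} := by
    ext w
    rw [hW w]
    simp [Q.one_mem_stab 0]
  have h2 : Fintype.card Q.Weyl = 1 := Fintype.card_eq_one_iff.2 ⟨1, hW⟩
  have h3 : (1 - t ^ 2 : ℝ) ≠ 0 := by linarith [(sq_mem_Ioo ht).2]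
  rw [h1, h2, Finset.sum_singleton, perm_one, Matrix.permMatrix_one, Matrix.det_unique]
  simp [h3]

end GenQuiver

/-! ### Integrality and parity of Δ -/

/-- A linear order on V selects one of each pair (x, y), (y, x), which cancels the factor 1/2 in Δ;
only the selecting relation is exposed. -/
theorem sum_sum_symm {V M : Type*} [Fintype V] [AddCommMonoid M] (f : V → V → M)
    (hf : ∀ x y, f x y = f y x) :
    ∃ r : V → V → Prop, ∃ _ : DecidableRel r, (∀ x y, x ≠ y → (r x y ↔ ¬ r y x)) ∧
      (∀ x, ¬ r x x) ∧
      ∑ x, ∑ y, f x y = ∑ x, f x x + (∑ x, ∑ y, (if r x y then f x y else 0) +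
        ∑ x, ∑ y, if r x y then f x y else 0) := by
  classical
  let e := Fintype.equivFin V
  refine ⟨fun x y => e x < e y, fun x y => inferInstance, fun x y h => ?_, fun x => lt_irrefl _, ?_⟩
  · have : e x ≠ e y := fun h' => h (e.injective h')
    rw [not_lt]
    exact ⟨le_of_lt, fun h' => lt_of_le_of_ne h' this⟩
  · have h1 : ∀ x y, f x y = (if x = y then f x x else 0) +
        ((if e x < e y then f x y else 0) + if e y < e x then f y x else 0) := by
      intro x y
      rcases lt_trichotomy (e x) (e y) with h | h | h
      · have hne : x ≠ y := fun h' => by simp [h'] at h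
        simp [hne, h, h.le.not_gt]
      · obtain rfl := e.injective h
        simp
      · have hne : x ≠ y := fun h' => by simp [h'] at h
        simp [hne, h, h.le.not_gt, hf x y]
    conv_lhs => enter [2, x, 2, y]; rw [h1]
    simp only [Finset.sum_add_distrib]
    congr 1
    · exact Finset.sum_congr rfl fun x _ => by simp
    · congr 1
      exact Finset.sum_comm

/-- `∑ y, A x y * K y`. -/
def QuiverData.balance {V : Type*} [Fintype V] (R : QuiverData V) (x : V) : ℤ :=
  ∑ y, R.A x y * R.K y

namespace GenQuiver

section

variable {V : Type*}

/-- `∑ a b, |m (x, a) * A x y - m (y, b) * A y x|`. -/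
def pairSum (Q : GenQuiver V) (m : Q.Lattice) (x y : V) : ℤ :=
  ∑ a : Fin (Q.K x), ∑ b : Fin (Q.K y), |m ⟨x, a⟩ * Q.A x y - m ⟨y, b⟩ * Q.A y x|

theorem pairSum_comm (Q : GenQuiver V) (m : Q.Lattice) (x y : V) :
    Q.pairSum m x y = Q.pairSum m y x := by
  unfold pairSum
  rw [Finset.sum_comm]
  exact Finset.sum_congr rfl fun b _ => Finset.sum_congr rfl fun a _ => abs_sub_comm _ _

theorem sign_comm (Q : GenQuiver V) (x y : V) : (Q.A x y).sign = (Q.A y x).sign := by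
  by_cases h : x = y
  · rw [h]
  · have h1 := Q.offdiag_nonneg x y h
    have h2 := Q.offdiag_nonneg y x (Ne.symm h)
    by_cases h0 : Q.A x y = 0
    · rw [h0, Q.zero_of_zero h0]
    · have h0' : Q.A y x ≠ 0 := fun h' => h0 (Q.zero_of_zero h')
      rw [Int.sign_eq_one_of_pos (by omega), Int.sign_eq_one_of_pos (by omega)]

theorem sign_mul_pairSum_of_ne (Q : GenQuiver V) (m : Q.Lattice) {x y : V} (h : x ≠ y) :
    (Q.A x y).sign * Q.pairSum m x y = Q.pairSum m x y := by
  by_cases h0 : Q.A x y = 0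
  · simp [pairSum, h0, Q.zero_of_zero h0]
  · have h1 := Q.offdiag_nonneg x y h
    rw [Int.sign_eq_one_of_pos (by omega), one_mul]

theorem pairSum_nonneg (Q : GenQuiver V) (m : Q.Lattice) (x y : V) : 0 ≤ Q.pairSum m x y :=
  Finset.sum_nonneg fun _ _ => Finset.sum_nonneg fun _ _ => abs_nonneg _

theorem sign_mul_pairSum_self (Q : GenQuiver V) (m : Q.Lattice) (x : V) :
    (Q.A x x).sign * Q.pairSum m x x =
      Q.A x x * ∑ a : Fin (Q.K x), ∑ b : Fin (Q.K x), |m ⟨x, a⟩ - m ⟨x, b⟩| := by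
  unfold pairSum
  simp only [Finset.mul_sum]
  refine Finset.sum_congr rfl fun a _ => Finset.sum_congr rfl fun b _ => ?_
  rw [← sub_mul, abs_mul, mul_left_comm, Int.sign_mul_abs, mul_comm]

theorem intCast_abs_sub_zmod_two (a b : ℤ) :
    ((|a - b| : ℤ) : ZMod 2) = (a : ZMod 2) + (b : ZMod 2) := by
  rcases abs_choice (a - b) with h | h <;> rw [h]
  · rw [Int.cast_sub, sub_eq_add_neg, ZMod.neg_eq_self_mod_two]
  · rw [neg_sub, Int.cast_sub, sub_eq_add_neg, ZMod.neg_eq_self_mod_two, add_comm]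

theorem add_self_zmod_two (a : ZMod 2) : a + a = 0 := CharTwo.add_self_eq_zero a

theorem even_sum_abs {n : ℕ} (f : Fin n → ℤ) : Even (∑ a, ∑ b, |f a - f b|) := by
  obtain ⟨r, _, -, -, h⟩ := sum_sum_symm (fun a b => |f a - f b|) fun a b => abs_sub_comm _ _
  rw [h]
  simp only [sub_self, abs_zero, Finset.sum_const_zero, zero_add]
  exact ⟨_, rfl⟩

theorem even_diag (Q : GenQuiver V) (x : V) : Even (Q.A x x) := by
  obtain ⟨g, hg⟩ := Q.loops x
  exact ⟨g - 1, by rw [hg]; ring⟩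

variable [Fintype V]

theorem confDim_eq_pairSum (Q : GenQuiver V) (m : Q.Lattice) :
    Q.confDim m = (1 / 2) * ((∑ x, ∑ y, (Q.A x y).sign * Q.pairSum m x y : ℤ) : ℝ) := by
  unfold confDim pairSum
  push_cast
  rfl

/-- Modulo 2 one has |a - b| = a + b, so an edge between x and y contributes A(x,y) K(y) ∑ m_x +
A(y,x) K(x) ∑ m_y. The diagonal contribution is even because both A(x,x) and the double sum of |m_a
- m_b| are even. Collecting by vertices gives the balances. -/
theorem exists_confDim_eq (Q : GenQuiver V) (m : Q.Lattice) :
    ∃ z : ℤ, Q.confDim m = z ∧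
      (z : ZMod 2) = ((∑ x, Q.toQuiverData.balance x * ∑ a, m ⟨x, a⟩ : ℤ) : ZMod 2) := by
  classical
  obtain ⟨r, _, hr, hrr, h⟩ := sum_sum_symm (fun x y => (Q.A x y).sign * Q.pairSum m x y)
    fun x y => by rw [Q.sign_comm, Q.pairSum_comm]
  have hdiag : ∀ x, ∃ d : ℤ, (Q.A x x).sign * Q.pairSum m x x = 2 * (2 * d) := by
    intro x
    obtain ⟨k, hk⟩ := Q.even_diag x
    obtain ⟨l, hl⟩ := even_sum_abs fun a => m ⟨x, a⟩
    refine ⟨k * l, ?_⟩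
    rw [Q.sign_mul_pairSum_self, hk, hl]
    ring
  choose d hd using hdiag
  set T := ∑ x, ∑ y, (if r x y then (Q.A x y).sign * Q.pairSum m x y else 0) with hT
  refine ⟨∑ x, 2 * d x + T, ?_, ?_⟩
  · rw [confDim_eq_pairSum, h, Finset.sum_congr rfl fun x _ => hd x, ← Finset.mul_sum]
    push_cast
    ring
  · have h1 : (T : ZMod 2) = ∑ x, ∑ y, if x = y then 0 else
        ((Q.A x y * Q.K y * ∑ a, m ⟨x, a⟩ : ℤ) : ZMod 2) := by
      have h2 : ∀ x y, x ≠ y → (((Q.A x y).sign * Q.pairSum m x y : ℤ) : ZMod 2) =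
          ((Q.A x y * Q.K y * ∑ a, m ⟨x, a⟩ : ℤ) : ZMod 2) +
          ((Q.A y x * Q.K x * ∑ a, m ⟨y, a⟩ : ℤ) : ZMod 2) := by
        intro x y hxy
        rw [Q.sign_mul_pairSum_of_ne m hxy]
        unfold pairSum
        push_cast
        simp only [intCast_abs_sub_zmod_two, Finset.sum_add_distrib, Finset.sum_const,
          Finset.card_univ, Fintype.card_fin, nsmul_eq_mul, Finset.mul_sum, Int.cast_mul]
        congr 1
        · exact Finset.sum_congr rfl fun a _ => by ring
        · exact Finset.sum_congr rfl fun a _ => by ring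
      rw [hT]
      push_cast
      have h3 : ∀ x y, (if r x y then (((Q.A x y).sign : ℤ) : ZMod 2) * (Q.pairSum m x y : ZMod 2)
          else 0) = (if r x y then ((Q.A x y * Q.K y * ∑ a, m ⟨x, a⟩ : ℤ) : ZMod 2) else 0) +
          if r x y then ((Q.A y x * Q.K x * ∑ a, m ⟨y, a⟩ : ℤ) : ZMod 2) else 0 := by
        intro x y
        by_cases hxy : r x y
        · have hne : x ≠ y := fun h' => hrr y (h' ▸ hxy)
          simp only [if_pos hxy]
          rw [← h2 x y hne]
          push_cast
          rfl
        · simp [hxy]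
      have h4 : ∀ x y, (if x = y then 0 else ((Q.A x y * Q.K y * ∑ a, m ⟨x, a⟩ : ℤ) : ZMod 2)) =
          (if r x y then ((Q.A x y * Q.K y * ∑ a, m ⟨x, a⟩ : ℤ) : ZMod 2) else 0) +
          if r y x then ((Q.A x y * Q.K y * ∑ a, m ⟨x, a⟩ : ℤ) : ZMod 2) else 0 := by
        intro x y
        by_cases hxy : x = y
        · subst hxy
          simp [hrr]
        · by_cases h5 : r x y
          · simp [hxy, h5, (hr x y hxy).1 h5]
          · have h6 : r y x := by
              by_contra h6
              exact h5 ((hr x y hxy).2 h6)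
            simp [hxy, h5, h6]
      have h5 : ∑ x, ∑ y, (if x = y then 0 else
          ((Q.A x y * Q.K y * ∑ a, m ⟨x, a⟩ : ℤ) : ZMod 2)) =
          ∑ x, ∑ y, (if r x y then ((Q.A x y * Q.K y * ∑ a, m ⟨x, a⟩ : ℤ) : ZMod 2) else 0) +
          ∑ x, ∑ y, if r x y then ((Q.A y x * Q.K x * ∑ a, m ⟨y, a⟩ : ℤ) : ZMod 2) else 0 := by
        simp only [h4, Finset.sum_add_distrib]
        congr 1
        exact Finset.sum_comm
      have h6 : ∀ x y, (if x = y then 0 else (Q.A x y : ZMod 2) * (Q.K y : ZMod 2) *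
          ∑ a, (m ⟨x, a⟩ : ZMod 2)) =
          if x = y then 0 else ((Q.A x y * Q.K y * ∑ a, m ⟨x, a⟩ : ℤ) : ZMod 2) := by
        intro x y
        push_cast
        rfl
      simp only [h6]
      rw [h5, ← Finset.sum_add_distrib]
      refine Finset.sum_congr rfl fun x _ => ?_
      rw [← Finset.sum_add_distrib]
      exact Finset.sum_congr rfl fun y _ => h3 x y
    have h7 : ((∑ x, 2 * d x : ℤ) : ZMod 2) = 0 := by
      rw [← Finset.mul_sum]
      push_cast
      rw [show (2 : ZMod 2) = 0 from rfl, zero_mul]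
    rw [Int.cast_add, h7, zero_add, h1, Int.cast_sum]
    refine Finset.sum_congr rfl fun x _ => ?_
    unfold QuiverData.balance
    rw [Finset.sum_mul, Int.cast_sum]
    refine Finset.sum_congr rfl fun y _ => ?_
    split_ifs with hxy
    · subst hxy
      obtain ⟨k, hk⟩ := Q.even_diag x
      rw [hk]
      push_cast
      rw [add_self_zmod_two, zero_mul, zero_mul]
    · rfl

theorem confDim_ne_one_of_even (Q : GenQuiver V)
    (h : ∀ x, Even (Q.toQuiverData.balance x)) (m : Q.Lattice) : Q.confDim m ≠ 1 := by
  intro h1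
  obtain ⟨z, hz, hz2⟩ := Q.exists_confDim_eq m
  obtain rfl : z = 1 := by
    rw [h1] at hz
    exact_mod_cast hz.symm
  have h2 : ((∑ x, Q.toQuiverData.balance x * ∑ a, m ⟨x, a⟩ : ℤ) : ZMod 2) = 0 := by
    rw [Int.cast_sum]
    refine Finset.sum_eq_zero fun x _ => ?_
    obtain ⟨k, hk⟩ := h x
    rw [hk]
    push_cast
    rw [add_self_zmod_two, zero_mul]
  rw [h2] at hz2
  exact absurd hz2 (by decide)

end

end GenQuiver
-- Level sets and the quadratic form of a layer
namespace GenQuiver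

/-- The absolute difference counts the thresholds s separating u from v. The square turns each layer
into a quadratic form in its indicator vector. -/
theorem abs_sub_eq_sum {u v l r : ℤ} (hu : l ≤ u ∧ u ≤ r) (hv : l ≤ v ∧ v ≤ r) :
    |u - v| = ∑ s ∈ Finset.Ico l r, ((if s < u then (1 : ℤ) else 0) - if s < v then 1 else 0) ^ 2 := by
  have key : ∀ u v : ℤ, l ≤ v → v ≤ u → u ≤ r → |u - v| =
      ∑ s ∈ Finset.Ico l r, ((if s < u then (1 : ℤ) else 0) - if s < v then 1 else 0) ^ 2 := by
    intro u v h1 h2 h3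
    have h4 : ∀ s, ((if s < u then (1 : ℤ) else 0) - if s < v then 1 else 0) ^ 2 =
        if v ≤ s ∧ s < u then 1 else 0 := by
      intro s
      split_ifs <;> first | rfl | omega
    simp only [h4]
    rw [Finset.sum_boole, abs_of_nonneg (by omega)]
    have h5 : (Finset.Ico l r).filter (fun s => v ≤ s ∧ s < u) = Finset.Ico v u := by
      ext s
      simp only [Finset.mem_filter, Finset.mem_Ico]
      omega
    rw [h5, Int.card_Ico]
    exact (Int.toNat_of_nonneg (by omega)).symm
  rcases le_total v u with h | h
  · exact key u v hv.1 h hu.2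
  · rw [abs_sub_comm, key v u hu.1 h hv.2]
    exact Finset.sum_congr rfl fun s _ => by ring

variable {V : Type*} [Fintype V]

/-- The wanted vector is proportional to 1/L: clear denominators with the product of all lengths and
divide by the gcd. -/
theorem exists_shift (Q : GenQuiver V) [Nonempty V] : Nonempty Q.Shift := by
  classical
  obtain ⟨L, hpos, hL⟩ := Q.length
  set P : V → ℕ := fun x => ∏ z ∈ Finset.univ.erase x, L z with hP
  have hPL : ∀ x, P x * L x = ∏ z, L z := fun x =>
    Finset.prod_erase_mul _ _ (Finset.mem_univ x)
  have hPpos : ∀ x, 0 < P x := fun x => Finset.prod_pos fun z _ => hpos z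
  obtain ⟨g, hg, hg1⟩ := Finset.extract_gcd P (Finset.univ_nonempty (α := V))
  set d := Finset.univ.gcd P with hd
  have hdpos : 0 < d := by
    rcases Nat.eq_zero_or_pos d with h | h
    · have x : V := Classical.arbitrary V
      have h1 := hg x (Finset.mem_univ x)
      have := hPpos x
      rw [h, zero_mul] at h1
      omega
    · exact h
  refine ⟨⟨g, fun x => ?_, fun x y => ?_, hg1⟩⟩
  · have h1 := hg x (Finset.mem_univ x)
    have h2 := hPpos x
    rw [h1] at h2
    exact Nat.pos_of_mul_pos_left h2
  · have h1 : (P x : ℤ) = d * g x := by exact_mod_cast hg x (Finset.mem_univ x)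
    have h2 : (P y : ℤ) = d * g y := by exact_mod_cast hg y (Finset.mem_univ y)
    have h3 : (P x : ℤ) * L x = P y * L y := by exact_mod_cast (hPL x).trans (hPL y).symm
    have h4 := hL x y
    have hx : (L x : ℤ) ≠ 0 := by exact_mod_cast (hpos x).ne'
    have hy : (L y : ℤ) ≠ 0 := by exact_mod_cast (hpos y).ne'
    have hd0 : (d : ℤ) ≠ 0 := by exact_mod_cast hdpos.ne'
    apply mul_left_cancel₀ (mul_ne_zero hd0 (mul_ne_zero hx hy))
    calc (d : ℤ) * (L x * L y) * (g x * Q.A x y) = (d * g x) * L x * (Q.A x y * L y) := by ring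
      _ = (d * g y) * L y * (Q.A y x * L x) := by rw [← h1, h3, h2, h4]
      _ = _ := by ring

/-- Let w(x) be the proportion of ones at x. The form becomes ∑ L(x) A(x,y) K(x) K(y) (w(x) - w(y))²
plus 2 ∑ L(x) K(x) w(x)(1 - w(x)) times the balance at x, so it is non-negative. If it vanishes,
connectedness makes w constant, and `hq` makes the constant 0 or 1. Proper multiples of affine
quivers show that some such condition is needed: there a fractional w has zero energy. -/
theorem layer_bound (Q : GenQuiver V) (S : Q.Shift) (hconn : Q.graph.Preconnected)
    (hbal : ∀ x, 0 ≤ Q.toQuiverData.balance x)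
    (hq : (∃ x, Q.K x = 1) ∨ ∃ x, 0 < Q.toQuiverData.balance x)
    (χ : Q.Index → ℤ) (hχ : ∀ i, χ i = 0 ∨ χ i = 1) :
    0 ≤ ∑ x, ∑ y, (S.L x * Q.A x y) *
      ∑ a : Fin (Q.K x), ∑ b : Fin (Q.K y), (χ ⟨x, a⟩ - χ ⟨y, b⟩) ^ 2 ∧
    (∑ x, ∑ y, (S.L x * Q.A x y) *
      ∑ a : Fin (Q.K x), ∑ b : Fin (Q.K y), (χ ⟨x, a⟩ - χ ⟨y, b⟩) ^ 2 ≤ 0 →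
      ∀ i j, χ i = χ j) := by
  set v : V → ℤ := fun x => ∑ a : Fin (Q.K x), χ ⟨x, a⟩ with hv
  set w : V → ℝ := fun x => v x / Q.K x with hw
  have hKpos : ∀ x, (0 : ℝ) < Q.K x := fun x => by exact_mod_cast Q.K_pos x
  have hvw : ∀ x, (v x : ℝ) = Q.K x * w x := fun x => by
    rw [hw]; field_simp [(hKpos x).ne']
  have hsq : ∀ i, χ i ^ 2 = χ i := fun i => by rcases hχ i with h | h <;> simp [h]
  have hv0 : ∀ x, 0 ≤ v x := fun x => Finset.sum_nonneg fun a _ => by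
    rcases hχ ⟨x, a⟩ with h | h <;> simp [h]
  have hvK : ∀ x, v x ≤ Q.K x := fun x => by
    have : v x ≤ ∑ _a : Fin (Q.K x), (1 : ℤ) := Finset.sum_le_sum fun a _ => by
      rcases hχ ⟨x, a⟩ with h | h <;> simp [h]
    simpa using this
  have hw0 : ∀ x, 0 ≤ w x := fun x => div_nonneg (by exact_mod_cast hv0 x) (hKpos x).le
  have hw1 : ∀ x, w x ≤ 1 := fun x => by
    rw [hw, div_le_one (hKpos x)]
    exact_mod_cast hvK x
  -- Averaged form of a + b - 2ab = (a - b)² + a(1 - a) + b(1 - b), valid since χ² = χ.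
  have hinner : ∀ x y, ((∑ a : Fin (Q.K x), ∑ b : Fin (Q.K y), (χ ⟨x, a⟩ - χ ⟨y, b⟩) ^ 2 : ℤ) : ℝ) =
      Q.K x * Q.K y * ((w x - w y) ^ 2 + w x * (1 - w x) + w y * (1 - w y)) := by
    intro x y
    have h1 : ∑ a : Fin (Q.K x), ∑ b : Fin (Q.K y), (χ ⟨x, a⟩ - χ ⟨y, b⟩) ^ 2 =
        Q.K y * v x + Q.K x * v y - 2 * (v x * v y) := by
      have h2 : ∀ a b, (χ ⟨x, a⟩ - χ ⟨y, b⟩) ^ 2 =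
          χ ⟨x, a⟩ + χ ⟨y, b⟩ - 2 * (χ ⟨x, a⟩ * χ ⟨y, b⟩) := fun a b => by
        linear_combination hsq ⟨x, a⟩ + hsq ⟨y, b⟩
      simp only [h2, Finset.sum_add_distrib, Finset.sum_sub_distrib, ← Finset.mul_sum,
        ← Finset.sum_mul, Finset.sum_const, Finset.card_univ, Fintype.card_fin, nsmul_eq_mul, hv]
    rw [h1]
    push_cast
    rw [hvw, hvw]
    ring
  have hBsymm : ∀ x y, ((S.L x * Q.A x y : ℤ) : ℝ) = ((S.L y * Q.A y x : ℤ) : ℝ) := fun x y => by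
    rw [S.eq]
  have hB0 : ∀ x y, x ≠ y → (0 : ℝ) ≤ ((S.L x * Q.A x y : ℤ) : ℝ) := fun x y h => by
    have := Q.offdiag_nonneg x y h
    exact_mod_cast mul_nonneg (by positivity) this
  have htotal : ((∑ x, ∑ y, (S.L x * Q.A x y) *
      ∑ a : Fin (Q.K x), ∑ b : Fin (Q.K y), (χ ⟨x, a⟩ - χ ⟨y, b⟩) ^ 2 : ℤ) : ℝ) =
      ∑ x, ∑ y, ((S.L x * Q.A x y : ℤ) : ℝ) * (Q.K x * Q.K y) * (w x - w y) ^ 2 +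
      2 * ∑ x, (S.L x * Q.K x * (w x * (1 - w x))) * (Q.toQuiverData.balance x : ℝ) := by
    have h1 : ∀ x, ∑ y, ((S.L x * Q.A x y : ℤ) : ℝ) * (Q.K x * Q.K y) * (w x * (1 - w x)) =
        (S.L x * Q.K x * (w x * (1 - w x))) * (Q.toQuiverData.balance x : ℝ) := by
      intro x
      unfold QuiverData.balance
      push_cast
      rw [Finset.mul_sum]
      exact Finset.sum_congr rfl fun y _ => by ring
    have h2 : ∑ x, ∑ y, ((S.L x * Q.A x y : ℤ) : ℝ) * (Q.K x * Q.K y) * (w y * (1 - w y)) =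
        ∑ x, (S.L x * Q.K x * (w x * (1 - w x))) * (Q.toQuiverData.balance x : ℝ) := by
      rw [Finset.sum_comm]
      refine Finset.sum_congr rfl fun x _ => ?_
      rw [← h1]
      refine Finset.sum_congr rfl fun y _ => ?_
      rw [hBsymm y x]
      ring
    rw [two_mul]
    nth_rewrite 1 [← h2]
    rw [← Finset.sum_congr rfl fun x _ => h1 x]
    push_cast [Int.cast_sum, ← Finset.sum_add_distrib]
    refine Finset.sum_congr rfl fun x _ => Finset.sum_congr rfl fun y _ => ?_
    have h3 := hinner x y
    push_cast at h3
    rw [h3]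
    ring
  have hT1 : ∀ x y, 0 ≤ ((S.L x * Q.A x y : ℤ) : ℝ) * (Q.K x * Q.K y) * (w x - w y) ^ 2 := by
    intro x y
    by_cases h : x = y
    · subst h; simp
    · exact mul_nonneg (mul_nonneg (hB0 x y h) (mul_pos (hKpos x) (hKpos y)).le) (sq_nonneg _)
  have hT2 : ∀ x, 0 ≤ (S.L x * Q.K x * (w x * (1 - w x))) * (Q.toQuiverData.balance x : ℝ) := by
    intro x
    have h1 : (0 : ℝ) ≤ Q.toQuiverData.balance x := by exact_mod_cast hbal x
    have h2 : 0 ≤ w x * (1 - w x) := mul_nonneg (hw0 x) (by linarith [hw1 x])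
    positivity
  have hS1 := Finset.sum_nonneg fun x (_ : x ∈ Finset.univ) =>
    Finset.sum_nonneg fun y (_ : y ∈ Finset.univ) => hT1 x y
  have hS2 := Finset.sum_nonneg fun x (_ : x ∈ Finset.univ) => hT2 x
  refine ⟨?_, fun hle => ?_⟩
  · have : (0 : ℝ) ≤ ((∑ x, ∑ y, (S.L x * Q.A x y) *
      ∑ a : Fin (Q.K x), ∑ b : Fin (Q.K y), (χ ⟨x, a⟩ - χ ⟨y, b⟩) ^ 2 : ℤ) : ℝ) := by
      rw [htotal]; linarith
    exact_mod_cast this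
  · have hle' : ((∑ x, ∑ y, (S.L x * Q.A x y) *
      ∑ a : Fin (Q.K x), ∑ b : Fin (Q.K y), (χ ⟨x, a⟩ - χ ⟨y, b⟩) ^ 2 : ℤ) : ℝ) ≤ 0 := by
      exact_mod_cast hle
    rw [htotal] at hle'
    have hS1' := le_antisymm (by linarith) hS1
    have hS2' := le_antisymm (by linarith) hS2
    have hz1 : ∀ x y, ((S.L x * Q.A x y : ℤ) : ℝ) * (Q.K x * Q.K y) * (w x - w y) ^ 2 = 0 := by
      intro x y
      have h1 := (Finset.sum_eq_zero_iff_of_nonneg fun x _ =>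
        Finset.sum_nonneg fun y (_ : y ∈ Finset.univ) => hT1 x y).1 hS1' x (Finset.mem_univ x)
      exact (Finset.sum_eq_zero_iff_of_nonneg fun y _ => hT1 x y).1 h1 y (Finset.mem_univ y)
    have hz2 : ∀ x, (S.L x * Q.K x * (w x * (1 - w x))) * (Q.toQuiverData.balance x : ℝ) = 0 :=
      fun x => (Finset.sum_eq_zero_iff_of_nonneg fun x _ => hT2 x).1 hS2' x (Finset.mem_univ x)
    have hadj : ∀ x y, Q.graph.Adj x y → w x = w y := by
      intro x y h
      have h1 : ((S.L x * Q.A x y : ℤ) : ℝ) ≠ 0 := by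
        exact_mod_cast mul_ne_zero (by exact_mod_cast (S.pos x).ne') h.2
      have h2 := hz1 x y
      have h3 : (w x - w y) ^ 2 = 0 := by
        refine (mul_eq_zero.1 h2).resolve_left ?_
        exact mul_ne_zero h1 (mul_pos (hKpos x) (hKpos y)).ne'
      exact sub_eq_zero.1 (pow_eq_zero_iff two_ne_zero |>.1 h3)
    have hall : ∀ x y, w x = w y := by
      intro x y
      obtain ⟨p⟩ := hconn x y
      induction p with
      | nil => rfl
      | cons h _ ih => exact (hadj _ _ h).trans ih
    have h01 : (∀ x, w x = 0) ∨ ∀ x, w x = 1 := by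
      have : ∃ x, w x = 0 ∨ w x = 1 := by
        rcases hq with ⟨x, hx⟩ | ⟨x, hx⟩
        · refine ⟨x, ?_⟩
          have h1 := hvw x
          rw [hx, Nat.cast_one, one_mul] at h1
          have h2 := hv0 x
          have h3 := hvK x
          rw [hx] at h3
          push_cast at h3
          have h4 : v x = 0 ∨ v x = 1 := by omega
          rw [← h1]
          rcases h4 with h4 | h4 <;> simp [h4]
        · refine ⟨x, ?_⟩
          have h1 : (Q.toQuiverData.balance x : ℝ) ≠ 0 := by exact_mod_cast hx.ne'
          have h2 := (mul_eq_zero.1 (hz2 x)).resolve_right h1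
          have h3 : (S.L x : ℝ) * Q.K x ≠ 0 :=
            mul_ne_zero (by exact_mod_cast (S.pos x).ne') (hKpos x).ne'
          rcases mul_eq_zero.1 ((mul_eq_zero.1 h2).resolve_left h3) with h | h
          · exact Or.inl h
          · exact Or.inr (by linarith)
      obtain ⟨x, hx | hx⟩ := this
      · exact Or.inl fun y => (hall y x).trans hx
      · exact Or.inr fun y => (hall y x).trans hx
    rcases h01 with h | h
    · have h1 : ∀ i, χ i = 0 := by
        rintro ⟨x, a⟩
        have h2 : v x = 0 := by
          have := hvw x
          rw [h x, mul_zero] at this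
          exact_mod_cast this
        exact (Finset.sum_eq_zero_iff_of_nonneg fun a _ => by
          rcases hχ ⟨x, a⟩ with h | h <;> simp [h]).1 h2 a (Finset.mem_univ a)
      intro i j
      rw [h1, h1]
    · have h1 : ∀ i, χ i = 1 := by
        rintro ⟨x, a⟩
        have h2 : v x = Q.K x := by
          have := hvw x
          rw [h x, mul_one] at this
          exact_mod_cast this
        have h3 : ∑ a : Fin (Q.K x), (1 - χ ⟨x, a⟩) = 0 := by
          rw [Finset.sum_sub_distrib]
          simp only [Finset.sum_const, Finset.card_univ, Fintype.card_fin, nsmul_eq_mul, mul_one]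
          rw [← h2]
          exact sub_self _
        have h4 := (Finset.sum_eq_zero_iff_of_nonneg fun a _ => by
          rcases hχ ⟨x, a⟩ with h | h <;> simp [h]).1 h3 a (Finset.mem_univ a)
        linarith
      intro i j
      rw [h1, h1]

end GenQuiver
-- Growth of Δ and goodness from non-negative balance
namespace GenQuiver

variable {V : Type*} [Fintype V]

theorem Shift.prod_pos {Q : GenQuiver V} (S : Q.Shift) : 0 < ∏ z, S.L z :=
  Finset.prod_pos fun z _ => S.pos z

/-- Sum `layer_bound` over all thresholds: a layer that separates i from j has positive integral
energy, hence at least 1, and every other layer has energy at least 0. -/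
theorem energy_bound (Q : GenQuiver V) (S : Q.Shift) (hconn : Q.graph.Preconnected)
    (hbal : ∀ x, 0 ≤ Q.toQuiverData.balance x)
    (hq : (∃ x, Q.K x = 1) ∨ ∃ x, 0 < Q.toQuiverData.balance x)
    (u : Q.Index → ℤ) (i j : Q.Index) :
    |u i - u j| ≤ ∑ x, ∑ y, (S.L x * Q.A x y) *
      ∑ a : Fin (Q.K x), ∑ b : Fin (Q.K y), |u ⟨x, a⟩ - u ⟨y, b⟩| := by
  classical
  set R := ∑ k, |u k| with hR
  have hb : ∀ k, -R ≤ u k ∧ u k ≤ R := fun k => by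
    have h1 : |u k| ≤ R := Finset.single_le_sum (f := fun k => |u k|)
      (fun k _ => abs_nonneg _) (Finset.mem_univ k)
    exact abs_le.1 h1
  set χ : ℤ → Q.Index → ℤ := fun s k => if s < u k then 1 else 0 with hχ
  have habs : ∀ k l, |u k - u l| = ∑ s ∈ Finset.Ico (-R) R, (χ s k - χ s l) ^ 2 :=
    fun k l => abs_sub_eq_sum (hb k) (hb l)
  have hE : ∑ x, ∑ y, (S.L x * Q.A x y) *
      ∑ a : Fin (Q.K x), ∑ b : Fin (Q.K y), |u ⟨x, a⟩ - u ⟨y, b⟩| =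
      ∑ s ∈ Finset.Ico (-R) R, ∑ x, ∑ y, (S.L x * Q.A x y) *
      ∑ a : Fin (Q.K x), ∑ b : Fin (Q.K y), (χ s ⟨x, a⟩ - χ s ⟨y, b⟩) ^ 2 := by
    symm
    rw [Finset.sum_comm]
    refine Finset.sum_congr rfl fun x _ => ?_
    rw [Finset.sum_comm]
    refine Finset.sum_congr rfl fun y _ => ?_
    rw [← Finset.mul_sum]
    congr 1
    rw [Finset.sum_comm]
    refine Finset.sum_congr rfl fun a _ => ?_
    rw [Finset.sum_comm]
    exact Finset.sum_congr rfl fun b _ => (habs _ _).symm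
  rw [hE, habs i j]
  refine Finset.sum_le_sum fun s _ => ?_
  have h01 : ∀ k, χ s k = 0 ∨ χ s k = 1 := fun k => by
    simp only [hχ]
    split_ifs <;> simp
  obtain ⟨h1, h2⟩ := Q.layer_bound S hconn hbal hq (χ s) h01
  by_cases hij : χ s i = χ s j
  · rw [hij, sub_self]
    simpa using h1
  · have h3 := not_le.1 fun hle => hij (h2 hle i j)
    refine le_trans ?_ h3
    rcases h01 i with h | h <;> rcases h01 j with h' | h' <;> simp [h, h']

/-- The product of all `L z` with `z ≠ x`. -/
def Shift.cofactor [DecidableEq V] {Q : GenQuiver V} (S : Q.Shift) (x : V) : ℕ :=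
  ∏ z ∈ Finset.univ.erase x, S.L z

variable [DecidableEq V]

theorem Shift.cofactor_mul {Q : GenQuiver V} (S : Q.Shift) (x : V) :
    S.cofactor x * S.L x = ∏ z, S.L z :=
  Finset.prod_erase_mul _ _ (Finset.mem_univ x)

theorem Shift.cofactor_pos {Q : GenQuiver V} (S : Q.Shift) (x : V) : 0 < S.cofactor x :=
  Finset.prod_pos fun z _ => S.pos z

/-- Multiplying the coordinates at x by the cofactor ∏ L / L(x) makes the matrix symmetric: the two
labels of an edge are replaced by the common factor L(x) A(x,y) = L(y) A(y,x). -/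
theorem two_mul_confDim_eq (Q : GenQuiver V) (S : Q.Shift) (m : Q.Lattice) :
    2 * (∏ z, S.L z : ℕ) * Q.confDim m = ((∑ x, ∑ y, (S.L x * Q.A x y) *
      ∑ a : Fin (Q.K x), ∑ b : Fin (Q.K y),
        |S.cofactor x * m ⟨x, a⟩ - S.cofactor y * m ⟨y, b⟩| : ℤ) : ℝ) := by
  rw [confDim_eq_pairSum]
  rw [show (2 * ((∏ z, S.L z : ℕ) : ℝ) * (1 / 2 *
    ((∑ x, ∑ y, (Q.A x y).sign * Q.pairSum m x y : ℤ) : ℝ))) =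
    (((∏ z, S.L z : ℕ) : ℤ) * (∑ x, ∑ y, (Q.A x y).sign * Q.pairSum m x y) : ℤ) by
      push_cast; ring]
  congr 1
  unfold pairSum
  simp only [Finset.mul_sum]
  refine Finset.sum_congr rfl fun x _ => Finset.sum_congr rfl fun y _ =>
    Finset.sum_congr rfl fun a _ => Finset.sum_congr rfl fun b _ => ?_
  have hx : (S.cofactor x : ℤ) * S.L x = (∏ z, S.L z : ℕ) := by exact_mod_cast S.cofactor_mul x
  have hy : (S.cofactor y : ℤ) * S.L y = (∏ z, S.L z : ℕ) := by exact_mod_cast S.cofactor_mul y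
  set P : ℤ := ((∏ z, S.L z : ℕ) : ℤ) with hP
  have hP0 : 0 ≤ P := by positivity
  have h1 : P * |m ⟨x, a⟩ * Q.A x y - m ⟨y, b⟩ * Q.A y x| =
      S.L x * |Q.A x y| * |S.cofactor x * m ⟨x, a⟩ - S.cofactor y * m ⟨y, b⟩| := by
    rw [← abs_of_nonneg hP0, ← abs_mul,
      ← abs_of_nonneg (show (0 : ℤ) ≤ S.L x by positivity), ← abs_mul, ← abs_mul]
    congr 1
    have h2 := S.eq x y
    rw [mul_sub, mul_sub]
    congr 1
    · rw [← hx]; ring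
    · rw [← hy]
      linear_combination (- (S.cofactor y : ℤ) * m ⟨y, b⟩) * h2
  rw [mul_left_comm, h1]
  nth_rewrite 3 [← Int.sign_mul_abs (Q.A x y)]
  ring

theorem abs_sub_le_confDim (Q : GenQuiver V) (S : Q.Shift) (hconn : Q.graph.Preconnected)
    (hbal : ∀ x, 0 ≤ Q.toQuiverData.balance x)
    (hq : (∃ x, Q.K x = 1) ∨ ∃ x, 0 < Q.toQuiverData.balance x)
    (m : Q.Lattice) (i j : Q.Index) :
    (|(S.cofactor i.1 * m i - S.cofactor j.1 * m j : ℤ)| : ℝ) ≤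
      2 * (∏ z, S.L z : ℕ) * Q.confDim m := by
  rw [two_mul_confDim_eq]
  have := Q.energy_bound S hconn hbal hq (fun i => S.cofactor i.1 * m i) i j
  exact_mod_cast this

theorem Shift.mem_zmultiples_of_eq {Q : GenQuiver V} (S : Q.Shift) {m : Q.Lattice}
    (h : ∀ i j : Q.Index, (S.cofactor i.1 * m i : ℤ) = S.cofactor j.1 * m j) :
    m ∈ AddSubgroup.zmultiples S.vec := by
  have hne : Nonempty V := by
    by_contra hV
    rw [not_nonempty_iff] at hV
    have h1 := S.primitive
    rw [Finset.univ_eq_empty, Finset.gcd_empty] at h1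
    exact zero_ne_one h1
  obtain ⟨x0⟩ := hne
  set i0 : Q.Index := ⟨x0, ⟨0, Q.K_pos x0⟩⟩
  refine S.mem_of_nsmul_mem (S.prod_pos.ne') (m := m) ?_
  refine AddSubgroup.mem_zmultiples_iff.2 ⟨S.cofactor x0 * m i0, funext fun i => ?_⟩
  have h1 := h i0 i
  have h2 : (S.cofactor i.1 : ℤ) * S.L i.1 = (∏ z, S.L z : ℕ) := by
    exact_mod_cast S.cofactor_mul i.1
  simp only [Pi.smul_apply, smul_eq_mul, Shift.vec, nsmul_eq_mul, ← h2]
  rw [show (S.cofactor x0 * m i0 : ℤ) = S.cofactor i.1 * m i from h1]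
  ring

/-- The spread of the rescaled coordinates is bounded by a multiple of Δ. Thus Δ is non-negative and
vanishes only on ℤL, and integrality with Δ ≠ 1 gives Δ ≥ 2 elsewhere. Fixing one coordinate in a
bounded range then bounds all of them. -/
theorem hilbertGood_of_balance (Q : GenQuiver V) (hconn : Q.graph.Connected)
    (hbal : ∀ x, 0 ≤ Q.toQuiverData.balance x)
    (hq : (∃ x, Q.K x = 1) ∨ ∃ x, 0 < Q.toQuiverData.balance x)
    (hcard : 2 ≤ Fintype.card Q.Index) (hone : ∀ m, Q.confDim m ≠ 1) : Q.HilbertGood := by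
  have hV := hconn.nonempty
  obtain ⟨S⟩ := Q.exists_shift
  have hgrow := Q.abs_sub_le_confDim S hconn.preconnected hbal hq
  obtain ⟨x0⟩ := hV
  set i0 : Q.Index := ⟨x0, ⟨0, Q.K_pos x0⟩⟩ with hi0
  set P : ℝ := ((∏ z, S.L z : ℕ) : ℝ) with hP
  have hP0 : 0 < P := by
    rw [hP]
    exact_mod_cast S.prod_pos
  have hnonneg : ∀ m, 0 ≤ Q.confDim m := by
    intro m
    have h1 := hgrow m i0 i0
    rw [sub_self, Int.cast_zero, abs_zero] at h1
    by_contra! h2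
    nlinarith
  refine Q.hilbertGood_of_growth S (2 * P) (fun m => ?_) (fun m hm => ?_) (fun m => ?_) hcard
  · obtain ⟨z, hz, -⟩ := Q.exists_confDim_eq m
    have h1 := hnonneg m
    rw [hz] at h1
    have h2 : 0 ≤ z := by exact_mod_cast h1
    refine ⟨z.toNat, ?_⟩
    rw [hz]
    exact_mod_cast (Int.toNat_of_nonneg h2).symm
  · obtain ⟨z, hz, -⟩ := Q.exists_confDim_eq m
    have h1 := hnonneg m
    have h3 := hone m
    rw [hz] at h1 h3 ⊢
    have h2 : 0 ≤ z := by exact_mod_cast h1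
    have h4 : z ≠ 1 := by
      rintro rfl
      exact h3 (by norm_num)
    have h5 : z ≠ 0 := by
      rintro rfl
      refine hm (S.mem_zmultiples_of_eq fun i j => ?_)
      have h6 := hgrow m i j
      rw [hz, Int.cast_zero, mul_zero] at h6
      have h7 := abs_nonpos_iff.1 h6
      have h8 : (S.cofactor i.1 * m i - S.cofactor j.1 * m j : ℤ) = 0 := by exact_mod_cast h7
      linarith
    have h6 : 2 ≤ z := by omega
    exact_mod_cast h6
  -- Representative whose coordinate at `i0` is the residue modulo L(x0).
  · set k : ℤ := -(m i0 / S.L x0) with hk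
    have hLpos : (0 : ℤ) < S.L x0 := by exact_mod_cast S.pos x0
    refine ⟨k • S.vec + m, ?_, fun i => ?_⟩
    · refine AddSubgroup.mem_zmultiples_iff.2 ⟨k, ?_⟩
      abel
    · set m' := k • S.vec + m with hm'
      have h0 : m' i0 = m i0 % S.L x0 := by
        simp only [hm', Pi.add_apply, Pi.smul_apply, Shift.vec, smul_eq_mul, hk]
        rw [Int.emod_def]
        ring
      have h1 : 0 ≤ m' i0 := by rw [h0]; exact Int.emod_nonneg _ hLpos.ne'
      have h2 : m' i0 < S.L x0 := by rw [h0]; exact Int.emod_lt_of_pos _ hLpos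
      have h3 : (S.cofactor x0 * m' i0 : ℤ) ≤ (∏ z, S.L z : ℕ) := by
        have h4 : (S.cofactor x0 : ℤ) * S.L x0 = (∏ z, S.L z : ℕ) := by
          exact_mod_cast S.cofactor_mul x0
        rw [← h4]
        exact mul_le_mul_of_nonneg_left h2.le (by positivity)
      have h5 := hgrow m' i i0
      have h6 : |m' i| ≤ |S.cofactor i.1 * m' i| := by
        rw [abs_mul]
        refine le_mul_of_one_le_left (abs_nonneg _) ?_
        rw [Nat.abs_cast]
        exact_mod_cast S.cofactor_pos i.1
      have h7 : |(S.cofactor i.1 * m' i : ℤ)| ≤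
          |S.cofactor i.1 * m' i - S.cofactor x0 * m' i0| + (∏ z, S.L z : ℕ) := by
        have h8 : |(S.cofactor x0 * m' i0 : ℤ)| ≤ (∏ z, S.L z : ℕ) := by
          rw [abs_of_nonneg (mul_nonneg (by positivity) h1)]
          exact h3
        have h9 := abs_add_le (S.cofactor i.1 * m' i - S.cofactor x0 * m' i0 : ℤ)
          (S.cofactor x0 * m' i0)
        rw [sub_add_cancel] at h9
        linarith
      have h8 : (|(m' i : ℤ)| : ℝ) ≤
          |((S.cofactor i.1 * m' i - S.cofactor i0.1 * m' i0 : ℤ) : ℝ)| + P := by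
        rw [hP]
        exact_mod_cast h6.trans h7
      calc _ ≤ _ := h8
        _ ≤ 2 * P * Q.confDim m' + P := by linarith
        _ ≤ 2 * P * (Q.confDim m' + 1) := by linarith

end GenQuiver
-- Containment up to isomorphism
open Edge

/-- `Q` has a subquiver isomorphic to `R`. -/
def GenQuiver.Contains {V W : Type*} (Q : GenQuiver V) (R : QuiverData W) : Prop :=
  ∃ f : W → V, Function.Injective f ∧ (∀ i j, i ≠ j → Q.A (f i) (f j) = R.A i j) ∧
    (∀ i, 0 < R.K i ∧ R.K i ≤ Q.K (f i)) ∧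
    ∀ i, R.A i i = if R.K i = 1 then -2 else Q.A (f i) (f i)

theorem GenQuiver.Contains.exists_sub {V W : Type*} [DecidableEq V] {Q : GenQuiver V}
    {R : QuiverData W} (h : Q.Contains R) :
    ∃ K' : V → ℕ, K' ≤ Q.K ∧ (Q.sub K').toQuiverData.Iso R := by
  classical
  obtain ⟨f, hf, hA, hK, hd⟩ := h
  let K' : V → ℕ := fun x => if h : ∃ i, f i = x then R.K h.choose else 0
  have hK' : ∀ i, K' (f i) = R.K i := by
    intro i
    have h1 : ∃ j, f j = f i := ⟨i, rfl⟩
    have h2 : h1.choose = i := hf h1.choose_spec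
    simp only [K', dif_pos h1, h2]
  have hne : ∀ i, K' (f i) ≠ 0 := fun i => by rw [hK']; exact (hK i).1.ne'
  let g : W → {x : V // K' x ≠ 0} := fun i => ⟨f i, hne i⟩
  have hg : Function.Bijective g := by
    refine ⟨fun i j h => hf (congrArg Subtype.val h), ?_⟩
    rintro ⟨x, hx⟩
    by_cases h1 : ∃ i, f i = x
    · obtain ⟨i, rfl⟩ := h1
      exact ⟨i, rfl⟩
    · exact absurd (dif_neg h1) hx
  let e := Equiv.ofBijective g hg
  refine ⟨K', fun x => ?_, e.symm, fun x y => ?_, fun x => ?_⟩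
  · by_cases h1 : ∃ i, f i = x
    · obtain ⟨i, rfl⟩ := h1
      rw [hK']
      exact (hK i).2
    · simp only [K', dif_neg h1]
      exact Nat.zero_le _
  · obtain ⟨i, rfl⟩ := e.surjective x
    obtain ⟨j, rfl⟩ := e.surjective y
    rw [e.symm_apply_apply, e.symm_apply_apply]
    change _ = if e i = e j ∧ K' (f i) = 1 then -2 else Q.A (f i) (f j)
    by_cases hij : i = j
    · subst hij
      rw [hd, hK']
      simp
    · have : e i ≠ e j := fun h => hij (e.injective h)
      rw [if_neg (fun h => this h.1), hA i j hij]
  · obtain ⟨i, rfl⟩ := e.surjective x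
    rw [e.symm_apply_apply]
    exact (hK' i).symm

theorem GenQuiver.Contains.of_iso_mul {V W : Type*} {Q : GenQuiver V} {R : QuiverData W} {N : ℕ}
    (hN : 1 ≤ N) (hR : ∀ i, 0 < R.K i ∧ R.A i i = -2) (h : Q.toQuiverData.Iso (R.mul N)) :
    Q.Contains R := by
  obtain ⟨e, hA, hK⟩ := h
  refine ⟨e.symm, e.symm.injective, fun i j _ => ?_, fun i => ⟨(hR i).1, ?_⟩, fun i => ?_⟩
  · rw [← hA, e.apply_symm_apply, e.apply_symm_apply]
    rfl
  · rw [← hK, e.apply_symm_apply]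
    exact Nat.le_mul_of_pos_left _ hN
  · have h1 : Q.A (e.symm i) (e.symm i) = R.A i i := by
      rw [← hA, e.apply_symm_apply]
      rfl
    rw [h1, (hR i).2]
    simp

/-! ### Goodness is invariant under isomorphism and can be checked on the data -/

section Good

variable {V W : Type*} [Fintype V] [Fintype W]

theorem balance_of_iso {P : GenQuiver V} {R : QuiverData W} (e : V ≃ W)
    (hA : ∀ x y, R.A (e x) (e y) = P.A x y) (hK : ∀ x, R.K (e x) = P.K x) (x : V) :
    P.toQuiverData.balance x = R.balance (e x) := by
  unfold QuiverData.balance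
  rw [← e.sum_comp]
  exact Finset.sum_congr rfl fun y _ => by rw [hA, hK]

theorem confDim_ne_one_of_iso {P : GenQuiver V} {R : QuiverData W}
    (hiso : P.toQuiverData.Iso R) (heven : ∀ w, Even (R.balance w)) (m : P.Lattice) :
    P.confDim m ≠ 1 := by
  obtain ⟨e, hA, hK⟩ := hiso
  exact P.confDim_ne_one_of_even (fun x => by rw [balance_of_iso e hA hK]; exact heven _) m

variable [DecidableEq V]

theorem isGoodConnected_of_iso {P : GenQuiver V} {R : QuiverData W}
    (hiso : P.toQuiverData.Iso R)
    (hlink : ∃ w₀, ∀ w, Relation.ReflTransGen (fun x y => R.A x y ≠ 0) w w₀)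
    (hbal : ∀ w, 0 ≤ R.balance w) (hq : (∃ w, R.K w = 1) ∨ ∃ w, 0 < R.balance w)
    (hsum : 2 ≤ ∑ w, R.K w) (hone : ∀ m, P.confDim m ≠ 1) : P.IsGoodConnected := by
  obtain ⟨e, hA, hK⟩ := hiso
  have hconn : P.graph.Connected := by
    obtain ⟨w₀, hw⟩ := hlink
    refine SimpleGraph.connected_iff_exists_forall_reachable _ |>.2 ⟨e.symm w₀, fun v => ?_⟩
    have key : ∀ w, Relation.ReflTransGen (fun x y => R.A x y ≠ 0) w w₀ →
        P.graph.Reachable (e.symm w₀) (e.symm w) := by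
      intro w h
      induction h using Relation.ReflTransGen.head_induction_on with
      | refl => exact SimpleGraph.Reachable.refl _
      | @head a b h _ ih =>
        refine ih.trans ?_
        by_cases hab : a = b
        · rw [hab]
        · refine SimpleGraph.Adj.reachable ⟨fun h' => hab (e.symm.injective h'.symm), ?_⟩
          refine fun h' => h ?_
          rw [← e.apply_symm_apply a, ← e.apply_symm_apply b, hA]
          exact P.zero_of_zero h'
    simpa using key (e v) (hw (e v))
  refine ⟨hconn, Or.inl (P.hilbertGood_of_balance hconn (fun x => ?_) ?_ ?_ hone)⟩
  · rw [balance_of_iso e hA hK]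
    exact hbal _
  · rcases hq with ⟨w, hw⟩ | ⟨w, hw⟩
    · exact Or.inl ⟨e.symm w, by rw [← hK, e.apply_symm_apply, hw]⟩
    · exact Or.inr ⟨e.symm w, by rw [balance_of_iso e hA hK, e.apply_symm_apply]; exact hw⟩
  · rw [Fintype.card_sigma]
    simp only [Fintype.card_fin]
    rw [← e.sum_comp] at hsum
    simpa only [hK] using hsum

end Good

/-! ### Quivers whose underlying graph is a tree, given by a list of edges -/

/-- Each edge of the list joins one new vertex, in the order `n, n + 1, …`, to an older vertex. -/
def IsTreeFrom : ℕ → List Edge → Prop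
  | _, [] => True
  | n, e :: E => (e.src = n ∧ e.tgt < n ∨ e.tgt = n ∧ e.src < n) ∧ IsTreeFrom (n + 1) E

/-- The contribution of an edge to the adjacency matrix. -/
def Edge.entry (e : Edge) (i j : ℕ) : ℤ :=
  if e.src = i ∧ e.tgt = j then (e.p : ℤ) else if e.src = j ∧ e.tgt = i then (e.q : ℤ) else 0

/-- The off-diagonal entries of the adjacency matrix of a list of edges. -/
def entries (E : List Edge) (i j : ℕ) : ℤ := (E.map fun e => e.entry i j).sum

theorem ofEdges_A (K : List ℕ) (E : List Edge) (x y : Fin K.length) :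
    (ofEdges K E).A x y = if x = y then -2 else entries E x y := rfl

theorem entries_cons (e : Edge) (E : List Edge) (i j : ℕ) :
    entries (e :: E) i j = e.entry i j + entries E i j := by simp [entries]

/-- The edge `e` joins `i` and `j`. -/
def Edge.Joins (e : Edge) (i j : ℕ) : Prop := e.src = i ∧ e.tgt = j ∨ e.src = j ∧ e.tgt = i

theorem entries_eq_zero {E : List Edge} {i j : ℕ} (h : ∀ e ∈ E, ¬ e.Joins i j) :
    entries E i j = 0 := by
  refine List.sum_eq_zero fun z hz => ?_
  obtain ⟨e, he, rfl⟩ := List.mem_map.1 hz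
  have h1 := h e he
  unfold Edge.Joins at h1
  push Not at h1
  unfold Edge.entry
  rw [if_neg fun h2 => h1.1 h2.1 h2.2, if_neg fun h2 => h1.2 h2.1 h2.2]

namespace IsTreeFrom

theorem bounds {n : ℕ} {E : List Edge} (h : IsTreeFrom n E) {e : Edge} (he : e ∈ E) :
    (n ≤ e.src ∨ n ≤ e.tgt) ∧ e.src ≠ e.tgt ∧ e.src < n + E.length ∧ e.tgt < n + E.length := by
  induction E generalizing n with
  | nil => simp at he
  | cons e' E ih =>
    obtain ⟨h1, h2⟩ := h
    rw [List.length_cons]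
    rcases List.mem_cons.1 he with rfl | he
    · omega
    · have := ih h2 he
      omega

theorem entries_edge {n : ℕ} {E : List Edge} (h : IsTreeFrom n E) {e : Edge} (he : e ∈ E) :
    entries E e.src e.tgt = e.p ∧ entries E e.tgt e.src = e.q := by
  induction E generalizing n with
  | nil => simp at he
  | cons e' E ih =>
    obtain ⟨h1, h2⟩ := h
    rw [entries_cons, entries_cons]
    rcases List.mem_cons.1 he with rfl | he
    · have h3 : ∀ e' ∈ E, ¬ e'.Joins e.src e.tgt := by
        intro e' he'
        have := h2.bounds he'
        unfold Edge.Joins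
        omega
      have h4 : ∀ e' ∈ E, ¬ e'.Joins e.tgt e.src := by
        intro e' he'
        have := h2.bounds he'
        unfold Edge.Joins
        omega
      rw [entries_eq_zero h3, entries_eq_zero h4]
      have h5 : e.src ≠ e.tgt := by omega
      simp [Edge.entry, h5, h5.symm]
    · have h3 := ih h2 he
      have h4 := h2.bounds he
      rw [h3.1, h3.2]
      unfold Edge.entry
      constructor <;> rw [if_neg (by omega), if_neg (by omega), zero_add]

theorem exists_edge {n : ℕ} {E : List Edge} (h : IsTreeFrom n E) {i : ℕ} (h1 : n ≤ i)
    (h2 : i < n + E.length) : ∃ e ∈ E, e.src = i ∧ e.tgt < i ∨ e.tgt = i ∧ e.src < i := by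
  induction E generalizing n with
  | nil => simp at h2; omega
  | cons e' E ih =>
    obtain ⟨h3, h4⟩ := h
    rw [List.length_cons] at h2
    by_cases hi : i = n
    · subst hi
      exact ⟨e', by simp, h3⟩
    · obtain ⟨e, he, h5⟩ := ih h4 (by omega) (by omega)
      exact ⟨e, by simp [he], h5⟩

theorem append {n : ℕ} {E F : List Edge} :
    IsTreeFrom n (E ++ F) ↔ IsTreeFrom n E ∧ IsTreeFrom (n + E.length) F := by
  induction E generalizing n with
  | nil => simp [IsTreeFrom]
  | cons e E ih =>
    rw [List.cons_append]
    simp only [IsTreeFrom, ih, List.length_cons, and_assoc, Nat.add_assoc, Nat.add_comm 1]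

end IsTreeFrom

theorem length_chain (r : ℕ) : (chain r).length = r := by simp [chain]

theorem isTreeFrom_chain (r : ℕ) : IsTreeFrom 1 (chain r) := by
  induction r with
  | zero => trivial
  | succ r ih =>
    have : chain (r + 1) = chain r ++ [edge r (r + 1) 1 1] := by
      simp [chain, List.range_succ]
    rw [this, IsTreeFrom.append, length_chain]
    refine ⟨ih, ?_⟩
    simp [IsTreeFrom]
    omega

/-- The balance of the vertex `x` of `ofEdges K E`. -/
def listBalance (K : List ℕ) (E : List Edge) (x : ℕ) : ℤ :=
  -2 * (K.getD x 0 : ℤ) + (E.map fun e => if e.src = x then (e.p : ℤ) * (K.getD e.tgt 0 : ℕ)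
    else if e.tgt = x then (e.q : ℤ) * (K.getD e.src 0 : ℕ) else 0).sum

theorem balance_ofEdges {K : List ℕ} {E : List Edge}
    (hE : ∀ e ∈ E, e.src ≠ e.tgt ∧ e.src < K.length ∧ e.tgt < K.length) (x : Fin K.length) :
    (ofEdges K E).balance x = listBalance K E x := by
  have hget : ∀ y : Fin K.length, (ofEdges K E).K y = K.getD y 0 := fun y => by
    simp [ofEdges]
  have h1 : (ofEdges K E).balance x = -2 * (K.getD x 0 : ℤ) +
      ∑ y : Fin K.length, (if x = y then 0 else entries E x y * (K.getD y 0 : ℕ)) := by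
    unfold QuiverData.balance
    have h2 : ∀ y, (ofEdges K E).A x y * ((ofEdges K E).K y : ℤ) =
        (if x = y then -2 * (K.getD x 0 : ℤ) else 0) +
        if x = y then 0 else entries E x y * (K.getD y 0 : ℕ) := by
      intro y
      rw [ofEdges_A, hget]
      split_ifs with h
      · rw [h]; ring
      · ring
    simp only [h2, Finset.sum_add_distrib]
    congr 1
    simp
  rw [h1, listBalance]
  congr 1
  clear h1 hget
  induction E with
  | nil => simp [entries]
  | cons e E ih =>
    rw [List.map_cons, List.sum_cons, ← ih (fun e' he' => hE e' (by simp [he']))]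
    obtain ⟨hne, hs, ht⟩ := hE e (by simp)
    have h3 : ∀ y : Fin K.length, (if x = y then 0 else entries (e :: E) x y * ((K.getD y 0 : ℕ) : ℤ)) =
        (if x = y then 0 else e.entry x y * ((K.getD y 0 : ℕ) : ℤ)) +
        if x = y then 0 else entries E x y * ((K.getD y 0 : ℕ) : ℤ) := by
      intro y
      rw [entries_cons]
      split_ifs <;> ring
    simp only [h3, Finset.sum_add_distrib]
    congr 1
    unfold Edge.entry
    by_cases hx : e.src = x
    · rw [if_pos hx, Finset.sum_eq_single_of_mem (⟨e.tgt, ht⟩ : Fin K.length) (Finset.mem_univ _)]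
      · have h4 : x ≠ ⟨e.tgt, ht⟩ := fun h => hne (by rw [hx, h])
        simp [h4, hx]
      · intro y _ hy
        have h4 : e.tgt ≠ y := fun h => hy (Fin.ext h.symm)
        have h5 : e.tgt ≠ x := fun h => hne (hx.trans h.symm)
        simp [h4, h5]
    · rw [if_neg hx]
      by_cases hx' : e.tgt = x
      · rw [if_pos hx', Finset.sum_eq_single_of_mem (⟨e.src, hs⟩ : Fin K.length) (Finset.mem_univ _)]
        · have h4 : x ≠ ⟨e.src, hs⟩ := fun h => hx (by rw [h])
          simp [h4, hx', hx]
        · intro y _ hy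
          have h4 : e.src ≠ y := fun h => hy (Fin.ext h.symm)
          simp [h4, hx]
      · rw [if_neg hx']
        refine Finset.sum_eq_zero fun y _ => ?_
        simp [hx, hx']

section TreeGood

variable {V : Type*} [Fintype V] [DecidableEq V]

theorem isGoodConnected_of_tree' {P : GenQuiver V} {K : List ℕ} {E : List Edge}
    (hiso : P.toQuiverData.Iso (ofEdges K E)) (hlen : K.length = 1 + E.length)
    (htree : IsTreeFrom 1 E) (hpos : ∀ e ∈ E, 0 < e.p ∧ 0 < e.q)
    (hbal : ∀ x < K.length, 0 ≤ listBalance K E x)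
    (hq : 1 ∈ K ∨ ∃ x < K.length, 0 < listBalance K E x) (hsum : 2 ≤ K.sum)
    (hone : ∀ m, P.confDim m ≠ 1) : P.IsGoodConnected := by
  have hE : ∀ e ∈ E, e.src ≠ e.tgt ∧ e.src < K.length ∧ e.tgt < K.length := fun e he => by
    have := htree.bounds he
    omega
  refine isGoodConnected_of_iso hiso ?_ (fun w => ?_) ?_ ?_ hone
  · refine ⟨⟨0, by omega⟩, ?_⟩
    rintro ⟨i, hi⟩
    induction i using Nat.strong_induction_on with
    | _ i ih =>
      rcases Nat.eq_zero_or_pos i with rfl | h0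
      · exact Relation.ReflTransGen.refl
      · obtain ⟨e, he, h1⟩ := htree.exists_edge h0 (by omega)
        have h2 := htree.entries_edge he
        have h3 := hpos e he
        rcases h1 with ⟨rfl, h1⟩ | ⟨rfl, h1⟩
        · refine Relation.ReflTransGen.head ?_ (ih e.tgt h1 (by omega))
          rw [ofEdges_A, if_neg (by simp; omega), h2.1]
          omega
        · refine Relation.ReflTransGen.head ?_ (ih e.src h1 (by omega))
          rw [ofEdges_A, if_neg (by simp; omega), h2.2]
          omega
  · rw [balance_ofEdges hE]
    exact hbal w w.2
  · rcases hq with h | ⟨x, hx, h⟩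
    · obtain ⟨i, hi⟩ := List.mem_iff_get.1 h
      exact Or.inl ⟨i, hi⟩
    · refine Or.inr ⟨⟨x, hx⟩, ?_⟩
      rw [balance_ofEdges hE]
      exact h
  · have : ∑ w, (ofEdges K E).K w = K.sum := by
      simp only [ofEdges, List.get_eq_getElem]
      exact Fin.sum_univ_getElem K
    rw [this]
    exact hsum

/-- Even balances exclude Δ = 1 by parity; the primed version leaves that exclusion to families with
an odd balance. -/
theorem isGoodConnected_of_tree {P : GenQuiver V} {K : List ℕ} {E : List Edge}
    (hiso : P.toQuiverData.Iso (ofEdges K E)) (hlen : K.length = 1 + E.length)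
    (htree : IsTreeFrom 1 E) (hpos : ∀ e ∈ E, 0 < e.p ∧ 0 < e.q)
    (hbal : ∀ x < K.length, 0 ≤ listBalance K E x ∧ listBalance K E x % 2 = 0)
    (hq : 1 ∈ K ∨ ∃ x < K.length, 0 < listBalance K E x) (hsum : 2 ≤ K.sum) :
    P.IsGoodConnected := by
  refine isGoodConnected_of_tree' hiso hlen htree hpos (fun x hx => (hbal x hx).1) hq hsum ?_
  refine confDim_ne_one_of_iso hiso fun w => ?_
  rw [balance_ofEdges fun e he => by have := htree.bounds he; omega]
  exact Int.even_iff.2 (hbal w w.2).2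

end TreeGood

/-! ### Balances along a spine of weight two -/

theorem getD_spine (r : ℕ) (L : List ℕ) (x : ℕ) :
    (List.replicate (r + 1) 2 ++ L).getD x 0 = if x ≤ r then 2 else L.getD (x - (r + 1)) 0 := by
  split_ifs with h
  · rw [List.getD_append _ _ _ _ (by simp; omega), List.getD_eq_getElem _ _ (by simp; omega),
      List.getElem_replicate]
  · rw [List.getD_append_right _ _ _ _ (by simp; omega), List.length_replicate]

theorem pos_chain (r : ℕ) : ∀ e ∈ chain r, 0 < e.p ∧ 0 < e.q := by
  simp [chain]

theorem sum_chain (r : ℕ) (K : List ℕ) (hK : ∀ y ≤ r, K.getD y 0 = 2) (x : ℕ) :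
    ((chain r).map fun e => if e.src = x then (e.p : ℤ) * (K.getD e.tgt 0 : ℕ)
      else if e.tgt = x then (e.q : ℤ) * (K.getD e.src 0 : ℕ) else 0).sum =
      (if x < r then 2 else 0) + if 0 < x ∧ x ≤ r then 2 else 0 := by
  induction r with
  | zero => simp [chain]; omega
  | succ r ih =>
    have : chain (r + 1) = chain r ++ [edge r (r + 1) 1 1] := by simp [chain, List.range_succ]
    rw [this, List.map_append, List.sum_append, ih fun y hy => hK y (by omega)]
    simp only [List.map_cons, List.map_nil, List.sum_cons, List.sum_nil, hK r (by omega),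
      hK (r + 1) le_rfl]
    split_ifs <;> first | rfl | omega

theorem listBalance_spine (r : ℕ) (L : List ℕ) (T : List Edge) (x : ℕ) :
    listBalance (List.replicate (r + 1) 2 ++ L) (chain r ++ T) x =
      -2 * ((if x ≤ r then 2 else L.getD (x - (r + 1)) 0 : ℕ) : ℤ) +
      ((if x < r then 2 else 0) + (if 0 < x ∧ x ≤ r then 2 else 0) +
      (T.map fun e => if e.src = x then
        (e.p : ℤ) * ((if e.tgt ≤ r then 2 else L.getD (e.tgt - (r + 1)) 0 : ℕ) : ℤ)
        else if e.tgt = x then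
        (e.q : ℤ) * ((if e.src ≤ r then 2 else L.getD (e.src - (r + 1)) 0 : ℕ) : ℤ) else 0).sum) := by
  unfold listBalance
  rw [List.map_append, List.sum_append, sum_chain r]
  · simp only [getD_spine]
  · intro y hy
    rw [getD_spine, if_pos hy]

/-! ### Goodness of the families settled by parity -/

namespace GenQuiver

variable {V : Type*} [Fintype V] [DecidableEq V] {P : GenQuiver V}

/-- With one loop the balance is zero and the weight is two, so the criterion fails and the
exceptional clause of goodness applies. With more loops the balance is positive and even. -/
theorem good_oneVertex {g : ℕ} (hg : 1 ≤ g) (h : P.toQuiverData.Iso (oneVertex 2 g)) :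
    P.IsGoodConnected := by
  by_cases h1 : g = 1
  · subst h1
    obtain ⟨e, he⟩ := h
    have : Unique V := e.unique
    have : Nonempty V := ⟨default⟩
    exact ⟨⟨SimpleGraph.Preconnected.of_subsingleton⟩, Or.inr (Or.inl ⟨2, le_rfl, e, he⟩)⟩
  · have hb : ∀ w, (oneVertex 2 g).balance w = (-2 + 2 * (g : ℤ)) * 2 := fun w => by
      simp [QuiverData.balance, oneVertex]
    refine isGoodConnected_of_iso h ⟨0, fun w => ?_⟩ (fun w => ?_) (Or.inr ⟨0, ?_⟩) ?_
      (confDim_ne_one_of_iso h fun w => ?_)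
    · rw [Subsingleton.elim w 0]
    · rw [hb]; omega
    · rw [hb]; omega
    · simp [oneVertex]
    · rw [hb]; exact even_two.mul_left _

theorem good_affE6 (a b c : ℕ) (ha : 0 < a) (hb : 0 < b) (hc : 0 < c)
    (h : P.toQuiverData.Iso (affE6 a b c)) : P.IsGoodConnected := by
  refine isGoodConnected_of_tree h rfl (by simp [IsTreeFrom]) (by simp; omega) (fun x hx => ?_)
    (Or.inl (by simp)) (by simp)
  simp only [List.length_cons, List.length_nil] at hx
  interval_cases x <;> simp [listBalance] <;> omega

theorem good_affE7 (a b : ℕ) (ha : 0 < a) (hb : 0 < b)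
    (h : P.toQuiverData.Iso (affE7 a b)) : P.IsGoodConnected := by
  refine isGoodConnected_of_tree h rfl (by simp [IsTreeFrom]) (by simp; omega) (fun x hx => ?_)
    (Or.inl (by simp)) (by simp)
  simp only [List.length_cons, List.length_nil] at hx
  interval_cases x <;> simp [listBalance] <;> omega

theorem good_affE8 (a : ℕ) (ha : 0 < a)
    (h : P.toQuiverData.Iso (affE8 a)) : P.IsGoodConnected := by
  refine isGoodConnected_of_tree h rfl (by simp [IsTreeFrom]) (by simp; omega) (fun x hx => ?_)
    (Or.inl (by simp)) (by simp)
  simp only [List.length_cons, List.length_nil] at hx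
  interval_cases x <;> simp [listBalance] <;> omega

theorem good_twD4 (a : ℕ) (ha : 0 < a)
    (h : P.toQuiverData.Iso (ofEdges [1, 2, 3] [edge 0 1 a 1, edge 2 1 3 1])) : P.IsGoodConnected := by
  refine isGoodConnected_of_tree h rfl (by simp [IsTreeFrom]) (by simp; omega) (fun x hx => ?_)
    (Or.inl (by simp)) (by simp)
  simp only [List.length_cons, List.length_nil] at hx
  interval_cases x <;> simp [listBalance] <;> omega

theorem good_twE6 (a : ℕ) (ha : 0 < a)
    (h : P.toQuiverData.Iso (ofEdges [2, 4, 3, 2, 1] [edge 0 1 1 1, edge 1 2 2 1, edge 2 3 1 1, edge 4 3 a 1])) : P.IsGoodConnected := by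
  refine isGoodConnected_of_tree h rfl (by simp [IsTreeFrom]) (by simp; omega) (fun x hx => ?_)
    (Or.inl (by simp)) (by simp)
  simp only [List.length_cons, List.length_nil] at hx
  interval_cases x <;> simp [listBalance] <;> omega

theorem good_affF4 (a b : ℕ) (ha : 0 < a) (hb : 0 < b)
    (h : P.toQuiverData.Iso (ofEdges [1, 2, 3, 2, 1]
      [edge 0 1 a 1, edge 1 2 1 1, edge 2 3 2 1, edge 4 3 b 1])) : P.IsGoodConnected := by
  refine isGoodConnected_of_tree h rfl (by simp [IsTreeFrom]) (by simp; omega) (fun x hx => ?_)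
    (Or.inl (by simp)) (by simp)
  simp only [List.length_cons, List.length_nil] at hx
  interval_cases x <;> simp [listBalance] <;> omega

theorem good_affG2 (a b : ℕ) (ha : 0 < a) (hb : 0 < b)
    (h : P.toQuiverData.Iso (ofEdges [1, 2, 1] [edge 0 1 a 1, edge 1 2 3 b])) : P.IsGoodConnected := by
  refine isGoodConnected_of_tree h rfl (by simp [IsTreeFrom]) (by simp; omega) (fun x hx => ?_)
    (Or.inl (by simp)) (by simp)
  simp only [List.length_cons, List.length_nil] at hx
  interval_cases x <;> simp [listBalance] <;> omega

theorem good_J33 (a b : ℕ) (ha : 0 < a) (hb : 0 < b)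
    (h : P.toQuiverData.Iso (ofEdges [1, 2, 1] [edge 0 1 a 3, edge 1 2 3 b])) : P.IsGoodConnected := by
  refine isGoodConnected_of_tree h rfl (by simp [IsTreeFrom]) (by simp; omega) (fun x hx => ?_)
    (Or.inl (by simp)) (by simp)
  simp only [List.length_cons, List.length_nil] at hx
  interval_cases x <;> simp [listBalance] <;> omega

theorem good_gc1
    (h : P.toQuiverData.Iso (gc1)) : P.IsGoodConnected := by
  refine isGoodConnected_of_tree h rfl (by simp [IsTreeFrom]) (by simp) (fun x hx => ?_)
    (Or.inr ⟨0, by simp, by simp [listBalance]⟩) (by simp)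
  simp only [List.length_cons, List.length_nil] at hx
  interval_cases x <;> simp [listBalance]

theorem good_affD (r a b c d : ℕ) (ha : 0 < a) (hb : 0 < b) (hc : 0 < c) (hd : 0 < d)
    (h : P.toQuiverData.Iso (affD r a b c d)) : P.IsGoodConnected := by
  refine isGoodConnected_of_tree h (by simp [length_chain]; omega)
    (IsTreeFrom.append.2 ⟨isTreeFrom_chain r, by simp [IsTreeFrom, length_chain]; omega⟩)
    (List.forall_mem_append.2 ⟨pos_chain r, by simp; omega⟩) (fun x hx => ?_)
    (Or.inl (by simp)) (by simp)
  rw [listBalance_spine]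
  simp only [List.length_append, List.length_replicate, List.length_cons, List.length_nil] at hx
  -- Spine vertices are treated uniformly in r; the leaves `r + 1 + j` form a finite list.
  obtain hx | ⟨j, rfl⟩ : x ≤ r ∨ ∃ j, x = r + 1 + j :=
    (le_or_gt x r).imp id fun hx => ⟨x - (r + 1), by omega⟩
  · simp [hx, List.getD] <;> split_ifs <;> omega
  · have hj : j < 4 := by omega
    interval_cases j <;> simp <;> omega

theorem good_twA2even (r a : ℕ) (ha : 0 < a)
    (h : P.toQuiverData.Iso (twA2even r a)) : P.IsGoodConnected := by
  refine isGoodConnected_of_tree h (by simp [length_chain]; omega)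
    (IsTreeFrom.append.2 ⟨isTreeFrom_chain r, by simp [IsTreeFrom, length_chain]; omega⟩)
    (List.forall_mem_append.2 ⟨pos_chain r, by simp; omega⟩) (fun x hx => ?_)
    (Or.inl (by simp)) (by simp)
  rw [listBalance_spine]
  simp only [List.length_append, List.length_replicate, List.length_cons, List.length_nil] at hx
  obtain hx | ⟨j, rfl⟩ : x ≤ r ∨ ∃ j, x = r + 1 + j :=
    (le_or_gt x r).imp id fun hx => ⟨x - (r + 1), by omega⟩
  · simp [hx, List.getD] <;> split_ifs <;> omega
  · have hj : j < 2 := by omega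
    interval_cases j <;> simp <;> omega

theorem good_twA2odd (r a b : ℕ) (ha : 0 < a) (hb : 0 < b)
    (h : P.toQuiverData.Iso (twA2odd r a b)) : P.IsGoodConnected := by
  refine isGoodConnected_of_tree h (by simp [length_chain]; omega)
    (IsTreeFrom.append.2 ⟨isTreeFrom_chain r, by simp [IsTreeFrom, length_chain]; omega⟩)
    (List.forall_mem_append.2 ⟨pos_chain r, by simp; omega⟩) (fun x hx => ?_)
    (Or.inl (by simp)) (by simp)
  rw [listBalance_spine]
  simp only [List.length_append, List.length_replicate, List.length_cons, List.length_nil] at hx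
  obtain hx | ⟨j, rfl⟩ : x ≤ r ∨ ∃ j, x = r + 1 + j :=
    (le_or_gt x r).imp id fun hx => ⟨x - (r + 1), by omega⟩
  · simp [hx, List.getD] <;> split_ifs <;> omega
  · have hj : j < 3 := by omega
    interval_cases j <;> simp <;> omega

theorem good_affB (r a b c : ℕ) (ha : 0 < a) (hb : 0 < b) (hc : 0 < c)
    (h : P.toQuiverData.Iso (affB r a b c)) : P.IsGoodConnected := by
  refine isGoodConnected_of_tree h (by simp [length_chain]; omega)
    (IsTreeFrom.append.2 ⟨isTreeFrom_chain r, by simp [IsTreeFrom, length_chain]; omega⟩)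
    (List.forall_mem_append.2 ⟨pos_chain r, by simp; omega⟩) (fun x hx => ?_)
    (Or.inl (by simp)) (by simp)
  rw [listBalance_spine]
  simp only [List.length_append, List.length_replicate, List.length_cons, List.length_nil] at hx
  obtain hx | ⟨j, rfl⟩ : x ≤ r ∨ ∃ j, x = r + 1 + j :=
    (le_or_gt x r).imp id fun hx => ⟨x - (r + 1), by omega⟩
  · simp [hx, List.getD] <;> split_ifs <;> omega
  · have hj : j < 3 := by omega
    interval_cases j <;> simp <;> omega

theorem good_twD (r a b : ℕ) (ha : 0 < a) (hb : 0 < b)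
    (h : P.toQuiverData.Iso (twD r a b)) : P.IsGoodConnected := by
  refine isGoodConnected_of_tree h (by simp [length_chain]; omega)
    (IsTreeFrom.append.2 ⟨isTreeFrom_chain r, by simp [IsTreeFrom, length_chain]; omega⟩)
    (List.forall_mem_append.2 ⟨pos_chain r, by simp; omega⟩) (fun x hx => ?_)
    (Or.inl (by simp)) (by simp)
  rw [listBalance_spine]
  simp only [List.length_append, List.length_replicate, List.length_cons, List.length_nil] at hx
  obtain hx | ⟨j, rfl⟩ : x ≤ r ∨ ∃ j, x = r + 1 + j :=
    (le_or_gt x r).imp id fun hx => ⟨x - (r + 1), by omega⟩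
  · simp [hx, List.getD] <;> split_ifs <;> omega
  · have hj : j < 2 := by omega
    interval_cases j <;> simp <;> omega

theorem good_gc (r : ℕ)
    (h : P.toQuiverData.Iso (gc r)) : P.IsGoodConnected := by
  refine isGoodConnected_of_tree h (by simp [length_chain]; omega)
    (IsTreeFrom.append.2 ⟨isTreeFrom_chain r, by simp [IsTreeFrom, length_chain]; omega⟩)
    (List.forall_mem_append.2 ⟨pos_chain r, by simp⟩) (fun x hx => ?_)
    (Or.inr ⟨r + 1, by simp, by rw [listBalance_spine]; simp⟩) (by simp)
  rw [listBalance_spine]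
  simp only [List.length_append, List.length_replicate, List.length_cons, List.length_nil] at hx
  obtain hx | ⟨j, rfl⟩ : x ≤ r ∨ ∃ j, x = r + 1 + j :=
    (le_or_gt x r).imp id fun hx => ⟨x - (r + 1), by omega⟩
  · simp [hx, List.getD] <;> split_ifs <;> omega
  · have hj : j < 2 := by omega
    interval_cases j <;> simp <;> omega

theorem good_gb (r a : ℕ) (ha : 0 < a)
    (h : P.toQuiverData.Iso (gb r a)) : P.IsGoodConnected := by
  refine isGoodConnected_of_tree h (by simp [length_chain]; omega)
    (IsTreeFrom.append.2 ⟨isTreeFrom_chain r, by simp [IsTreeFrom, length_chain]; omega⟩)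
    (List.forall_mem_append.2 ⟨pos_chain r, by simp; omega⟩) (fun x hx => ?_)
    (Or.inl (by simp)) (by simp)
  rw [listBalance_spine]
  simp only [List.length_append, List.length_replicate, List.length_cons, List.length_nil] at hx
  obtain hx | ⟨j, rfl⟩ : x ≤ r ∨ ∃ j, x = r + 1 + j :=
    (le_or_gt x r).imp id fun hx => ⟨x - (r + 1), by omega⟩
  · simp [hx, List.getD] <;> split_ifs <;> omega
  · have hj : j < 2 := by omega
    interval_cases j <;> simp <;> omega

theorem good_gd (r a b : ℕ) (ha : 0 < a) (hb : 0 < b)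
    (h : P.toQuiverData.Iso (gd r a b)) : P.IsGoodConnected := by
  refine isGoodConnected_of_tree h (by simp [length_chain]; omega)
    (IsTreeFrom.append.2 ⟨isTreeFrom_chain r, by simp [IsTreeFrom, length_chain]; omega⟩)
    (List.forall_mem_append.2 ⟨pos_chain r, by simp; omega⟩) (fun x hx => ?_)
    (Or.inl (by simp)) (by simp)
  rw [listBalance_spine]
  simp only [List.length_append, List.length_replicate, List.length_cons, List.length_nil] at hx
  obtain hx | ⟨j, rfl⟩ : x ≤ r ∨ ∃ j, x = r + 1 + j :=
    (le_or_gt x r).imp id fun hx => ⟨x - (r + 1), by omega⟩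
  · simp [hx, List.getD] <;> split_ifs <;> omega
  · have hj : j < 3 := by omega
    interval_cases j <;> simp <;> omega

end GenQuiver
-- Excluding Δ = 1 beyond parity: stars and Abelian quivers
namespace GenQuiver

theorem exists_sum_fin_two {n : ℕ} (hn : n = 2) (f : Fin n → ℤ) :
    ∃ p q : ℤ, ∀ F : ℤ → ℤ, ∑ a, F (f a) = F p + F q := by
  subst hn
  exact ⟨f 0, f 1, fun F => Fin.sum_univ_two _⟩

theorem exists_sum_fin_one {n : ℕ} (hn : n = 1) (f : Fin n → ℤ) :
    ∃ p : ℤ, ∀ F : ℤ → ℤ, ∑ a, F (f a) = F p := by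
  subst hn
  exact ⟨f 0, fun F => Fin.sum_univ_one _⟩

/-- The coordinate of `m` at a vertex (the only one for a vertex of weight one). -/
def coord {V : Type*} (P : GenQuiver V) (m : P.Lattice) (x : V) : ℤ := m ⟨x, ⟨0, P.K_pos x⟩⟩

theorem pairSum_of_abelian {V : Type*} {P : GenQuiver V} (hK : ∀ x, P.K x = 1) (m : P.Lattice) (x y : V) :
    P.pairSum m x y = |P.coord m x * P.A x y - P.coord m y * P.A y x| := by
  have key : ∀ {n : ℕ} (hn : n = 1) (h0 : 0 < n) (F : Fin n → ℤ), ∑ a, F a = F ⟨0, h0⟩ := by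
    intro n hn h0 F
    subst hn
    exact Fin.sum_univ_one _
  unfold pairSum coord
  rw [key (hK x) (P.K_pos x), key (hK y) (P.K_pos y)]

variable {V : Type*} [Fintype V] {P : GenQuiver V}

/-- Let p, q be the coordinates at the centre. If they agree, the centre does not affect the parity
of Δ, which is then even. Otherwise the triangle inequality bounds the edges below by |p - q| ∑
A(x,v) ≥ 4 |p - q|, while the centre subtracts only 2 |p - q|; so Δ ≥ 2. -/
theorem confDim_ne_one_of_star {x : V} (hx : P.K x = 2) (hxx : P.A x x = -2)
    (hz : ∀ z, z ≠ x → P.K z = 1) (hbal : 0 ≤ P.toQuiverData.balance x)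
    (heven : ∀ z, z ≠ x → Even (P.toQuiverData.balance z)) (m : P.Lattice) :
    P.confDim m ≠ 1 := by
  classical
  intro hone
  obtain ⟨p, q, hpq⟩ := exists_sum_fin_two hx fun a => m ⟨x, a⟩
  have hsumx : ∑ a, m ⟨x, a⟩ = p + q := hpq id
  obtain ⟨z, hz1, hz2⟩ := P.exists_confDim_eq m
  obtain rfl : z = 1 := by
    rw [hone] at hz1
    exact_mod_cast hz1.symm
  have hodd : p ≠ q := by
    rintro rfl
    have h1 : ((∑ y, P.toQuiverData.balance y * ∑ a, m ⟨y, a⟩ : ℤ) : ZMod 2) = 0 := by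
      rw [Int.cast_sum]
      refine Finset.sum_eq_zero fun y _ => ?_
      by_cases hy : y = x
      · subst hy
        rw [hsumx]
        push_cast
        rw [add_self_zmod_two, mul_zero]
      · obtain ⟨k, hk⟩ := heven y hy
        rw [hk]
        push_cast
        rw [add_self_zmod_two, zero_mul]
    rw [h1] at hz2
    exact absurd hz2 (by decide)
  have hd : 1 ≤ |p - q| := Int.one_le_abs (sub_ne_zero.2 hodd)
  set T : V → V → ℤ := fun u v => (P.A u v).sign * P.pairSum m u v with hT
  have hTxx : T x x = -4 * |p - q| := by
    simp only [hT]
    rw [P.sign_mul_pairSum_self, hxx, hpq fun c => ∑ b : Fin (P.K x), |c - m ⟨x, b⟩|,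
      hpq fun c => |p - c|, hpq fun c => |q - c|, abs_sub_comm q p]
    simp
    ring
  have hTne : ∀ u v, u ≠ v → T u v = P.pairSum m u v := fun u v h => P.sign_mul_pairSum_of_ne m h
  have hpair : ∀ v, v ≠ x → P.A x v * |p - q| ≤ P.pairSum m x v := by
    intro v hv
    obtain ⟨s, hs⟩ := exists_sum_fin_one (hz v hv) fun a => m ⟨v, a⟩
    unfold pairSum
    rw [hpq fun c => ∑ b : Fin (P.K v), |c * P.A x v - m ⟨v, b⟩ * P.A v x|,
      hs fun c => |p * P.A x v - c * P.A v x|, hs fun c => |q * P.A x v - c * P.A v x|]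
    rw [← abs_of_nonneg (P.offdiag_nonneg x v hv.symm), ← abs_mul,
      abs_of_nonneg (P.offdiag_nonneg x v hv.symm), abs_sub_comm (q * P.A x v)]
    have := abs_add_le (p * P.A x v - s * P.A v x) (s * P.A v x - q * P.A x v)
    rwa [show p * P.A x v - s * P.A v x + (s * P.A v x - q * P.A x v) = P.A x v * (p - q) by
      ring] at this
  have hrow : ∀ u, u ≠ x → P.pairSum m x u ≤ ∑ v, T u v := by
    intro u hu
    rw [P.pairSum_comm, ← hTne u x hu]
    refine Finset.single_le_sum (f := fun v => T u v) (fun v _ => ?_) (Finset.mem_univ x)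
    by_cases huv : u = v
    · subst huv
      have h1 : T u u = 0 := by
        obtain ⟨s, hs⟩ := exists_sum_fin_one (hz u hu) fun a => m ⟨u, a⟩
        simp only [hT]
        rw [P.sign_mul_pairSum_self, hs fun c => ∑ b : Fin (P.K u), |c - m ⟨u, b⟩|,
          hs fun c => |s - c|]
        simp
      rw [h1]
    · rw [hTne u v huv]
      exact P.pairSum_nonneg m u v
  have hbalx : P.toQuiverData.balance x = -4 + ∑ v ∈ Finset.univ.erase x, P.A x v := by
    unfold QuiverData.balance
    rw [← Finset.add_sum_erase _ _ (Finset.mem_univ x), hxx, hx]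
    congr 1
    refine Finset.sum_congr rfl fun v hv => ?_
    rw [hz v (Finset.ne_of_mem_erase hv)]
    simp
  have hsum : ∑ v ∈ Finset.univ.erase x, P.A x v * |p - q| ≤
      ∑ v ∈ Finset.univ.erase x, P.pairSum m x v :=
    Finset.sum_le_sum fun v hv => hpair v (Finset.ne_of_mem_erase hv)
  rw [← Finset.sum_mul] at hsum
  have htot : ∑ u, ∑ v, T u v = 2 := by
    have h1 := P.confDim_eq_pairSum m
    rw [hone] at h1
    have h2 : ((∑ u, ∑ v, T u v : ℤ) : ℝ) = 2 := by
      simp only [hT]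
      linarith
    exact_mod_cast h2
  rw [← Finset.add_sum_erase _ _ (Finset.mem_univ x),
    ← Finset.add_sum_erase Finset.univ (fun v => T x v) (Finset.mem_univ x)] at htot
  have h3 : ∑ v ∈ Finset.univ.erase x, T x v = ∑ v ∈ Finset.univ.erase x, P.pairSum m x v :=
    Finset.sum_congr rfl fun v hv => hTne x v (Finset.ne_of_mem_erase hv).symm
  have h4 : ∑ v ∈ Finset.univ.erase x, P.pairSum m x v ≤
      ∑ u ∈ Finset.univ.erase x, ∑ v, T u v :=
    Finset.sum_le_sum fun u hu => hrow u (Finset.ne_of_mem_erase hu)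
  have h5 : 4 ≤ ∑ v ∈ Finset.univ.erase x, P.A x v := by omega
  have h6 : 4 * |p - q| ≤ (∑ v ∈ Finset.univ.erase x, P.A x v) * |p - q| :=
    mul_le_mul_of_nonneg_right h5 (abs_nonneg _)
  rw [h3, hTxx] at htot
  linarith

/-- For weights one the diagonal terms vanish and Δ is a sum of non-negative integers over edges; a
sum equal to 1 has a single nonzero term. -/
theorem exists_unique_edge_of_confDim_eq_one (hK : ∀ x, P.K x = 1) {m : P.Lattice}
    (hone : P.confDim m = 1) : ∃ x y, x ≠ y ∧
      |P.coord m x * P.A x y - P.coord m y * P.A y x| = 1 ∧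
      ∀ u v, u ≠ v → ¬(u = x ∧ v = y) → ¬(u = y ∧ v = x) →
        P.coord m u * P.A u v = P.coord m v * P.A v u := by
  classical
  obtain ⟨r, _, hr, hrr, h⟩ := sum_sum_symm (fun x y => (P.A x y).sign * P.pairSum m x y)
    fun x y => by rw [P.sign_comm, P.pairSum_comm]
  have hdiag : ∀ x, (P.A x x).sign * P.pairSum m x x = 0 := fun x => by
    rw [pairSum_of_abelian hK]
    simp
  have h1 := P.confDim_eq_pairSum m
  rw [h, hone] at h1
  simp only [hdiag, Finset.sum_const_zero, zero_add] at h1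
  set T : V × V → ℤ := fun p =>
    if r p.1 p.2 then |P.coord m p.1 * P.A p.1 p.2 - P.coord m p.2 * P.A p.2 p.1| else 0 with hT
  have h2 : ∑ x, ∑ y, (if r x y then (P.A x y).sign * P.pairSum m x y else 0) = ∑ p, T p := by
    rw [Fintype.sum_prod_type]
    refine Finset.sum_congr rfl fun x _ => Finset.sum_congr rfl fun y _ => ?_
    by_cases hxy : r x y
    · have hne : x ≠ y := fun h' => hrr y (h' ▸ hxy)
      simp only [hT, if_pos hxy]
      rw [P.sign_mul_pairSum_of_ne m hne, pairSum_of_abelian hK]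
    · simp [hT, hxy]
  rw [h2] at h1
  have h3 : ∑ p, T p = 1 := by
    have h4 : ((∑ p, T p : ℤ) : ℝ) = 1 := by
      push_cast at h1 ⊢
      linarith
    exact_mod_cast h4
  have hT0 : ∀ p, 0 ≤ T p := fun p => by
    simp only [hT]
    split_ifs <;> simp
  obtain ⟨p, hp⟩ : ∃ p, T p ≠ 0 := by
    by_contra! hcon
    simp [hcon] at h3
  have h5 := Finset.add_sum_erase Finset.univ T (Finset.mem_univ p)
  rw [h3] at h5
  have h6 : 0 ≤ ∑ q ∈ Finset.univ.erase p, T q := Finset.sum_nonneg fun q _ => hT0 q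
  have h7 := hT0 p
  have h8 : ∑ q ∈ Finset.univ.erase p, T q = 0 := by omega
  have h9 : ∀ q, q ≠ p → T q = 0 := fun q hq =>
    (Finset.sum_eq_zero_iff_of_nonneg fun q _ => hT0 q).1 h8 q
      (Finset.mem_erase.2 ⟨hq, Finset.mem_univ q⟩)
  have hrp : r p.1 p.2 := by
    by_contra hcon
    exact hp (if_neg hcon)
  refine ⟨p.1, p.2, fun h' => hrr p.2 (h' ▸ hrp), ?_, fun u v huv hn1 hn2 => ?_⟩
  · have : T p = 1 := by omega
    simpa only [hT, if_pos hrp] using this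
  · by_cases hruv : r u v
    · have := h9 (u, v) fun h' => hn1 (by rw [← h']; exact ⟨rfl, rfl⟩)
      simp only [hT, if_pos hruv] at this
      linarith [abs_eq_zero.1 this]
    · have hrvu : r v u := by
        by_contra hcon
        exact hruv ((hr u v huv).2 hcon)
      have := h9 (v, u) fun h' => hn2 (by rw [← h']; exact ⟨rfl, rfl⟩)
      simp only [hT, if_pos hrvu] at this
      linarith [abs_eq_zero.1 this]

end GenQuiver

/-! ### The quivers `h_n` -/

/-- The edges of a linear quiver. -/
def pathEdges (n : ℕ) (ℓ k : ℕ → ℕ) : List Edge :=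
  (List.range n).map fun i => edge i (i + 1) (ℓ i) (k i)

theorem pathEdges_succ (n : ℕ) (ℓ k : ℕ → ℕ) :
    pathEdges (n + 1) ℓ k = pathEdges n ℓ k ++ [edge n (n + 1) (ℓ n) (k n)] := by
  simp [pathEdges, List.range_succ]

theorem length_pathEdges (n : ℕ) (ℓ k : ℕ → ℕ) : (pathEdges n ℓ k).length = n := by
  simp [pathEdges]

theorem mem_pathEdges {n : ℕ} {ℓ k : ℕ → ℕ} {e : Edge} :
    e ∈ pathEdges n ℓ k ↔ ∃ i < n, edge i (i + 1) (ℓ i) (k i) = e := by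
  simp [pathEdges]

theorem isTreeFrom_pathEdges (n : ℕ) (ℓ k : ℕ → ℕ) : IsTreeFrom 1 (pathEdges n ℓ k) := by
  induction n with
  | zero => trivial
  | succ n ih =>
    rw [pathEdges_succ, IsTreeFrom.append, length_pathEdges]
    refine ⟨ih, ?_⟩
    simp [IsTreeFrom]
    omega

theorem entries_pathEdges {n : ℕ} {ℓ k : ℕ → ℕ} {i : ℕ} (hi : i < n) :
    entries (pathEdges n ℓ k) i (i + 1) = ℓ i ∧ entries (pathEdges n ℓ k) (i + 1) i = k i :=
  (isTreeFrom_pathEdges n ℓ k).entries_edge (mem_pathEdges.2 ⟨i, hi, rfl⟩)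

theorem entries_pathEdges_eq_zero {n : ℕ} {ℓ k : ℕ → ℕ} {i j : ℕ} (h1 : j ≠ i + 1)
    (h2 : i ≠ j + 1) : entries (pathEdges n ℓ k) i j = 0 := by
  refine entries_eq_zero fun e he => ?_
  obtain ⟨s, -, rfl⟩ := mem_pathEdges.1 he
  unfold Edge.Joins
  simp only
  omega

theorem listBalance_pathEdges (n : ℕ) (ℓ k : ℕ → ℕ) (K : List ℕ) (hK : ∀ y ≤ n, K.getD y 0 = 1)
    {x : ℕ} (hx : x ≤ n) : listBalance K (pathEdges n ℓ k) x =
      -2 + ((if x < n then (ℓ x : ℤ) else 0) + if 0 < x then (k (x - 1) : ℤ) else 0) := by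
  unfold listBalance
  rw [hK x hx]
  congr 1
  have key : ∀ r ≤ n, ((pathEdges r ℓ k).map fun e =>
      if e.src = x then (e.p : ℤ) * (K.getD e.tgt 0 : ℕ)
      else if e.tgt = x then (e.q : ℤ) * (K.getD e.src 0 : ℕ) else 0).sum =
      (if x < r then (ℓ x : ℤ) else 0) + if 0 < x ∧ x ≤ r then (k (x - 1) : ℤ) else 0 := by
    intro r hr
    induction r with
    | zero => simp [pathEdges]; omega
    | succ r ih =>
      rw [pathEdges_succ, List.map_append, List.sum_append, ih (by omega)]
      simp only [List.map_cons, List.map_nil, List.sum_cons, List.sum_nil, hK r (by omega),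
        hK (r + 1) hr]
      rcases lt_trichotomy x r with h | h | h
      · simp [h, h.ne', h.le, (by omega : x < r + 1), (by omega : x ≤ r + 1)]
        omega
      · subst h
        simp [add_comm]
      · by_cases h2 : x = r + 1
        · subst h2
          simp
        · simp [h.ne, h.not_gt, h.not_ge]
          split_ifs <;> omega
  rw [key n le_rfl]
  congr 1
  by_cases h : 0 < x
  · rw [if_pos h, if_pos ⟨h, hx⟩]
  · rw [if_neg h, if_neg (by omega)]

namespace GenQuiver

variable {V : Type*} [Fintype V] [DecidableEq V] {P : GenQuiver V}

/-- The centre has balance ℓ - 4, which may be odd, so the star argument replaces parity. -/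
theorem good_Y {a ℓ : ℕ} (ha : 0 < a) (hℓ : 4 ≤ ℓ)
    (h : P.toQuiverData.Iso (ofEdges [1, 2] [edge 0 1 a ℓ])) : P.IsGoodConnected := by
  have hb0 : listBalance [1, 2] [edge 0 1 a ℓ] 0 = -2 + a * 2 := by simp [listBalance]
  have hb1 : listBalance [1, 2] [edge 0 1 a ℓ] 1 = -4 + ℓ := by simp [listBalance]
  refine isGoodConnected_of_tree' h rfl (by simp [IsTreeFrom]) (by simp; omega) (fun x hx => ?_)
    (Or.inl (by simp)) (by simp) ?_
  · simp only [List.length_cons, List.length_nil] at hx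
    interval_cases x
    · rw [hb0]; omega
    · rw [hb1]; omega
  · obtain ⟨e, hA, hK⟩ := h
    have hbal : ∀ x, P.toQuiverData.balance x = listBalance [1, 2] [edge 0 1 a ℓ] (e x).1 :=
      fun x => by rw [balance_of_iso e hA hK, balance_ofEdges (by simp)]
    have hne : ∀ z, z ≠ e.symm 1 → e z = 0 := fun z hz => by
      have : e z ≠ 1 := fun h => hz (by rw [← h, e.symm_apply_apply])
      revert this
      generalize e z = w
      revert w
      decide
    refine P.confDim_ne_one_of_star (x := e.symm 1) ?_ ?_ (fun z hz => ?_) ?_ (fun z hz => ?_)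
    · rw [← hK, e.apply_symm_apply]; rfl
    · rw [← hA, e.apply_symm_apply]; rfl
    · rw [← hK, hne z hz]; rfl
    · rw [hbal, e.apply_symm_apply]
      exact le_of_le_of_eq (by omega) hb1.symm
    · rw [hbal, hne z hz]
      change Even (listBalance _ _ 0)
      rw [hb0, Int.even_iff]
      omega

theorem good_J23 {a b : ℕ} (ha : 0 < a) (hb : 0 < b)
    (h : P.toQuiverData.Iso (ofEdges [1, 2, 1] [edge 0 1 a 2, edge 1 2 3 b])) :
    P.IsGoodConnected := by
  set E := [edge 0 1 a 2, edge 1 2 3 b] with hE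
  have hb0 : listBalance [1, 2, 1] E 0 = -2 + a * 2 := by simp [hE, listBalance]
  have hb1 : listBalance [1, 2, 1] E 1 = 1 := by simp [hE, listBalance]
  have hb2 : listBalance [1, 2, 1] E 2 = -2 + b * 2 := by simp [hE, listBalance]
  refine isGoodConnected_of_tree' h rfl (by simp [hE, IsTreeFrom]) (by simp [hE]; omega)
    (fun x hx => ?_) (Or.inl (by simp)) (by simp) ?_
  · simp only [List.length_cons, List.length_nil] at hx
    interval_cases x
    · rw [hb0]; omega
    · rw [hb1]; omega
    · rw [hb2]; omega
  · obtain ⟨e, hA, hK⟩ := h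
    have hbal : ∀ x, P.toQuiverData.balance x = listBalance [1, 2, 1] E (e x).1 :=
      fun x => by rw [balance_of_iso e hA hK, balance_ofEdges (by simp [hE])]
    have hne : ∀ z, z ≠ e.symm 1 → e z = 0 ∨ e z = 2 := fun z hz => by
      have : e z ≠ 1 := fun h => hz (by rw [← h, e.symm_apply_apply])
      revert this
      generalize e z = w
      revert w
      decide
    refine P.confDim_ne_one_of_star (x := e.symm 1) ?_ ?_ (fun z hz => ?_) ?_ (fun z hz => ?_)
    · rw [← hK, e.apply_symm_apply]; rfl
    · rw [← hA, e.apply_symm_apply]; rfl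
    · rcases hne z hz with h | h <;> rw [← hK, h] <;> rfl
    · rw [hbal, e.apply_symm_apply]
      exact le_of_le_of_eq (by omega) hb1.symm
    · rw [hbal]
      rcases hne z hz with h | h <;> rw [h]
      · change Even (listBalance _ _ 0)
        rw [hb0, Int.even_iff]
        omega
      · change Even (listBalance _ _ 2)
        rw [hb2, Int.even_iff]
        omega

/-- If Δ = 1, exactly one edge is unbalanced, by one. The gcd g of the two inward end labels divides
both sides of the edge equations when these are followed from either end, since g is coprime to the
labels that have to be cancelled. Hence g would divide 1. -/
theorem good_h {n : ℕ} {ℓ k : ℕ → ℕ} (hn : 1 ≤ n) (pos : ∀ i < n, 1 ≤ ℓ i ∧ 1 ≤ k i)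
    (hδ : 1 < Nat.gcd (ℓ 0) (k (n - 1)))
    (cop : ∀ i j, i ≤ j → j < n → ¬(i = 0 ∧ j = n - 1) → Nat.Coprime (ℓ i) (k j))
    (h : P.toQuiverData.Iso (abelianPath n ℓ k)) : P.IsGoodConnected := by
  set K := List.replicate (n + 1) 1 with hKdef
  have hget : ∀ y ≤ n, K.getD y 0 = 1 := fun y hy => by
    rw [hKdef, List.getD_eq_getElem _ _ (by simp; omega), List.getElem_replicate]
  have hlen : K.length = n + 1 := by simp [hKdef]
  have hpos0 := pos 0 (by omega)
  have hposn := pos (n - 1) (by omega)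
  have h2 : 2 ≤ ℓ 0 ∧ 2 ≤ k (n - 1) :=
    ⟨hδ.trans_le (Nat.le_of_dvd (by omega) (Nat.gcd_dvd_left _ _)),
      hδ.trans_le (Nat.le_of_dvd (by omega) (Nat.gcd_dvd_right _ _))⟩
  refine isGoodConnected_of_tree' (K := K) (E := pathEdges n ℓ k) h
    (by rw [hlen, length_pathEdges]; omega) (isTreeFrom_pathEdges n ℓ k) (fun e he => ?_)
    (fun x hx => ?_) (Or.inl ?_) ?_ fun m hone => ?_
  · obtain ⟨i, hi, rfl⟩ := mem_pathEdges.1 he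
    have := pos i hi
    exact ⟨this.1, this.2⟩
  · rw [listBalance_pathEdges n ℓ k K hget (by omega)]
    by_cases hx0 : 0 < x
    · have h3 := pos (x - 1) (by omega)
      rw [if_pos hx0]
      by_cases hxn : x < n
      · have h4 := pos x hxn
        rw [if_pos hxn]
        omega
      · rw [if_neg hxn]
        obtain rfl : x = n := by omega
        omega
    · obtain rfl : x = 0 := by omega
      rw [if_pos (by omega), if_neg (by omega)]
      omega
  · simp [hKdef]
  · simp [hKdef]; omega
  · obtain ⟨e, hA, hK⟩ := h
    have hK1 : ∀ x, P.K x = 1 := fun x => by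
      rw [← hK]
      simp [abelianPath, ofEdges]
    obtain ⟨x, y, hxy, h1, hrest⟩ := exists_unique_edge_of_confDim_eq_one hK1 hone
    let v : ℕ → V := fun i => if hi : i < K.length then e.symm ⟨i, hi⟩ else e.symm ⟨0, by simp⟩
    have hv : ∀ i (hi : i < K.length), v i = e.symm ⟨i, hi⟩ := fun i hi => dif_pos hi
    have hvinj : ∀ i j, i ≤ n → j ≤ n → v i = v j → i = j := fun i j hi hj hij => by
      rw [hv i (by omega), hv j (by omega)] at hij
      simpa using e.symm.injective hij
    have hAv : ∀ i j, i ≤ n → j ≤ n → i ≠ j → P.A (v i) (v j) =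
        entries (pathEdges n ℓ k) i j := fun i j hi hj hij => by
      rw [hv i (by omega), hv j (by omega), ← hA, e.apply_symm_apply, e.apply_symm_apply]
      have : (⟨i, by omega⟩ : Fin K.length) ≠ ⟨j, by omega⟩ := by simpa using hij
      exact if_neg this
    have hℓ : ∀ i < n, P.A (v i) (v (i + 1)) = ℓ i ∧ P.A (v (i + 1)) (v i) = k i := fun i hi => by
      rw [hAv _ _ (by omega) (by omega) (by omega), hAv _ _ (by omega) (by omega) (by omega)]
      exact entries_pathEdges hi
    have hsurj : ∀ z, ∃ i ≤ n, v i = z := fun z => by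
      refine ⟨(e z).1, ?_, ?_⟩
      · have := (e z).2
        change _ < K.length at this
        omega
      · rw [hv _ (e z).2]
        exact e.symm_apply_apply z
    have main : ∀ i < n, |P.coord m (v i) * P.A (v i) (v (i + 1)) -
        P.coord m (v (i + 1)) * P.A (v (i + 1)) (v i)| = 1 →
        (∀ u w, u ≠ w → ¬(u = v i ∧ w = v (i + 1)) → ¬(u = v (i + 1) ∧ w = v i) →
          P.coord m u * P.A u w = P.coord m w * P.A w u) → False := by
      intro i0 hi0 h1 hrest
      set u : ℕ → ℤ := fun i => P.coord m (v i) with hu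
      have hstep : ∀ i < n, i ≠ i0 → u i * ℓ i = u (i + 1) * k i := by
        intro i hi hne
        have h3 := hrest (v i) (v (i + 1)) (fun h => by have := hvinj _ _ (by omega) (by omega) h; omega)
          (fun h => hne (hvinj _ _ (by omega) (by omega) h.1))
          (fun h => by
            have h4 := hvinj _ _ (by omega) (by omega) h.1
            have h5 := hvinj _ _ (by omega) (by omega) h.2
            omega)
        rwa [(hℓ i hi).1, (hℓ i hi).2] at h3
      rw [(hℓ i0 hi0).1, (hℓ i0 hi0).2] at h1
      set g := Nat.gcd (ℓ 0) (k (n - 1)) with hg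
      have hcopk : ∀ i, i < n - 1 → IsCoprime (g : ℤ) (k i : ℤ) := fun i hi =>
        Nat.isCoprime_iff_coprime.2 (Nat.Coprime.coprime_dvd_left (Nat.gcd_dvd_left _ _)
          (cop 0 i (by omega) (by omega) (by omega)))
      have hcopl : ∀ i, 0 < i → i < n → IsCoprime (g : ℤ) (ℓ i : ℤ) := fun i h0 hi =>
        Nat.isCoprime_iff_coprime.2 (Nat.Coprime.coprime_dvd_left (Nat.gcd_dvd_right _ _)
          (cop i (n - 1) (by omega) (by omega) (by omega)).symm)
      -- From the left end: g divides ℓ 0, and passing edge i cancels k i, with i < n - 1.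
      have hF : ∀ i ≤ i0, (g : ℤ) ∣ u i * ℓ i := by
        intro i
        induction i with
        | zero =>
          intro _
          exact Dvd.dvd.mul_left (by exact_mod_cast Nat.gcd_dvd_left _ _) _
        | succ i ih =>
          intro hi
          have h3 := ih (by omega)
          rw [hstep i (by omega) (by omega)] at h3
          exact Dvd.dvd.mul_right ((hcopk i (by omega)).dvd_of_dvd_mul_right h3) _
      -- From the right end; d is the distance to the last edge.
      have hB : ∀ d i, i + d = n - 1 → i0 ≤ i → (g : ℤ) ∣ u (i + 1) * k i := by
        intro d
        induction d with
        | zero =>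
          intro i hi _
          obtain rfl : i = n - 1 := by omega
          exact Dvd.dvd.mul_left (by exact_mod_cast Nat.gcd_dvd_right _ _) _
        | succ d ih =>
          intro i hi hle
          have h3 := ih (i + 1) (by omega) (by omega)
          rw [← hstep (i + 1) (by omega) (by omega)] at h3
          exact Dvd.dvd.mul_right ((hcopl (i + 1) (by omega) (by omega)).dvd_of_dvd_mul_right h3) _
      have h3 := dvd_sub (hF i0 le_rfl) (hB (n - 1 - i0) i0 (by omega) le_rfl)
      have h4 : (g : ℤ) ∣ 1 := by
        rw [← h1]
        exact (dvd_abs _ _).2 h3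
      have h5 : g ∣ 1 := by exact_mod_cast h4
      have := Nat.le_of_dvd one_pos h5
      omega
    obtain ⟨i, hi, rfl⟩ := hsurj x
    obtain ⟨j, hj, rfl⟩ := hsurj y
    have hij : i ≠ j := fun h => hxy (by rw [h])
    by_cases h3 : j = i + 1
    · subst h3
      exact main i (by omega) h1 hrest
    · by_cases h4 : i = j + 1
      · subst h4
        rw [abs_sub_comm] at h1
        exact main j (by omega) h1 fun u w huw h5 h6 => hrest u w huw h6 h5
      · rw [hAv i j hi hj hij, hAv j i hj hi hij.symm, entries_pathEdges_eq_zero h3 h4,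
          entries_pathEdges_eq_zero h4 h3] at h1
        simp at h1

end GenQuiver
/-! ### The cyclic quivers -/

theorem entries_cycle {n : ℕ} {ℓ k : ℕ → ℕ} {i j : ℕ} (hij : i ≠ j) (hi : i < n + 1)
    (hj : j < n + 1) :
    entries ((List.range (n + 1)).map fun i => edge i ((i + 1) % (n + 1)) (ℓ i) (k i)) i j =
      (if (i + 1) % (n + 1) = j then (ℓ i : ℤ) else 0) +
        if (j + 1) % (n + 1) = i then (k j : ℤ) else 0 := by
  unfold entries
  rw [List.map_map]
  have h1 : ∀ s, ((fun e : Edge => e.entry i j) ∘ fun i => edge i ((i + 1) % (n + 1)) (ℓ i) (k i)) s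
      = (if i = s then (if (s + 1) % (n + 1) = j then (ℓ s : ℤ) else 0) else 0) +
        if j = s then (if (s + 1) % (n + 1) = i then (k s : ℤ) else 0) else 0 := by
    intro s
    simp only [Function.comp, Edge.entry]
    by_cases hs : i = s
    · subst hs
      simp [hij, hij.symm]
    · by_cases hs' : j = s
      · subst hs'
        simp [hij, hij.symm]
      · simp [hs, hs', Ne.symm hs, Ne.symm hs']
  have h2 : ∀ f : ℕ → ℤ, ((List.range (n + 1)).map f).sum = ∑ s ∈ Finset.range (n + 1), f s :=
    fun f => rfl
  rw [h2]
  simp only [h1, Finset.sum_add_distrib, Finset.sum_ite_eq, Finset.mem_range, hi, hj, if_true]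

theorem mod_ne_mod {n a b : ℕ} (h1 : a < b) (h2 : b < a + n) : a % n ≠ b % n := by
  intro h
  have h3 := (Nat.modEq_iff_dvd' h1.le).1 h
  have := Nat.le_of_dvd (by omega) h3
  omega

namespace GenQuiver

variable {V : Type*} [Fintype V] [DecidableEq V] {P : GenQuiver V}

/-- Across a balanced edge the product of coordinate and length is preserved. If all edges but one
are balanced, going round the cycle the other way shows that the last one is balanced too, so Δ = 1
does not occur. -/
theorem good_hbar {n : ℕ} {ℓ k : ℕ → ℕ} (hn : 2 ≤ n) (pos : ∀ i ≤ n, 1 ≤ ℓ i ∧ 1 ≤ k i)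
    (h : P.toQuiverData.Iso (abelianCycle n ℓ k)) : P.IsGoodConnected := by
  set K := List.replicate (n + 1) 1 with hKdef
  have hlen : K.length = n + 1 := by simp [hKdef]
  let w : ℕ → Fin K.length := fun i => ⟨i % (n + 1), by rw [hlen]; exact Nat.mod_lt _ (by omega)⟩
  have hw : ∀ x : Fin K.length, w x = x := fun x => Fin.ext (Nat.mod_eq_of_lt (hlen ▸ x.2))
  have hwne : ∀ i j, i < j → j < i + (n + 1) → w i ≠ w j := fun i j h1 h2 h3 =>
    mod_ne_mod h1 h2 (congrArg Fin.val h3)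
  have hwadd : ∀ i, w (i + (n + 1)) = w i := fun i => Fin.ext (Nat.add_mod_right _ _)
  have hKone : ∀ x, (abelianCycle n ℓ k).K x = 1 := fun x => by simp [abelianCycle, ofEdges]
  have hAne : ∀ x y : Fin K.length, x ≠ y → (abelianCycle n ℓ k).A x y =
      (if (x.1 + 1) % (n + 1) = y.1 then (ℓ x : ℤ) else 0) +
        if (y.1 + 1) % (n + 1) = x.1 then (k y : ℤ) else 0 := fun x y hxy =>
    (if_neg hxy).trans (entries_cycle (fun h => hxy (Fin.ext h)) (x.2.trans_eq hlen)
      (y.2.trans_eq hlen))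
  have hA0 : ∀ x y : Fin K.length, x ≠ y → 0 ≤ (abelianCycle n ℓ k).A x y := fun x y hxy => by
    rw [hAne x y hxy]
    split_ifs <;> omega
  have hAs : ∀ i, 1 ≤ (abelianCycle n ℓ k).A (w i) (w (i + 1)) ∧
      1 ≤ (abelianCycle n ℓ k).A (w (i + 1)) (w i) := by
    intro i
    have h1 := hwne i (i + 1) (by omega) (by omega)
    have h2 : (i % (n + 1) + 1) % (n + 1) = (i + 1) % (n + 1) := by simp
    have h3 := pos (i % (n + 1)) (Nat.lt_succ_iff.1 (Nat.mod_lt _ (by omega)))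
    rw [hAne _ _ h1, hAne _ _ h1.symm]
    simp only [w, h2, if_true]
    constructor <;> split_ifs <;> omega
  refine isGoodConnected_of_iso h ⟨w 0, fun x => ?_⟩ (fun x => ?_) (Or.inl ⟨w 0, hKone _⟩) ?_
    fun m hone => ?_
  · rw [← hw x]
    generalize x.1 = i
    induction i with
    | zero => exact Relation.ReflTransGen.refl
    | succ i ih =>
      refine Relation.ReflTransGen.head ?_ ih
      have := (hAs i).2
      omega
  · have h1 : ∃ i, x = w (i + 1) := ⟨x + n, (hw x).symm.trans (hwadd x.1).symm⟩
    obtain ⟨i, rfl⟩ := h1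
    unfold QuiverData.balance
    simp only [hKone, Nat.cast_one, mul_one]
    have h2 := Finset.add_sum_erase Finset.univ ((abelianCycle n ℓ k).A (w (i + 1)))
      (Finset.mem_univ (w (i + 1)))
    have h3 : ∑ y ∈ {w i, w (i + 2)}, (abelianCycle n ℓ k).A (w (i + 1)) y ≤
        ∑ y ∈ Finset.univ.erase (w (i + 1)), (abelianCycle n ℓ k).A (w (i + 1)) y := by
      refine Finset.sum_le_sum_of_subset_of_nonneg ?_ fun y hy _ =>
        hA0 _ _ (Finset.ne_of_mem_erase hy).symm
      intro y hy
      simp only [Finset.mem_insert, Finset.mem_singleton] at hy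
      rcases hy with rfl | rfl
      · exact Finset.mem_erase.2 ⟨hwne _ _ (by omega) (by omega), Finset.mem_univ _⟩
      · exact Finset.mem_erase.2 ⟨(hwne _ _ (by omega) (by omega)).symm, Finset.mem_univ _⟩
    rw [Finset.sum_pair (hwne _ _ (by omega) (by omega))] at h3
    have h4 := (hAs i).2
    have h5 := (hAs (i + 1)).1
    have h6 : (abelianCycle n ℓ k).A (w (i + 1)) (w (i + 1)) = -2 := if_pos rfl
    rw [h6] at h2
    rw [← h2]
    have h7 : w (i + 1 + 1) = w (i + 2) := rfl
    rw [h7] at h5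
    linarith
  · simp only [hKone, Finset.sum_const, Finset.card_univ, Fintype.card_fin]
    simp
    omega
  · obtain ⟨e, hA, hK⟩ := h
    have hK1 : ∀ x, P.K x = 1 := fun x => by rw [← hK, hKone]
    obtain ⟨x, y, hxy, h1, hrest⟩ := exists_unique_edge_of_confDim_eq_one hK1 hone
    obtain ⟨L, hL0, hL⟩ := P.length
    let v : ℕ → V := fun i => e.symm (w i)
    have hvne : ∀ i j, i < j → j < i + (n + 1) → v i ≠ v j := fun i j h1 h2 h3 =>
      hwne i j h1 h2 (e.symm.injective h3)
    have main : ∀ i0, |P.coord m (v i0) * P.A (v i0) (v (i0 + 1)) -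
        P.coord m (v (i0 + 1)) * P.A (v (i0 + 1)) (v i0)| = 1 →
        (∀ u z, u ≠ z → ¬(u = v i0 ∧ z = v (i0 + 1)) → ¬(u = v (i0 + 1) ∧ z = v i0) →
          P.coord m u * P.A u z = P.coord m z * P.A z u) → False := by
      intro i0 h1 hrest
      have hc : ∀ j ≤ n, P.coord m (v (i0 + 1 + j)) * L (v (i0 + 1 + j)) =
          P.coord m (v (i0 + 1)) * L (v (i0 + 1)) := by
        intro j
        induction j with
        | zero => intro _; rfl
        | succ j ih =>
          intro hj
          rw [← ih (by omega)]
          have h3 := hrest (v (i0 + 1 + j)) (v (i0 + 1 + (j + 1)))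
            (hvne _ _ (by omega) (by omega)) (fun h => hvne i0 (i0 + 1 + j) (by omega) (by omega)
              h.1.symm) (fun h => by
                rcases Nat.eq_zero_or_pos j with rfl | hj0
                · exact hvne i0 (i0 + 1 + (0 + 1)) (by omega) (by omega) h.2.symm
                · exact hvne (i0 + 1) (i0 + 1 + j) (by omega) (by omega) h.1.symm)
          have h4 := hL (v (i0 + 1 + j)) (v (i0 + 1 + (j + 1)))
          have h5 : P.A (v (i0 + 1 + (j + 1))) (v (i0 + 1 + j)) ≠ 0 := by
            have := (hAs (i0 + 1 + j)).2
            have h6 : P.A (v (i0 + 1 + (j + 1))) (v (i0 + 1 + j)) =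
                (abelianCycle n ℓ k).A (w (i0 + 1 + j + 1)) (w (i0 + 1 + j)) := by
              rw [← hA]
              simp [v, add_assoc]
            rw [h6]
            omega
          refine mul_right_cancel₀ h5 ?_
          linear_combination (-(L (v (i0 + 1 + (j + 1))) : ℤ)) * h3 +
            (P.coord m (v (i0 + 1 + j))) * h4
      have h2 := hc n le_rfl
      have h3 : v (i0 + 1 + n) = v i0 := by
        simp only [v]
        rw [show i0 + 1 + n = i0 + (n + 1) by omega, hwadd]
      rw [h3] at h2
      have h4 := hL (v i0) (v (i0 + 1))
      have h5 : (P.coord m (v i0) * P.A (v i0) (v (i0 + 1)) -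
        P.coord m (v (i0 + 1)) * P.A (v (i0 + 1)) (v i0)) * L (v (i0 + 1)) = 0 := by
        linear_combination (P.A (v (i0 + 1)) (v i0)) * h2 + (P.coord m (v i0)) * h4
      rcases mul_eq_zero.1 h5 with h6 | h6
      · rw [h6] at h1
        simp at h1
      · have := hL0 (v (i0 + 1))
        omega
    have hsurj : ∀ z, v (e z) = z := fun z => by
      simp only [v]
      rw [hw, e.symm_apply_apply]
    by_cases h3 : ((e x).1 + 1) % (n + 1) = (e y).1
    · have h4 : v ((e x).1 + 1) = y := by
        rw [← hsurj y, ← h3]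
        simp [v, w]
      refine main (e x).1 ?_ ?_
      · rw [h4, hsurj]; exact h1
      · rw [h4, hsurj]; exact hrest
    · by_cases h4 : ((e y).1 + 1) % (n + 1) = (e x).1
      · have h5 : v ((e y).1 + 1) = x := by
          rw [← hsurj x, ← h4]
          simp [v, w]
        refine main (e y).1 ?_ ?_
        · rw [h5, hsurj, abs_sub_comm]; exact h1
        · rw [h5, hsurj]
          exact fun u z huz h6 h7 => hrest u z huz h7 h6
      · have h5 : e x ≠ e y := fun h => hxy (e.injective h)
        rw [← hA, ← hA, hAne _ _ h5, hAne _ _ h5.symm] at h1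
        simp [h3, h4] at h1

end GenQuiver
namespace GenQuiver

/-! ### Induced paths and cycles -/

section Labels

variable {V : Type*} (Q : GenQuiver V)

/-- `Q` contains a quiver of the list. -/
def HasListed : Prop := ∃ (W : Type) (R : QuiverData W), IsListed R ∧ Q.Contains R

/-- The label of the edge from `x` to `y` as a natural number. -/
def lab (x y : V) : ℕ := (Q.A x y).toNat

variable {Q}

theorem A_eq_lab {x y : V} (h : x ≠ y) : Q.A x y = Q.lab x y :=
  (Int.toNat_of_nonneg (Q.offdiag_nonneg x y h)).symm

theorem lab_pos {x y : V} (h : Q.graph.Adj x y) : 0 < Q.lab x y := by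
  have h1 := Q.offdiag_nonneg x y h.1
  have h2 := h.2
  unfold lab
  omega

theorem adj_of_lab_pos {x y : V} (hxy : x ≠ y) (h : 0 < Q.lab x y) : Q.graph.Adj x y := by
  refine ⟨hxy, ?_⟩
  unfold lab at h
  omega

theorem A_eq_zero {x y : V} (hxy : x ≠ y) (h : ¬ Q.graph.Adj x y) : Q.A x y = 0 := by
  by_contra hcon
  exact h ⟨hxy, hcon⟩

theorem contains_ofEdges {K : List ℕ} {E : List Edge} (f : ℕ → V)
    (hinj : ∀ i j, i < j → j < K.length → f i ≠ f j)
    (hA : ∀ i j, i ≠ j → i < K.length → j < K.length → Q.A (f i) (f j) = entries E i j)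
    (hK : ∀ i < K.length, 0 < K.getD i 0 ∧ K.getD i 0 ≤ Q.K (f i))
    (hd : ∀ i < K.length, K.getD i 0 ≠ 1 → Q.A (f i) (f i) = -2) :
    Q.Contains (ofEdges K E) := by
  have hget : ∀ i : Fin K.length, (ofEdges K E).K i = K.getD i 0 := fun i => by simp [ofEdges]
  refine ⟨fun i => f i, fun i j hij => ?_, fun i j hij => ?_, fun i => ?_, fun i => ?_⟩
  · by_contra hne
    have hne' : i.1 ≠ j.1 := fun h => hne (Fin.ext h)
    rcases lt_or_gt_of_ne hne' with h | h
    · exact hinj _ _ h j.2 hij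
    · exact hinj _ _ h i.2 hij.symm
  · rw [ofEdges_A, if_neg hij]
    exact hA _ _ (fun h => hij (Fin.ext h)) i.2 j.2
  · rw [hget]
    exact hK i i.2
  · rw [ofEdges_A, if_pos rfl, hget]
    split_ifs with h
    · rfl
    · exact (hd i i.2 h).symm

variable (Q) in
/-- The vertices `v 0, …, v n` are distinct and `v` is an induced path. -/
def IsInduced (n : ℕ) (v : ℕ → V) : Prop :=
  ∀ i j, i < j → j ≤ n → v i ≠ v j ∧ (Q.graph.Adj (v i) (v j) ↔ j = i + 1)

/-- Strong induction on the length: if the end labels have a common factor while all proper subpaths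
satisfy the claim, the path is exactly a listed `h`. -/
theorem coprime_of_induced (hno : ¬ Q.HasListed) (n : ℕ) :
    ∀ v : ℕ → V, 1 ≤ n → Q.IsInduced n v →
      Nat.Coprime (Q.lab (v 0) (v 1)) (Q.lab (v n) (v (n - 1))) := by
  induction n using Nat.strong_induction_on with
  | _ n ih =>
    intro v hn hv
    by_contra hcop
    have hadj : ∀ i < n, Q.graph.Adj (v i) (v (i + 1)) := fun i hi =>
      (hv i (i + 1) (by omega) (by omega)).2.2 rfl
    have hn1 : n - 1 + 1 = n := by omega
    refine hno ⟨_, _, IsListed.h n (fun i => Q.lab (v i) (v (i + 1)))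
      (fun i => Q.lab (v (i + 1)) (v i)) hn
      (fun i hi => ⟨lab_pos (hadj i hi), lab_pos (hadj i hi).symm⟩) ?_ ?_, ?_⟩
    · rw [hn1]
      have h1 : Nat.gcd (Q.lab (v 0) (v 1)) (Q.lab (v n) (v (n - 1))) ≠ 0 := fun h =>
        (lab_pos (hadj 0 (by omega))).ne' (Nat.gcd_eq_zero_iff.1 h).1
      have h2 : Nat.gcd (Q.lab (v 0) (v 1)) (Q.lab (v n) (v (n - 1))) ≠ 1 := hcop
      simp only [zero_add]
      omega
    · intro i j hij hj hne
      have h1 := ih (j + 1 - i) (by omega) (fun t => v (i + t)) (by omega) fun a b hab hb => by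
        have := hv (i + a) (i + b) (by omega) (by omega)
        exact ⟨this.1, this.2.trans (by omega)⟩
      rw [show i + (j + 1 - i) = j + 1 by omega, show i + (j + 1 - i - 1) = j by omega] at h1
      exact h1
    · refine contains_ofEdges (E := pathEdges n (fun i => Q.lab (v i) (v (i + 1)))
        (fun i => Q.lab (v (i + 1)) (v i))) v ?_ ?_ ?_ ?_
      · intro i j hij hj
        rw [List.length_replicate] at hj
        exact (hv i j hij (by omega)).1
      · intro i j hij hi hj
        rw [List.length_replicate] at hi hj
        by_cases h1 : j = i + 1
        · subst h1
          rw [(entries_pathEdges (by omega)).1,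
            A_eq_lab (hv i (i + 1) (by omega) (by omega)).1]
        · by_cases h2 : i = j + 1
          · subst h2
            rw [(entries_pathEdges (by omega)).2,
              A_eq_lab (hv j (j + 1) (by omega) (by omega)).1.symm]
          · rw [entries_pathEdges_eq_zero h1 h2]
            rcases lt_or_gt_of_ne hij with h | h
            · have h3 := hv i j h (by omega)
              exact A_eq_zero h3.1 fun h4 => h1 (h3.2.1 h4)
            · have h3 := hv j i h (by omega)
              exact A_eq_zero h3.1.symm fun h4 => h2 (h3.2.1 h4.symm)
      · intro i hi
        rw [List.getD_eq_getElem _ _ hi, List.getElem_replicate]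
        exact ⟨one_pos, Q.K_pos _⟩
      · intro i hi h
        rw [List.getD_eq_getElem _ _ hi, List.getElem_replicate] at h
        exact absurd rfl h

/-- An induced cycle would be a listed `hbar`. The product condition telescopes from the length
function. Coprimality comes from `coprime_of_induced` on arcs with at most n - 1 edges, which are
induced paths; the two excluded residues are the longer arcs. -/
theorem not_induced_cycle (hno : ¬ Q.HasListed) {n : ℕ} (hn : 2 ≤ n) (v : ℕ → V)
    (hv : ∀ i j, i < j → j ≤ n →
      v i ≠ v j ∧ (Q.graph.Adj (v i) (v j) ↔ j = i + 1 ∨ i = 0 ∧ j = n)) : False := by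
  let u : ℕ → V := fun i => v (i % (n + 1))
  have hu : ∀ i ≤ n, u i = v i := fun i hi => by
    simp only [u]
    rw [Nat.mod_eq_of_lt (by omega)]
  have huN : u (n + 1) = v 0 := by simp [u]
  -- In the periodic extension, positions less than a period apart are adjacent exactly when they
  -- differ by 1 or n.
  have key : ∀ a b, a < b → b < a + (n + 1) →
      u a ≠ u b ∧ (Q.graph.Adj (u a) (u b) ↔ b = a + 1 ∨ b = a + n) := by
    intro a b hab hb
    have h1 := Nat.mod_add_div a (n + 1)
    have h2 := Nat.mod_add_div b (n + 1)
    have h3 := Nat.mod_lt a (show 0 < n + 1 by omega)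
    have h4 := Nat.mod_lt b (show 0 < n + 1 by omega)
    simp only [u]
    generalize a % (n + 1) = a' at *
    generalize b % (n + 1) = b' at *
    generalize a / (n + 1) = q at *
    generalize b / (n + 1) = q' at *
    rcases lt_or_ge q' q with h5 | h5
    · have := Nat.mul_le_mul_left (n + 1) (show q' + 1 ≤ q from h5)
      rw [mul_add] at this
      omega
    · rcases Nat.lt_or_ge (q + 1) q' with h6 | h6
      · have := Nat.mul_le_mul_left (n + 1) (show q + 2 ≤ q' from h6)
        rw [mul_add] at this
        omega
      · rcases Nat.lt_or_ge q q' with h7 | h7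
        · obtain rfl : q' = q + 1 := by omega
          rw [mul_add] at h2
          have h8 := hv b' a' (by omega) (by omega)
          refine ⟨h8.1.symm, (Q.graph.adj_comm _ _).trans (h8.2.trans ?_)⟩
          omega
        · obtain rfl : q' = q := by omega
          have h8 := hv a' b' (by omega) (by omega)
          refine ⟨h8.1, h8.2.trans ?_⟩
          omega
  have hadj : ∀ i, Q.graph.Adj (u i) (u (i + 1)) := fun i =>
    (key i (i + 1) (by omega) (by omega)).2.2 (Or.inl rfl)
  refine hno ⟨_, _, IsListed.hbar n (fun i => Q.lab (u i) (u (i + 1)))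
      (fun i => Q.lab (u (i + 1)) (u i)) hn
      (fun i _ => ⟨lab_pos (hadj i), lab_pos (hadj i).symm⟩) ?_ ?_, ?_⟩
  · obtain ⟨L, hL0, hL⟩ := Q.length
    have h1 : ∀ i, Q.lab (u i) (u (i + 1)) * L (u (i + 1)) =
        Q.lab (u (i + 1)) (u i) * L (u i) := fun i => by
      have := hL (u i) (u (i + 1))
      rw [A_eq_lab (hadj i).1, A_eq_lab (hadj i).1.symm] at this
      exact_mod_cast this
    have h2 : ∏ i ∈ Finset.range (n + 1), L (u (i + 1)) = ∏ i ∈ Finset.range (n + 1), L (u i) := by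
      rw [Finset.prod_range_succ, Finset.prod_range_succ', huN, hu 0 (by omega)]
    have h3 : 0 < ∏ i ∈ Finset.range (n + 1), L (u i) := Finset.prod_pos fun i _ => hL0 _
    refine Nat.eq_of_mul_eq_mul_right h3 ?_
    rw [← Finset.prod_mul_distrib]
    conv_rhs => rw [← h2]
    rw [← Finset.prod_mul_distrib]
    exact Finset.prod_congr rfl fun i _ => (h1 i).symm
  · intro i hi j hj hne1 hne2
    have main : ∀ m, 1 ≤ m → m + 1 ≤ n → Nat.Coprime (Q.lab (u i) (u (i + 1)))
        (Q.lab (u (i + m)) (u (i + (m - 1)))) := by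
      intro m hm hmn
      refine coprime_of_induced hno m (fun t => u (i + t)) hm fun a b hab hb => ?_
      have := key (i + a) (i + b) (by omega) (by omega)
      exact ⟨this.1, this.2.trans (by omega)⟩
    have hN : ∀ a, u (a + (n + 1)) = u a := fun a => by simp [u]
    by_cases hij : i ≤ j
    · have h1 : ¬ (i = 0 ∧ j = n) := by
        rintro ⟨rfl, rfl⟩
        exact hne1 (by simp [Nat.ModEq])
      have h2 : ¬ (i = 0 ∧ j + 1 = n) := by
        rintro ⟨rfl, rfl⟩
        exact hne2 (by simp [Nat.ModEq])
      have h3 : ¬ (i = 1 ∧ j = n) := by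
        rintro ⟨rfl, rfl⟩
        exact hne2 (by simp [Nat.ModEq, show j + 2 = 1 + (j + 1) by omega])
      have := main (j + 1 - i) (by omega) (by omega)
      rwa [show i + (j + 1 - i) = j + 1 by omega, show i + (j + 1 - i - 1) = j by omega] at this
    · have h1 : i ≠ j + 1 := fun h => hne1 (by rw [h])
      have h2 : i ≠ j + 2 := fun h => hne2 (by rw [h])
      have := main (j + 1 + (n + 1) - i) (by omega) (by omega)
      rwa [show i + (j + 1 + (n + 1) - i) = j + 1 + (n + 1) by omega,
        show i + (j + 1 + (n + 1) - i - 1) = j + (n + 1) by omega, hN, hN] at this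
  · refine contains_ofEdges v ?_ ?_ ?_ ?_
    · intro i j hij hj
      rw [List.length_replicate] at hj
      exact (hv i j hij (by omega)).1
    · intro i j hij hi hj
      rw [List.length_replicate] at hi hj
      rw [entries_cycle hij hi hj]
      have h1 : ∀ i < n + 1, (i + 1) % (n + 1) = if i = n then 0 else i + 1 := fun i hi => by
        split_ifs with h
        · rw [h, Nat.mod_self]
        · exact Nat.mod_eq_of_lt (by omega)
      have h2 : v i ≠ v j ∧ (Q.graph.Adj (v i) (v j) ↔
          ((i + 1) % (n + 1) = j ∨ (j + 1) % (n + 1) = i)) := by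
        rw [h1 i hi, h1 j hj]
        rcases lt_or_gt_of_ne hij with h | h
        · have := hv i j h (by omega)
          refine ⟨this.1, this.2.trans ?_⟩
          split_ifs <;> omega
        · have := hv j i h (by omega)
          refine ⟨this.1.symm, (Q.graph.adj_comm _ _).trans (this.2.trans ?_)⟩
          split_ifs <;> omega
      have h3 : ¬ ((i + 1) % (n + 1) = j ∧ (j + 1) % (n + 1) = i) := by
        rw [h1 i hi, h1 j hj]
        split_ifs <;> omega
      by_cases h4 : (i + 1) % (n + 1) = j
      · rw [if_pos h4, if_neg fun h => h3 ⟨h4, h⟩, add_zero, A_eq_lab h2.1]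
        simp only [u]
        rw [h4, Nat.mod_eq_of_lt hi]
      · by_cases h5 : (j + 1) % (n + 1) = i
        · rw [if_neg h4, if_pos h5, zero_add, A_eq_lab h2.1]
          simp only [u]
          rw [h5, Nat.mod_eq_of_lt hj]
        · rw [if_neg h4, if_neg h5, add_zero]
          exact A_eq_zero h2.1 fun h => (h2.2.1 h).elim h4 h5
    · intro i hi
      rw [List.getD_eq_getElem _ _ hi, List.getElem_replicate]
      exact ⟨one_pos, Q.K_pos _⟩
    · intro i hi h
      rw [List.getD_eq_getElem _ _ hi, List.getElem_replicate] at h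
      exact absurd rfl h

variable (Q) in
/-- The sequence `v 0, …, v n` is a walk without backtracking. -/
def IsNonBack (n : ℕ) (v : ℕ → V) : Prop :=
  (∀ i < n, Q.graph.Adj (v i) (v (i + 1))) ∧ ∀ i, i + 2 ≤ n → v i ≠ v (i + 2)

/-- Induction on the distance d of two positions. A coincidence at distance d ≥ 3 gives a chord at
distance d - 1, and a first chord closes an induced cycle. -/
theorem IsNonBack.induced (hno : ¬ Q.HasListed) {n : ℕ} {v : ℕ → V} (hv : Q.IsNonBack n v) :
    Q.IsInduced n v := by
  have key : ∀ d, ∀ a, a + d ≤ n → 1 ≤ d →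
      v a ≠ v (a + d) ∧ (2 ≤ d → ¬ Q.graph.Adj (v a) (v (a + d))) := by
    intro d
    induction d using Nat.strong_induction_on with
    | _ d ih =>
      intro a had hd
      by_cases hd1 : d = 1
      · subst hd1
        exact ⟨(hv.1 a (by omega)).1, fun h => by omega⟩
      have hne : v a ≠ v (a + d) := by
        by_cases hd2 : d = 2
        · subst hd2
          exact hv.2 a had
        · intro h
          refine (ih (d - 1) (by omega) a (by omega) (by omega)).2 (by omega) ?_
          rw [h]
          have := (hv.1 (a + (d - 1)) (by omega)).symm
          rwa [show a + (d - 1) + 1 = a + d by omega] at this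
      refine ⟨hne, fun hd2 hadj => ?_⟩
      refine not_induced_cycle hno hd2 (fun t => v (a + t)) fun i j hij hj => ?_
      by_cases h1 : i = 0 ∧ j = d
      · obtain ⟨rfl, rfl⟩ := h1
        exact ⟨hne, by simpa using hadj⟩
      · have h2 := ih (j - i) (by omega) (a + i) (by omega) (by omega)
        rw [show a + i + (j - i) = a + j by omega] at h2
        refine ⟨h2.1, fun h => Or.inl ?_, fun h => ?_⟩
        · by_contra hcon
          exact h2.2 (by omega) h
        · obtain rfl : j = i + 1 := by omega
          exact hv.1 (a + i) (by omega)
  intro i j hij hj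
  have h1 := key (j - i) i (by omega) (by omega)
  rw [show i + (j - i) = j by omega] at h1
  refine ⟨h1.1, fun h => ?_, fun h => ?_⟩
  · by_contra hcon
    exact h1.2 (by omega) h
  · subst h
    exact hv.1 i (by omega)

theorem IsNonBack.coprime (hno : ¬ Q.HasListed) {n : ℕ} {v : ℕ → V} (hv : Q.IsNonBack n v)
    (hn : 1 ≤ n) : Nat.Coprime (Q.lab (v 0) (v 1)) (Q.lab (v n) (v (n - 1))) :=
  coprime_of_induced hno n v hn (hv.induced hno)

theorem coprime_of_adj (hno : ¬ Q.HasListed) {x y : V} (h : Q.graph.Adj x y) :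
    Nat.Coprime (Q.lab x y) (Q.lab y x) := by
  refine IsNonBack.coprime hno (n := 1) (v := fun i => if i = 0 then x else y)
    ⟨fun i hi => ?_, fun i hi => by omega⟩ le_rfl
  obtain rfl : i = 0 := by omega
  exact h

theorem IsNonBack.reverse {n : ℕ} {v : ℕ → V} (hv : Q.IsNonBack n v) :
    Q.IsNonBack n fun i => v (n - i) := by
  refine ⟨fun i hi => ?_, fun i hi => ?_⟩
  · have := (hv.1 (n - (i + 1)) (by omega)).symm
    rwa [show n - (i + 1) + 1 = n - i by omega] at this
  · have := (hv.2 (n - (i + 2)) (by omega)).symm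
    rwa [show n - (i + 2) + 2 = n - i by omega] at this

theorem IsNonBack.snoc {n : ℕ} {v : ℕ → V} (hv : Q.IsNonBack n v) {z : V}
    (hz : Q.graph.Adj (v n) z) (hz' : 1 ≤ n → v (n - 1) ≠ z) :
    Q.IsNonBack (n + 1) fun i => if i ≤ n then v i else z := by
  refine ⟨fun i hi => ?_, fun i hi => ?_⟩
  · by_cases h : i < n
    · simp only [h.le, (by omega : i + 1 ≤ n), if_true]
      exact hv.1 i h
    · obtain rfl : i = n := by omega
      simpa using hz
  · by_cases h : i + 2 ≤ n
    · simp only [h, (by omega : i ≤ n), if_true]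
      exact hv.2 i h
    · simp only [h, (by omega : i ≤ n), if_true, if_false]
      have := hz' (by omega)
      rwa [show n - 1 = i by omega] at this

theorem IsNonBack.cons {n : ℕ} {v : ℕ → V} (hv : Q.IsNonBack n v) {z : V}
    (hz : Q.graph.Adj z (v 0)) (hz' : 1 ≤ n → z ≠ v 1) :
    Q.IsNonBack (n + 1) fun i => if i = 0 then z else v (i - 1) := by
  refine ⟨fun i hi => ?_, fun i hi => ?_⟩
  · rcases Nat.eq_zero_or_pos i with rfl | h
    · simpa using hz
    · simp only [h.ne', if_false, Nat.succ_ne_zero, Nat.add_sub_cancel]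
      have := hv.1 (i - 1) (by omega)
      rwa [show i - 1 + 1 = i by omega] at this
  · rcases Nat.eq_zero_or_pos i with rfl | h
    · simpa using hz' (by omega)
    · simp only [h.ne', if_false, Nat.succ_ne_zero]
      have := hv.2 (i - 1) (by omega)
      rwa [show i - 1 + 2 = i + 2 - 1 by omega] at this

end Labels

end GenQuiver
/-- Two vertices are joined by an edge of the list. -/
def EAdj (E : List Edge) (i j : ℕ) : Prop := ∃ e ∈ E, e.Joins i j

theorem EAdj.symm {E : List Edge} {i j : ℕ} (h : EAdj E i j) : EAdj E j i := by
  obtain ⟨e, he, h⟩ := h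
  exact ⟨e, he, h.symm⟩

namespace GenQuiver

/-! ### Embeddings of trees -/

section Trees

variable {V : Type*} {Q : GenQuiver V}

/-- Induction on the leaf added last: local injectivity makes the image of the tree path a walk
without backtracking. The neighbours i', j' record its first and last steps, so that end labels can
be read off; the final clause separates vertices not joined in the tree. -/
theorem exists_nonBack {E : List Edge} {f : ℕ → V} (hE : IsTreeFrom 1 E)
    (hadj : ∀ e ∈ E, Q.graph.Adj (f e.src) (f e.tgt))
    (hloc : ∀ a b c, EAdj E a b → EAdj E a c → b ≠ c → f b ≠ f c) :
    ∀ i j, i ≠ j → i < 1 + E.length → j < 1 + E.length →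
      ∃ (n : ℕ) (v : ℕ → V) (i' j' : ℕ), 1 ≤ n ∧ Q.IsNonBack n v ∧ v 0 = f i ∧ v 1 = f i' ∧
        v n = f j ∧ v (n - 1) = f j' ∧ EAdj E i i' ∧ EAdj E j j' ∧ (EAdj E i j ∨ 2 ≤ n) := by
  induction E using List.reverseRecOn with
  | nil => intro i j hij hi hj; simp at hi hj; omega
  | append_singleton E e ih =>
    rw [IsTreeFrom.append] at hE
    have hmono : ∀ a b, EAdj E a b → EAdj (E ++ [e]) a b := fun a b ⟨e', he', h⟩ =>
      ⟨e', by simp [he'], h⟩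
    have ih' := ih hE.1 (fun e he => hadj e (by simp [he]))
      fun a b c h1 h2 => hloc a b c (hmono _ _ h1) (hmono _ _ h2)
    obtain ⟨t, ht, hjoin⟩ : ∃ t < 1 + E.length, e.Joins t (1 + E.length) := by
      rcases hE.2.1 with h | h
      · exact ⟨e.tgt, h.2, Or.inr ⟨h.1, rfl⟩⟩
      · exact ⟨e.src, h.2, Or.inl ⟨rfl, h.1⟩⟩
    have hEt : EAdj (E ++ [e]) t (1 + E.length) := ⟨e, by simp, hjoin⟩
    have hft : Q.graph.Adj (f t) (f (1 + E.length)) := by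
      have := hadj e (by simp)
      rcases hjoin with ⟨h1, h2⟩ | ⟨h1, h2⟩
      · rwa [h1, h2] at this
      · rw [h1, h2] at this
        exact this.symm
    have hnew : ∀ i < 1 + E.length, ∃ (n : ℕ) (v : ℕ → V) (i' j' : ℕ), 1 ≤ n ∧
        Q.IsNonBack n v ∧ v 0 = f i ∧ v 1 = f i' ∧ v n = f (1 + E.length) ∧ v (n - 1) = f j' ∧
        EAdj (E ++ [e]) i i' ∧ EAdj (E ++ [e]) (1 + E.length) j' ∧
        (EAdj (E ++ [e]) i (1 + E.length) ∨ 2 ≤ n) := by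
      intro i hi
      by_cases hit : i = t
      · subst hit
        refine ⟨1, fun s => if s = 0 then f i else f (1 + E.length), 1 + E.length, i, le_rfl,
          ⟨fun s hs => ?_, fun s hs => by omega⟩, by simp, by simp, by simp, by simp, hEt,
          hEt.symm, Or.inl hEt⟩
        obtain rfl : s = 0 := by omega
        simpa using hft
      · obtain ⟨n, v, i', j', hn, hv, h0, h1, h2, h3, h4, h5, -⟩ := ih' i t hit hi ht
        have hbound : j' < 1 + E.length := by
          obtain ⟨e', he', h⟩ := h5
          have := hE.1.bounds he'
          rcases h with h | h <;> omega
        have hne := hloc t j' (1 + E.length) (hmono _ _ h5) hEt (by omega)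
        refine ⟨n + 1, _, i', t, by omega, hv.snoc (z := f (1 + E.length)) (by rw [h2]; exact hft)
          fun _ => by rw [h3]; exact hne, ?_, ?_, ?_, ?_, hmono _ _ h4, hEt.symm, Or.inr (by omega)⟩
        · simpa using h0
        · simpa [hn] using h1
        · simp
        · simpa using h2
    intro i j hij hi hj
    rw [List.length_append, List.length_singleton] at hi hj
    by_cases hj' : j = 1 + E.length
    · subst hj'
      exact hnew i (by omega)
    · by_cases hi' : i = 1 + E.length
      · subst hi'
        obtain ⟨n, v, i', j', hn, hv, h0, h1, h2, h3, h4, h5, h6⟩ := hnew j (by omega)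
        refine ⟨n, _, j', i', hn, hv.reverse, by simpa using h2, h3, by simpa using h0, ?_,
          h5, h4, h6.imp_left EAdj.symm⟩
        simpa [show n - (n - 1) = 1 by omega] using h1
      · obtain ⟨n, v, i', j', hn, hv, h0, h1, h2, h3, h4, h5, h6⟩ :=
          ih' i j hij (by omega) (by omega)
        exact ⟨n, v, i', j', hn, hv, h0, h1, h2, h3, hmono _ _ h4, hmono _ _ h5,
          h6.imp_left (hmono _ _)⟩

/-- A map from the vertices of a tree that is compatible with the edges and locally injective is
an embedding. -/
theorem contains_of_tree (hno : ¬ Q.HasListed) {K : List ℕ} {E : List Edge} {f : ℕ → V}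
    (hlen : K.length = 1 + E.length) (hE : IsTreeFrom 1 E)
    (hlab : ∀ e ∈ E, Q.graph.Adj (f e.src) (f e.tgt) ∧ Q.lab (f e.src) (f e.tgt) = e.p ∧
      Q.lab (f e.tgt) (f e.src) = e.q)
    (hloc : ∀ a b c, EAdj E a b → EAdj E a c → b ≠ c → f b ≠ f c)
    (hK : ∀ i < K.length, 0 < K.getD i 0 ∧ K.getD i 0 ≤ Q.K (f i))
    (hd : ∀ x, Q.A x x = -2) : Q.Contains (ofEdges K E) := by
  have key := exists_nonBack hE (fun e he => (hlab e he).1) hloc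
  -- The walk joining the two images is induced, so its ends are distinct; by the same token they
  -- are adjacent only when its length is one.
  have hne : ∀ i j, i ≠ j → i < K.length → j < K.length → f i ≠ f j := by
    intro i j hij hi hj
    obtain ⟨n, v, i', j', hn, hv, h0, h1, h2, -⟩ := key i j hij (by omega) (by omega)
    rw [← h0, ← h2]
    exact (hv.induced hno 0 n (by omega) le_rfl).1
  refine contains_ofEdges f (fun i j hij hj => hne i j hij.ne (hij.trans hj) hj) ?_ hK
    fun i _ _ => hd _
  intro i j hij hi hj
  by_cases h : EAdj E i j
  · obtain ⟨e, he, h⟩ := h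
    have h1 := hlab e he
    have h2 := hE.entries_edge he
    rw [A_eq_lab (hne i j hij hi hj)]
    rcases h with ⟨rfl, rfl⟩ | ⟨rfl, rfl⟩
    · rw [h2.1, h1.2.1]
    · rw [h2.2, h1.2.2]
  · rw [entries_eq_zero fun e he h' => h ⟨e, he, h'⟩]
    obtain ⟨n, v, i', j', hn, hv, h0, h1, h2, -, -, -, h3⟩ := key i j hij (by omega) (by omega)
    have h4 := hv.induced hno 0 n (by omega) le_rfl
    rw [h0, h2] at h4
    refine A_eq_zero h4.1 fun h5 => ?_
    have h6 := h4.2.1 h5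
    have := h3.resolve_left h
    omega

/-- The labels pointing inwards from two leaves are coprime. -/
theorem coprime_of_leaves (hno : ¬ Q.HasListed) {E : List Edge} {f : ℕ → V}
    (hE : IsTreeFrom 1 E) (hadj : ∀ e ∈ E, Q.graph.Adj (f e.src) (f e.tgt))
    (hloc : ∀ a b c, EAdj E a b → EAdj E a c → b ≠ c → f b ≠ f c) {i j i' j' : ℕ} (hij : i ≠ j)
    (hi : i < 1 + E.length) (hj : j < 1 + E.length) (hi' : ∀ k, EAdj E i k → k = i')
    (hj' : ∀ k, EAdj E j k → k = j') :
    Nat.Coprime (Q.lab (f i) (f i')) (Q.lab (f j) (f j')) := by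
  obtain ⟨n, v, i'', j'', hn, hv, h0, h1, h2, h3, h4, h5, -⟩ := exists_nonBack hE hadj hloc i j hij hi hj
  obtain rfl := hi' _ h4
  obtain rfl := hj' _ h5
  rw [← h0, ← h1, ← h2, ← h3]
  exact hv.coprime hno hn

end Trees

end GenQuiver
namespace GenQuiver

/-! ### Spines with leaves -/

section Spine

variable {V : Type*} {Q : GenQuiver V}

theorem adj_of_lab (hd : ∀ x, Q.A x x = -2) {x y : V} (h : 0 < Q.lab x y) : Q.graph.Adj x y := by
  refine adj_of_lab_pos (fun hxy => ?_) h
  subst hxy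
  simp [lab, hd] at h

variable (Q) in
/-- A chain of vertices of weight at least two joined by simple edges. -/
structure IsSpine (r : ℕ) (s : ℕ → V) : Prop where
  nonBack : Q.IsNonBack r s
  lab_eq : ∀ i < r, Q.lab (s i) (s (i + 1)) = 1 ∧ Q.lab (s (i + 1)) (s i) = 1
  big : ∀ i ≤ r, 2 ≤ Q.K (s i)

theorem IsSpine.reverse {r : ℕ} {s : ℕ → V} (hs : Q.IsSpine r s) :
    Q.IsSpine r fun i => s (r - i) := by
  refine ⟨hs.nonBack.reverse, fun i hi => ?_, fun i hi => hs.big _ (by omega)⟩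
  have := hs.lab_eq (r - (i + 1)) (by omega)
  rw [show r - (i + 1) + 1 = r - i by omega] at this
  exact this.symm

/-- The vertices in `l` and `l'` can be attached to the two ends of the spine. -/
structure SpineLeaves (r : ℕ) (s : ℕ → V) (l l' : List V) : Prop where
  nodup : l.Nodup
  nodup' : l'.Nodup
  disjoint : r = 0 → l.Disjoint l'
  notMem : 0 < r → s 1 ∉ l
  notMem' : 0 < r → s (r - 1) ∉ l'

theorem SpineLeaves.reverse {r : ℕ} {s : ℕ → V} {l l' : List V} (h : SpineLeaves r s l l') :
    SpineLeaves r (fun i => s (r - i)) l' l := by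
  refine ⟨h.nodup', h.nodup, fun h0 => (h.disjoint h0).symm, h.notMem', fun h0 => ?_⟩
  have := h.notMem h0
  rwa [show r - (r - 1) = 1 by omega]

/-- The vertex of the spine to which the `j`-th leaf is attached. -/
def attach (r k j : ℕ) : ℕ := if j < k then 0 else r

theorem attach_le (r k j : ℕ) : attach r k j ≤ r := by
  unfold attach
  split_ifs <;> omega

section Leaves

variable {r : ℕ} {s : ℕ → V} {l l' : List V} {j j' : ℕ}

theorem SpineLeaves.getD_ne (hl : SpineLeaves r s l l') (d : V) (hj : j < (l ++ l').length) (hj' : j' < (l ++ l').length)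
    (hne : j ≠ j') (h : attach r l.length j = attach r l.length j') :
    (l ++ l').getD j d ≠ (l ++ l').getD j' d := by
  have key : ∀ L : List V, L.Nodup → ∀ a b, a < L.length → b < L.length → a ≠ b →
      L.getD a d ≠ L.getD b d := fun L hL a b ha hb hab h => by
    rw [List.getD_eq_getElem _ _ ha, List.getD_eq_getElem _ _ hb] at h
    exact hab ((hL.getElem_inj_iff).1 h)
  rcases Nat.eq_zero_or_pos r with h0 | h0
  · exact key _ (List.nodup_append'.2 ⟨hl.nodup, hl.nodup', hl.disjoint h0⟩) _ _ hj hj' hne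
  · rw [List.length_append] at hj hj'
    unfold attach at h
    by_cases h1 : j < l.length
    · by_cases h2 : j' < l.length
      · rw [List.getD_append _ _ _ _ h1, List.getD_append _ _ _ _ h2]
        exact key _ hl.nodup _ _ h1 h2 hne
      · rw [if_pos h1, if_neg h2] at h
        omega
    · by_cases h2 : j' < l.length
      · rw [if_neg h1, if_pos h2] at h
        omega
      · rw [List.getD_append_right _ _ _ _ (by omega), List.getD_append_right _ _ _ _ (by omega)]
        exact key _ hl.nodup' _ _ (by omega) (by omega) (by omega)

theorem SpineLeaves.getD_ne_succ (hl : SpineLeaves r s l l') (d : V) {i : ℕ} (hi : i < r)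
    (h : attach r l.length j = i) : (l ++ l').getD j d ≠ s (i + 1) := by
  unfold attach at h
  split_ifs at h with h1
  · subst h
    rw [List.getD_append _ _ _ _ h1, List.getD_eq_getElem _ _ h1]
    exact fun h2 => hl.notMem hi (h2 ▸ List.getElem_mem _)
  · omega

theorem SpineLeaves.getD_ne_pred (hl : SpineLeaves r s l l') (d : V)
    (hj : j < (l ++ l').length) {i : ℕ} (h : attach r l.length j = i + 1) : (l ++ l').getD j d ≠ s i := by
  unfold attach at h
  split_ifs at h with h1
  rw [List.length_append] at hj
  have h3 : j - l.length < l'.length := by omega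
  rw [List.getD_append_right _ _ _ _ (by omega), List.getD_eq_getElem _ _ h3]
  have h4 := hl.notMem' (by omega)
  rw [h, Nat.add_sub_cancel] at h4
  exact fun h2 => h4 (h2 ▸ List.getElem_mem _)

/-- A spine with leaves attached to its ends is contained in the quiver. -/
theorem contains_of_spine (hl : SpineLeaves r s l l') (hno : ¬ Q.HasListed) (hd : ∀ x, Q.A x x = -2) (hs : Q.IsSpine r s)
    {KL : List ℕ} {EX : List Edge} (hKL : KL.length = EX.length)
    (hlen : (l ++ l').length = EX.length) (htree : IsTreeFrom (r + 1) EX)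
    (hEX : ∀ e ∈ EX, (0 < e.p ∧ 0 < e.q) ∧ ∃ j < (l ++ l').length,
      (e.src = r + 1 + j ∧ e.tgt = attach r l.length j ∧
        Q.lab ((l ++ l').getD j (s 0)) (s (attach r l.length j)) = e.p ∧
        Q.lab (s (attach r l.length j)) ((l ++ l').getD j (s 0)) = e.q) ∨
      (e.tgt = r + 1 + j ∧ e.src = attach r l.length j ∧
        Q.lab ((l ++ l').getD j (s 0)) (s (attach r l.length j)) = e.q ∧
        Q.lab (s (attach r l.length j)) ((l ++ l').getD j (s 0)) = e.p))
    (hK : ∀ j < (l ++ l').length, 0 < KL.getD j 0 ∧ KL.getD j 0 ≤ Q.K ((l ++ l').getD j (s 0))) :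
    Q.Contains (ofEdges (List.replicate (r + 1) 2 ++ KL) (chain r ++ EX)) := by
  set g : ℕ → V := fun j => (l ++ l').getD j (s 0) with hg
  let f : ℕ → V := fun i => if i ≤ r then s i else g (i - (r + 1))
  have hfs : ∀ i ≤ r, f i = s i := fun i hi => if_pos hi
  have hfg : ∀ j, f (r + 1 + j) = g j := fun j => by
    simp only [f]
    rw [if_neg (by omega), Nat.add_sub_cancel_left]
  have hadj : ∀ a b, EAdj (chain r ++ EX) a b → (a < r ∧ b = a + 1) ∨ (b < r ∧ a = b + 1) ∨
      ∃ j < (l ++ l').length, (a = r + 1 + j ∧ b = attach r l.length j) ∨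
        (b = r + 1 + j ∧ a = attach r l.length j) := by
    rintro a b ⟨e, he, hj⟩
    rcases List.mem_append.1 he with he | he
    · obtain ⟨i, hi, rfl⟩ := List.mem_map.1 he
      have := List.mem_range.1 hi
      simp only [Edge.Joins] at hj
      omega
    · obtain ⟨-, j, hj1, h | h⟩ := hEX e he <;> refine Or.inr (Or.inr ⟨j, hj1, ?_⟩) <;>
        rcases hj with h' | h' <;> omega
  refine contains_of_tree hno (f := f) (by simp [length_chain]; omega)
    (IsTreeFrom.append.2 ⟨isTreeFrom_chain r, by rwa [length_chain, Nat.add_comm]⟩) ?_ ?_ ?_ hd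
  · intro e he
    rcases List.mem_append.1 he with he | he
    · obtain ⟨i, hi, rfl⟩ := List.mem_map.1 he
      have hi := List.mem_range.1 hi
      simp only [hfs i hi.le, hfs (i + 1) hi]
      exact ⟨hs.nonBack.1 i hi, hs.lab_eq i hi⟩
    · obtain ⟨⟨hp, hq⟩, j, hj1, ⟨h1, h2, h3, h4⟩ | ⟨h1, h2, h3, h4⟩⟩ := hEX e he
      · rw [h1, h2, hfg, hfs _ (attach_le _ _ _)]
        exact ⟨adj_of_lab hd (hp.trans_eq h3.symm), h3, h4⟩
      · rw [h1, h2, hfg, hfs _ (attach_le _ _ _)]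
        exact ⟨adj_of_lab hd (hp.trans_eq h4.symm), h4, h3⟩
  · intro a b c hab hac hbc
    have hnb : ∀ i, i + 2 ≤ r → s i ≠ s (i + 2) := hs.nonBack.2
    have hatt := attach_le r l.length
    rcases hadj a b hab with ⟨h1, h2⟩ | ⟨h1, h2⟩ | ⟨j, hj, ⟨h1, h2⟩ | ⟨h1, h2⟩⟩ <;>
      rcases hadj a c hac with ⟨h3, h4⟩ | ⟨h3, h4⟩ | ⟨j', hj', ⟨h3, h4⟩ | ⟨h3, h4⟩⟩
    · omega
    · subst h2 h4
      rw [hfs _ h1, hfs _ h3.le]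
      exact (hnb c (by omega)).symm
    · omega
    · subst h2 h3
      rw [hfs _ h1, hfg]
      exact (hl.getD_ne_succ _ h1 h4.symm).symm
    · subst h2 h4
      rw [hfs _ h3, hfs _ h1.le]
      exact hnb b (by omega)
    · omega
    · omega
    · subst h2 h3
      rw [hfs _ h1.le, hfg]
      exact (hl.getD_ne_pred _ hj' h4.symm).symm
    · omega
    · omega
    · obtain rfl : j = j' := by omega
      exact absurd (h2.trans h4.symm) hbc
    · have := hatt j'
      omega
    · subst h1 h4
      rw [hfs _ h3, hfg]
      exact hl.getD_ne_succ _ h3 h2.symm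
    · subst h1 h4
      rw [hfs _ h3.le, hfg]
      exact hl.getD_ne_pred _ hj h2.symm
    · have := hatt j
      omega
    · subst h1 h3
      rw [hfg, hfg]
      exact hl.getD_ne _ hj hj' (fun h => hbc (by rw [h])) (h2.symm.trans h4)
  · intro i hi
    rw [getD_spine]
    split_ifs with h
    · rw [hfs _ h]
      exact ⟨two_pos, hs.big i h⟩
    · simp only [f, if_neg h]
      refine hK _ ?_
      rw [List.length_append, List.length_replicate] at hi
      omega

end Leaves

/-- Coprimality for the walk u, c, u' of length two. -/
theorem coprime_at (hno : ¬ Q.HasListed) {c u u' : V} (hu : Q.graph.Adj c u)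
    (hu' : Q.graph.Adj c u') (hne : u ≠ u') : Nat.Coprime (Q.lab u c) (Q.lab u' c) := by
  have := IsNonBack.coprime hno (n := 2) (v := fun i => if i = 0 then u else if i = 1 then c else u')
    ⟨fun i hi => ?_, fun i hi => ?_⟩ (by omega)
  · simpa using this
  · interval_cases i
    · simpa using hu.symm
    · simpa using hu'
  · obtain rfl : i = 0 := by omega
    simpa using hne

/-- The labels pointing inwards from vertices attached to the two ends of a path are coprime. -/
theorem coprime_ends (hno : ¬ Q.HasListed) {r : ℕ} {s : ℕ → V} (hs : Q.IsNonBack r s) {u u' : V}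
    (hu : Q.graph.Adj (s 0) u) (hu' : Q.graph.Adj (s r) u') (h0 : r = 0 → u ≠ u')
    (h1 : 0 < r → s 1 ≠ u) (h2 : 0 < r → s (r - 1) ≠ u') :
    Nat.Coprime (Q.lab u (s 0)) (Q.lab u' (s r)) := by
  have h3 := (hs.snoc hu' h2).cons (z := u) (by simpa using hu.symm) fun _ => by
    rcases Nat.eq_zero_or_pos r with rfl | h
    · simpa using h0 rfl
    · simpa [Nat.one_le_iff_ne_zero.2 h.ne'] using (h1 h).symm
  simpa using h3.coprime hno (by omega)

end Spine

end GenQuiver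
namespace GenQuiver

/-! ### Features at the two ends of a spine -/

section Features

variable {V : Type*} {Q : GenQuiver V}

theorem lab_pos_symm (hd : ∀ x, Q.A x x = -2) {x y : V} (h : 0 < Q.lab x y) : 0 < Q.lab y x :=
  lab_pos (adj_of_lab hd h).symm

/-- Leaves at the same end are joined by a walk of length two, leaves at opposite ends by a walk
along the spine. This supplies the coprimality of leaf labels required in the spine families. -/
theorem SpineLeaves.coprime {r : ℕ} {s : ℕ → V} {l l' : List V} (hl : SpineLeaves r s l l')
    (hno : ¬ Q.HasListed) (hd : ∀ x, Q.A x x = -2) (hs : Q.IsSpine r s) (d : V)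
    (hlab : ∀ j < (l ++ l').length, 0 < Q.lab (s (attach r l.length j)) ((l ++ l').getD j d))
    (j j' : ℕ) (hj : j < j') (hj' : j' < (l ++ l').length) :
    Nat.Coprime (Q.lab ((l ++ l').getD j d) (s (attach r l.length j)))
      (Q.lab ((l ++ l').getD j' d) (s (attach r l.length j'))) := by
  have h1 := adj_of_lab hd (hlab j (hj.trans hj'))
  have h2 := adj_of_lab hd (hlab j' hj')
  by_cases h : attach r l.length j = attach r l.length j'
  · have hne := hl.getD_ne d (hj.trans hj') hj' hj.ne h
    rw [← h] at h2 ⊢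
    exact coprime_at hno h1 h2 hne
  · have h3 : attach r l.length j = 0 ∧ attach r l.length j' = r ∧ 0 < r := by
      unfold attach at h ⊢
      split_ifs at h ⊢ <;> omega
    obtain ⟨h4, h5, h6⟩ := h3
    have h7 := hl.getD_ne_succ d h6 h4
    have h8 := hl.getD_ne_pred (i := r - 1) d hj' (by omega)
    rw [h4] at h1 ⊢
    rw [h5] at h2 ⊢
    exact coprime_ends hno hs.nonBack h1 h2 (fun h => by omega) (fun _ => h7.symm)
      fun _ => h8.symm

variable (Q) in
/-- Configurations around a vertex that may close an affine diagram. -/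
inductive IsFeature (c : V) : List V → Prop
  | fork {u v : V} (hne : u ≠ v) (hu : Q.lab c u = 1) (hv : Q.lab c v = 1) : IsFeature c [u, v]
  | out {u : V} (hu : Q.lab c u = 2) : IsFeature c [u]
  | in2 {u : V} (hK : 2 ≤ Q.K u) (hu : Q.lab c u = 1) (hu' : Q.lab u c = 2) : IsFeature c [u]
  | in3 {u : V} (hK : 2 ≤ Q.K u) (hu : Q.lab c u = 1) (hu' : Q.lab u c = 3) : IsFeature c [u]

theorem IsFeature.nodup {c : V} {l : List V} (h : Q.IsFeature c l) : l.Nodup := by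
  cases h <;> simp_all

section Pairs

variable {r : ℕ} {s : ℕ → V} {u v w x : V}

/-- Two forks close up to affine D. In the same way each further unordered pair of distinct
features, and the pair of two `out`, produces its own family. -/
theorem not_fork_fork (hno : ¬ Q.HasListed) (hd : ∀ x, Q.A x x = -2) (hs : Q.IsSpine r s)
    (hl : SpineLeaves r s [u, v] [w, x])
    (hu : Q.lab (s 0) u = 1) (hv : Q.lab (s 0) v = 1) (hw : Q.lab (s r) w = 1)
    (hx : Q.lab (s r) x = 1) : False := by
  have hpos {a b : V} (h : Q.lab a b = 1) : 0 < Q.lab b a := lab_pos_symm hd (by omega)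
  have hc := hl.coprime hno hd hs u fun j hj => by
    simp only [List.cons_append, List.nil_append, List.length_cons, List.length_nil] at hj
    interval_cases j
    exacts [hu.symm ▸ one_pos, hv.symm ▸ one_pos, hw.symm ▸ one_pos, hx.symm ▸ one_pos]
  refine hno ⟨_, _, IsListed.affD r (Q.lab u (s 0)) (Q.lab v (s 0)) (Q.lab w (s r))
    (Q.lab x (s r)) ⟨hpos hu, hpos hv, hpos hw, hpos hx⟩ ?_, contains_of_spine hl hno hd hs rfl rfl
    (by simp [IsTreeFrom]; omega) ?_ ?_⟩
  · simp only [List.pairwise_cons, List.mem_cons, List.not_mem_nil, or_false, forall_eq_or_imp,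
      forall_eq, false_imp_iff, implies_true, List.Pairwise.nil, and_true]
    exact ⟨⟨hc 0 1 (by simp) (by simp), hc 0 2 (by simp) (by simp), hc 0 3 (by simp) (by simp)⟩,
      ⟨hc 1 2 (by simp) (by simp), hc 1 3 (by simp) (by simp)⟩, hc 2 3 (by simp) (by simp)⟩
  · intro e he
    simp only [List.mem_cons, List.not_mem_nil, or_false] at he
    rcases he with rfl | rfl | rfl | rfl
    · exact ⟨⟨hpos hu, one_pos⟩, 0, by simp, Or.inl ⟨rfl, rfl, rfl, hu⟩⟩
    · exact ⟨⟨hpos hv, one_pos⟩, 1, by simp, Or.inl ⟨rfl, rfl, rfl, hv⟩⟩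
    · exact ⟨⟨hpos hw, one_pos⟩, 2, by simp, Or.inl ⟨rfl, rfl, rfl, hw⟩⟩
    · exact ⟨⟨hpos hx, one_pos⟩, 3, by simp, Or.inl ⟨rfl, rfl, rfl, hx⟩⟩
  · intro j hj
    simp only [List.cons_append, List.nil_append, List.length_cons, List.length_nil] at hj
    interval_cases j
    exacts [⟨one_pos, Q.K_pos _⟩, ⟨one_pos, Q.K_pos _⟩, ⟨one_pos, Q.K_pos _⟩, ⟨one_pos, Q.K_pos _⟩]

theorem not_fork_out (hno : ¬ Q.HasListed) (hd : ∀ x, Q.A x x = -2) (hs : Q.IsSpine r s)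
    (hl : SpineLeaves r s [u, v] [w])
    (hu : Q.lab (s 0) u = 1) (hv : Q.lab (s 0) v = 1) (hw : Q.lab (s r) w = 2) : False := by
  have hpos {a b : V} (h : 0 < Q.lab a b) : 0 < Q.lab b a := lab_pos_symm hd h
  have hc := hl.coprime hno hd hs u fun j hj => by
    simp only [List.cons_append, List.nil_append, List.length_cons, List.length_nil] at hj
    interval_cases j
    exacts [hu.symm ▸ one_pos, hv.symm ▸ one_pos, hw.symm ▸ two_pos]
  have hw2 := coprime_of_adj hno (adj_of_lab hd (hw.symm ▸ two_pos)).symm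
  rw [hw] at hw2
  have pu := hpos (hu.symm ▸ one_pos)
  have pv := hpos (hv.symm ▸ one_pos)
  have pw := hpos (hw.symm ▸ two_pos)
  refine hno ⟨_, _, IsListed.affB r (Q.lab u (s 0)) (Q.lab v (s 0)) (Q.lab w (s r))
    ⟨pu, pv⟩ hw2 ?_, contains_of_spine hl hno hd hs rfl rfl (by simp [IsTreeFrom]; omega) ?_ ?_⟩
  · simp only [List.pairwise_cons, List.mem_cons, List.not_mem_nil, or_false, forall_eq_or_imp,
      forall_eq, false_imp_iff, implies_true, List.Pairwise.nil, and_true]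
    exact ⟨⟨hc 0 1 (by simp) (by simp), hc 0 2 (by simp) (by simp)⟩, hc 1 2 (by simp) (by simp)⟩
  · intro e he
    simp only [List.mem_cons, List.not_mem_nil, or_false] at he
    rcases he with rfl | rfl | rfl
    · exact ⟨⟨pu, one_pos⟩, 0, by simp, Or.inl ⟨rfl, rfl, rfl, hu⟩⟩
    · exact ⟨⟨pv, one_pos⟩, 1, by simp, Or.inl ⟨rfl, rfl, rfl, hv⟩⟩
    · exact ⟨⟨two_pos, pw⟩, 2, by simp, Or.inr ⟨rfl, rfl, rfl, hw⟩⟩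
  · intro j hj
    simp only [List.cons_append, List.nil_append, List.length_cons, List.length_nil] at hj
    interval_cases j
    exacts [⟨one_pos, Q.K_pos _⟩, ⟨one_pos, Q.K_pos _⟩, ⟨one_pos, Q.K_pos _⟩]

theorem not_fork_in2 (hno : ¬ Q.HasListed) (hd : ∀ x, Q.A x x = -2) (hs : Q.IsSpine r s)
    (hl : SpineLeaves r s [u, v] [w]) (hu : Q.lab (s 0) u = 1) (hv : Q.lab (s 0) v = 1)
    (hK : 2 ≤ Q.K w) (hw : Q.lab (s r) w = 1) (hw' : Q.lab w (s r) = 2) : False := by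
  have hpos {a b : V} (h : 0 < Q.lab a b) : 0 < Q.lab b a := lab_pos_symm hd h
  have hc := hl.coprime hno hd hs u fun j hj => by
    simp only [List.cons_append, List.nil_append, List.length_cons, List.length_nil] at hj
    interval_cases j
    exacts [hu.symm ▸ one_pos, hv.symm ▸ one_pos, hw.symm ▸ one_pos]
  have pu := hpos (hu.symm ▸ one_pos)
  have pv := hpos (hv.symm ▸ one_pos)
  refine hno ⟨_, _, IsListed.twA2odd r (Q.lab u (s 0)) (Q.lab v (s 0))
    (hw' ▸ hc 0 2 (by simp) (by simp)) (hw' ▸ hc 1 2 (by simp) (by simp))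
    (hc 0 1 (by simp) (by simp)),
    contains_of_spine hl hno hd hs rfl rfl (by simp [IsTreeFrom]; omega) ?_ ?_⟩
  · intro e he
    simp only [List.mem_cons, List.not_mem_nil, or_false] at he
    rcases he with rfl | rfl | rfl
    · exact ⟨⟨pu, one_pos⟩, 0, by simp, Or.inl ⟨rfl, rfl, rfl, hu⟩⟩
    · exact ⟨⟨pv, one_pos⟩, 1, by simp, Or.inl ⟨rfl, rfl, rfl, hv⟩⟩
    · exact ⟨⟨two_pos, one_pos⟩, 2, by simp, Or.inl ⟨rfl, rfl, hw', hw⟩⟩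
  · intro j hj
    simp only [List.cons_append, List.nil_append, List.length_cons, List.length_nil] at hj
    interval_cases j
    exacts [⟨one_pos, Q.K_pos _⟩, ⟨one_pos, Q.K_pos _⟩, ⟨two_pos, hK⟩]

theorem not_in3_fork (hno : ¬ Q.HasListed) (hd : ∀ x, Q.A x x = -2) (hs : Q.IsSpine r s)
    (hl : SpineLeaves r s [w] [u, v]) (hu : Q.lab (s r) u = 1) (hv : Q.lab (s r) v = 1)
    (hK : 2 ≤ Q.K w) (hw : Q.lab (s 0) w = 1) (hw' : Q.lab w (s 0) = 3) : False := by
  have hpos {a b : V} (h : 0 < Q.lab a b) : 0 < Q.lab b a := lab_pos_symm hd h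
  have hc := hl.coprime hno hd hs u fun j hj => by
    simp only [List.cons_append, List.nil_append, List.length_cons, List.length_nil] at hj
    interval_cases j
    exacts [hw.symm ▸ one_pos, hu.symm ▸ one_pos, hv.symm ▸ one_pos]
  have pu := hpos (hu.symm ▸ one_pos)
  have pv := hpos (hv.symm ▸ one_pos)
  refine hno ⟨_, _, IsListed.gd r (Q.lab u (s r)) (Q.lab v (s r))
    (hw' ▸ (hc 0 1 (by simp) (by simp)).symm) (hw' ▸ (hc 0 2 (by simp) (by simp)).symm)
    (hc 1 2 (by simp) (by simp)),
    contains_of_spine hl hno hd hs rfl rfl (by simp [IsTreeFrom]; omega) ?_ ?_⟩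
  · intro e he
    simp only [List.mem_cons, List.not_mem_nil, or_false] at he
    rcases he with rfl | rfl | rfl
    · exact ⟨⟨three_pos, one_pos⟩, 0, by simp, Or.inl ⟨rfl, rfl, hw', hw⟩⟩
    · exact ⟨⟨pu, one_pos⟩, 1, by simp, Or.inl ⟨rfl, rfl, rfl, hu⟩⟩
    · exact ⟨⟨pv, one_pos⟩, 2, by simp, Or.inl ⟨rfl, rfl, rfl, hv⟩⟩
  · intro j hj
    simp only [List.cons_append, List.nil_append, List.length_cons, List.length_nil] at hj
    interval_cases j
    exacts [⟨two_pos, hK⟩, ⟨one_pos, Q.K_pos _⟩, ⟨one_pos, Q.K_pos _⟩]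

theorem not_out_out (hno : ¬ Q.HasListed) (hd : ∀ x, Q.A x x = -2) (hs : Q.IsSpine r s)
    (hl : SpineLeaves r s [u] [v]) (hu : Q.lab (s 0) u = 2) (hv : Q.lab (s r) v = 2) : False := by
  have hc := hl.coprime hno hd hs u fun j hj => by
    simp only [List.cons_append, List.nil_append, List.length_cons, List.length_nil] at hj
    interval_cases j
    exacts [hu.symm ▸ two_pos, hv.symm ▸ two_pos]
  have hu2 := coprime_of_adj hno (adj_of_lab hd (hu.symm ▸ two_pos)).symm
  have hv2 := coprime_of_adj hno (adj_of_lab hd (hv.symm ▸ two_pos)).symm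
  rw [hu] at hu2
  rw [hv] at hv2
  have pu := lab_pos_symm hd (hu.symm ▸ two_pos)
  have pv := lab_pos_symm hd (hv.symm ▸ two_pos)
  refine hno ⟨_, _, IsListed.twD r (Q.lab u (s 0)) (Q.lab v (s r)) hu2 hv2
    (hc 0 1 (by simp) (by simp)),
    contains_of_spine hl hno hd hs rfl rfl (by simp [IsTreeFrom]) ?_ ?_⟩
  · intro e he
    simp only [List.mem_cons, List.not_mem_nil, or_false] at he
    rcases he with rfl | rfl
    · exact ⟨⟨two_pos, pu⟩, 0, by simp, Or.inr ⟨rfl, rfl, rfl, hu⟩⟩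
    · exact ⟨⟨two_pos, pv⟩, 1, by simp, Or.inr ⟨rfl, rfl, rfl, hv⟩⟩
  · intro j hj
    simp only [List.cons_append, List.nil_append, List.length_cons, List.length_nil] at hj
    interval_cases j
    exacts [⟨one_pos, Q.K_pos _⟩, ⟨one_pos, Q.K_pos _⟩]

theorem not_in2_out (hno : ¬ Q.HasListed) (hd : ∀ x, Q.A x x = -2) (hs : Q.IsSpine r s)
    (hl : SpineLeaves r s [w] [v]) (hK : 2 ≤ Q.K w) (hw : Q.lab (s 0) w = 1)
    (hw' : Q.lab w (s 0) = 2) (hv : Q.lab (s r) v = 2) : False := by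
  have hv2 := coprime_of_adj hno (adj_of_lab hd (hv.symm ▸ two_pos)).symm
  rw [hv] at hv2
  have pv := lab_pos_symm hd (hv.symm ▸ two_pos)
  refine hno ⟨_, _, IsListed.twA2even r (Q.lab v (s r)) hv2,
    contains_of_spine hl hno hd hs rfl rfl (by simp [IsTreeFrom]) ?_ ?_⟩
  · intro e he
    simp only [List.mem_cons, List.not_mem_nil, or_false] at he
    rcases he with rfl | rfl
    · exact ⟨⟨two_pos, one_pos⟩, 0, by simp, Or.inl ⟨rfl, rfl, hw', hw⟩⟩
    · exact ⟨⟨two_pos, pv⟩, 1, by simp, Or.inr ⟨rfl, rfl, rfl, hv⟩⟩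
  · intro j hj
    simp only [List.cons_append, List.nil_append, List.length_cons, List.length_nil] at hj
    interval_cases j
    exacts [⟨two_pos, hK⟩, ⟨one_pos, Q.K_pos _⟩]

theorem not_in3_out (hno : ¬ Q.HasListed) (hd : ∀ x, Q.A x x = -2) (hs : Q.IsSpine r s)
    (hl : SpineLeaves r s [w] [v]) (hK : 2 ≤ Q.K w) (hw : Q.lab (s 0) w = 1)
    (hw' : Q.lab w (s 0) = 3) (hv : Q.lab (s r) v = 2) : False := by
  have hc := hl.coprime hno hd hs w fun j hj => by
    simp only [List.cons_append, List.nil_append, List.length_cons, List.length_nil] at hj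
    interval_cases j
    exacts [hw.symm ▸ one_pos, hv.symm ▸ two_pos]
  have hv2 := coprime_of_adj hno (adj_of_lab hd (hv.symm ▸ two_pos)).symm
  rw [hv] at hv2
  have hv3 : Nat.Coprime (Q.lab v (s r)) 3 := hw' ▸ (hc 0 1 (by simp) (by simp)).symm
  have pv := lab_pos_symm hd (hv.symm ▸ two_pos)
  refine hno ⟨_, _, IsListed.gb r (Q.lab v (s r)) (Nat.Coprime.mul_right hv2 hv3),
    contains_of_spine hl hno hd hs rfl rfl (by simp [IsTreeFrom]) ?_ ?_⟩
  · intro e he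
    simp only [List.mem_cons, List.not_mem_nil, or_false] at he
    rcases he with rfl | rfl
    · exact ⟨⟨three_pos, one_pos⟩, 0, by simp, Or.inl ⟨rfl, rfl, hw', hw⟩⟩
    · exact ⟨⟨two_pos, pv⟩, 1, by simp, Or.inr ⟨rfl, rfl, rfl, hv⟩⟩
  · intro j hj
    simp only [List.cons_append, List.nil_append, List.length_cons, List.length_nil] at hj
    interval_cases j
    exacts [⟨two_pos, hK⟩, ⟨one_pos, Q.K_pos _⟩]

theorem not_in3_in2 (hno : ¬ Q.HasListed) (hd : ∀ x, Q.A x x = -2) (hs : Q.IsSpine r s)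
    (hl : SpineLeaves r s [w] [v]) (hK : 2 ≤ Q.K w) (hw : Q.lab (s 0) w = 1)
    (hw' : Q.lab w (s 0) = 3) (hKv : 2 ≤ Q.K v) (hv : Q.lab (s r) v = 1)
    (hv' : Q.lab v (s r) = 2) : False := by
  refine hno ⟨_, _, IsListed.gc r,
    contains_of_spine hl hno hd hs rfl rfl (by simp [IsTreeFrom]) ?_ ?_⟩
  · intro e he
    simp only [List.mem_cons, List.not_mem_nil, or_false] at he
    rcases he with rfl | rfl
    · exact ⟨⟨three_pos, one_pos⟩, 0, by simp, Or.inl ⟨rfl, rfl, hw', hw⟩⟩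
    · exact ⟨⟨two_pos, one_pos⟩, 1, by simp, Or.inl ⟨rfl, rfl, hv', hv⟩⟩
  · intro j hj
    simp only [List.cons_append, List.nil_append, List.length_cons, List.length_nil] at hj
    interval_cases j
    exacts [⟨two_pos, hK⟩, ⟨two_pos, hKv⟩]

/-- Both inward labels are p ≥ 2, contradicting their coprimality, so this pair needs no family of
its own. -/
theorem not_in_in (hno : ¬ Q.HasListed) (hd : ∀ x, Q.A x x = -2) (hs : Q.IsSpine r s)
    (hl : SpineLeaves r s [w] [v]) (hw : Q.lab (s 0) w = 1) (hv : Q.lab (s r) v = 1)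
    {p : ℕ} (hp : 2 ≤ p) (hw' : Q.lab w (s 0) = p) (hv' : Q.lab v (s r) = p) : False := by
  have hc := hl.coprime hno hd hs w fun j hj => by
    simp only [List.cons_append, List.nil_append, List.length_cons, List.length_nil] at hj
    interval_cases j
    exacts [hw.symm ▸ one_pos, hv.symm ▸ one_pos]
  have h1 : Nat.Coprime (Q.lab w (s 0)) (Q.lab v (s r)) := hc 0 1 (by simp) (by simp)
  rw [hw', hv', Nat.coprime_self] at h1
  omega

end Pairs

/-- There are no features at both ends of a spine. -/
theorem not_isFeature_isFeature (hno : ¬ Q.HasListed) (hd : ∀ x, Q.A x x = -2) {r : ℕ} {s : ℕ → V}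
    (hs : Q.IsSpine r s) {l l' : List V} (h : Q.IsFeature (s 0) l) (h' : Q.IsFeature (s r) l')
    (hdis : r = 0 → l.Disjoint l') (hl : 0 < r → s 1 ∉ l) (hl' : 0 < r → s (r - 1) ∉ l') :
    False := by
  have hL : SpineLeaves r s l l' := ⟨h.nodup, h'.nodup, hdis, hl, hl'⟩
  have hs' := hs.reverse
  have hL' := hL.reverse
  -- Half of the ordered pairs are handled on the reversed spine, whose last vertex is s 0.
  have hr : s (r - r) = s 0 := by rw [Nat.sub_self]
  cases h with
  | fork hne hu hv =>
    cases h' with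
    | fork hne' hw hx => exact not_fork_fork hno hd hs hL hu hv hw hx
    | out hw => exact not_fork_out hno hd hs hL hu hv hw
    | in2 hK hw hw' => exact not_fork_in2 hno hd hs hL hu hv hK hw hw'
    | in3 hK hw hw' =>
      exact not_in3_fork hno hd hs' hL' (hr.symm ▸ hu) (hr.symm ▸ hv) hK hw hw'
  | out hu =>
    cases h' with
    | fork hne' hw hx => exact not_fork_out hno hd hs' hL' hw hx (hr.symm ▸ hu)
    | out hw => exact not_out_out hno hd hs hL hu hw
    | in2 hK hw hw' => exact not_in2_out hno hd hs' hL' hK hw hw' (hr.symm ▸ hu)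
    | in3 hK hw hw' => exact not_in3_out hno hd hs' hL' hK hw hw' (hr.symm ▸ hu)
  | in2 hKu hu hu' =>
    cases h' with
    | fork hne' hw hx =>
      exact not_fork_in2 hno hd hs' hL' hw hx hKu (hr.symm ▸ hu) (hr.symm ▸ hu')
    | out hw => exact not_in2_out hno hd hs hL hKu hu hu' hw
    | in2 hK hw hw' => exact not_in_in hno hd hs hL hu hw le_rfl hu' hw'
    | in3 hK hw hw' =>
      exact not_in3_in2 hno hd hs' hL' hK hw hw' hKu (hr.symm ▸ hu) (hr.symm ▸ hu')
  | in3 hKu hu hu' =>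
    cases h' with
    | fork hne' hw hx => exact not_in3_fork hno hd hs hL hw hx hKu hu hu'
    | out hw => exact not_in3_out hno hd hs hL hKu hu hu' hw
    | in2 hK hw hw' => exact not_in3_in2 hno hd hs hL hKu hu hu' hK hw hw'
    | in3 hK hw hw' => exact not_in_in hno hd hs hL hu hw (by omega) hu' hw'

end Features

end GenQuiver
/-- The map `f` is locally injective at the common vertices of two edges. -/
def Edge.LocInj {V : Type*} (f : ℕ → V) (e e' : Edge) : Prop :=
  (e.src = e'.src → f e.tgt ≠ f e'.tgt) ∧ (e.src = e'.tgt → f e.tgt ≠ f e'.src) ∧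
    (e.tgt = e'.src → f e.src ≠ f e'.tgt) ∧ (e.tgt = e'.tgt → f e.src ≠ f e'.src)

instance {V : Type*} (f : ℕ → V) : Std.Symm (Edge.LocInj f) :=
  ⟨fun _ _ h => ⟨fun h1 => (h.1 h1.symm).symm, fun h1 => (h.2.2.1 h1.symm).symm,
    fun h1 => (h.2.1 h1.symm).symm, fun h1 => (h.2.2.2 h1.symm).symm⟩⟩

/-- Reduces local injectivity to a check on pairs of edges, which simplification settles for an
explicit list. -/
theorem locInj_of_pairwise {V : Type*} {f : ℕ → V} {E : List Edge} (hE : IsTreeFrom 1 E)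
    (h : E.Pairwise (Edge.LocInj f)) (a b c : ℕ) (hab : EAdj E a b) (hac : EAdj E a c)
    (hbc : b ≠ c) : f b ≠ f c := by
  obtain ⟨e, he, h1⟩ := hab
  obtain ⟨e', he', h2⟩ := hac
  by_cases hee : e = e'
  · subst hee
    have := hE.bounds he
    rcases h1 with h1 | h1 <;> rcases h2 with h2 | h2 <;> omega
  · have h3 : e.LocInj f e' := h.forall he he' hee
    rcases h1 with ⟨rfl, rfl⟩ | ⟨rfl, rfl⟩ <;> rcases h2 with ⟨h2, rfl⟩ | ⟨rfl, h2⟩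
    · exact h3.1 h2.symm
    · exact h3.2.1 h2.symm
    · exact h3.2.2.1 h2.symm
    · exact h3.2.2.2 h2.symm

namespace GenQuiver

theorem contains_of_list {V : Type*} {Q : GenQuiver V} (hno : ¬ Q.HasListed)
    (hd : ∀ x, Q.A x x = -2) (f : ℕ → V) {K : List ℕ} {E : List Edge}
    (hlen : K.length = 1 + E.length) (hE : IsTreeFrom 1 E) (hf : E.Pairwise (Edge.LocInj f))
    (hlab : ∀ e ∈ E, 0 < e.p ∧ Q.lab (f e.src) (f e.tgt) = e.p ∧
      Q.lab (f e.tgt) (f e.src) = e.q)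
    (hK : ∀ i < K.length, 0 < K.getD i 0 ∧ K.getD i 0 ≤ Q.K (f i)) : Q.Contains (ofEdges K E) :=
  contains_of_tree hno hlen hE
    (fun e he => ⟨adj_of_lab hd ((hlab e he).1.trans_eq (hlab e he).2.1.symm), (hlab e he).2⟩)
    (locInj_of_pairwise hE hf) hK hd

/-! ### Local structure of a quiver containing no listed one -/

section Local

variable {V : Type*} [Fintype V]

theorem not_nonBack_card {Q : GenQuiver V} (hno : ¬ Q.HasListed) {n : ℕ} (hn : Fintype.card V ≤ n) {v : ℕ → V} :
    ¬ Q.IsNonBack n v := by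
  intro hv
  have h1 := hv.induced hno
  have h2 : Function.Injective fun i : Fin (n + 1) => v i := by
    intro i j hij
    by_contra hne
    have hne' : i.1 ≠ j.1 := fun h => hne (Fin.ext h)
    rcases lt_or_gt_of_ne hne' with h | h
    · exact (h1 i j h (by omega)).1 hij
    · exact (h1 j i h (by omega)).1 hij.symm
  have h3 := Fintype.card_le_of_injective _ h2
  rw [Fintype.card_fin] at h3
  omega

/-- Walks without backtracking cannot be extended indefinitely. -/
theorem false_of_extend {Q : GenQuiver V} (hno : ¬ Q.HasListed) {p : V → Prop} {c : V} (hc : p c)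
    (h0 : ∃ u, Q.graph.Adj c u)
    (hext : ∀ v u, p v → Q.graph.Adj v u → ∃ w, w ≠ u ∧ Q.graph.Adj v w ∧ p w) : False := by
  have key : ∀ n, ∃ v : ℕ → V, Q.IsNonBack n v ∧ p (v n) ∧ ∃ u, Q.graph.Adj (v n) u ∧
      (1 ≤ n → v (n - 1) = u) := by
    intro n
    induction n with
    | zero =>
      obtain ⟨u, hu⟩ := h0
      exact ⟨fun _ => c, ⟨fun i hi => by omega, fun i hi => by omega⟩, hc, u, hu,
        fun h => by omega⟩
    | succ n ih =>
      obtain ⟨v, hv, hp, u, hu, hun⟩ := ih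
      obtain ⟨w, hwu, hw, hpw⟩ := hext (v n) u hp hu
      refine ⟨_, hv.snoc hw fun hn => (hun hn).trans_ne hwu.symm, by simpa using hpw, v n,
        by simpa using hw.symm, fun _ => by simp⟩
  obtain ⟨v, hv, -⟩ := key (Fintype.card V)
  exact not_nonBack_card hno le_rfl hv

/-- A loopless quiver that contains no quiver of the list, with non-negative balance at all
vertices of weight at least two. -/
structure IsBare (Q : GenQuiver V) : Prop where
  no : ¬ Q.HasListed
  diag : ∀ x, Q.A x x = -2
  bal : ∀ x, 2 ≤ Q.K x → 0 ≤ Q.toQuiverData.balance x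

namespace IsBare

variable {Q : GenQuiver V}

theorem adj (hQ : Q.IsBare) {x y : V} (h : 0 < Q.lab x y) : Q.graph.Adj x y := adj_of_lab hQ.diag h

theorem symm_pos (hQ : Q.IsBare) {x y : V} (h : 0 < Q.lab x y) : 0 < Q.lab y x :=
  lab_pos_symm hQ.diag h

theorem bal_le (hQ : Q.IsBare) {x : V} (hx : 2 ≤ Q.K x) {s : Finset V}
    (hs : ∀ y, 0 < Q.lab x y → y ∈ s) : 2 * Q.K x ≤ ∑ y ∈ s, Q.lab x y * Q.K y := by
  classical
  have h1 := hQ.bal x hx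
  have h0 : Q.lab x x = 0 := by simp [lab, hQ.diag]
  have h2 : Q.toQuiverData.balance x = -2 * (Q.K x : ℤ) + ∑ y, ((Q.lab x y * Q.K y : ℕ) : ℤ) := by
    unfold QuiverData.balance
    rw [← Finset.add_sum_erase _ _ (Finset.mem_univ x), hQ.diag,
      ← Finset.add_sum_erase (a := x) Finset.univ (fun y => ((Q.lab x y * Q.K y : ℕ) : ℤ))
        (Finset.mem_univ x), h0]
    simp only [zero_mul, Nat.cast_zero, zero_add]
    congr 1
    refine Finset.sum_congr rfl fun y hy => ?_
    rw [A_eq_lab (Finset.ne_of_mem_erase hy).symm]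
    push_cast
    rfl
  have h3 : ∑ y ∈ s, Q.lab x y * Q.K y = ∑ y, Q.lab x y * Q.K y := by
    refine Finset.sum_subset (Finset.subset_univ _) fun y _ hy => ?_
    have : Q.lab x y = 0 := by
      by_contra hcon
      exact hy (hs y (Nat.pos_of_ne_zero hcon))
    rw [this, zero_mul]
  rw [h3]
  rw [h2, ← Nat.cast_sum] at h1
  omega

theorem exists_lab_pos (hQ : Q.IsBare) {x : V} (hx : 2 ≤ Q.K x) : ∃ y, 0 < Q.lab x y := by
  by_contra! hcon
  have := hQ.bal_le hx (s := ∅) fun y hy => absurd (hcon y) (by omega)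
  simp at this
  omega

theorem bal_one (hQ : Q.IsBare) {x u : V} (hx : 2 ≤ Q.K x) (h : ∀ y, 0 < Q.lab x y → y = u) :
    2 * Q.K x ≤ Q.lab x u * Q.K u := by
  have := hQ.bal_le hx (s := {u}) fun y hy => by simpa using h y hy
  simpa using this

theorem bal_two (hQ : Q.IsBare) {x u w : V} (hx : 2 ≤ Q.K x) (hne : u ≠ w)
    (h : ∀ y, 0 < Q.lab x y → y = u ∨ y = w) :
    2 * Q.K x ≤ Q.lab x u * Q.K u + Q.lab x w * Q.K w := by
  classical
  have := hQ.bal_le hx (s := {u, w}) fun y hy => by simpa using h y hy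
  rwa [Finset.sum_pair hne] at this

/-- A label ℓ ≥ 4 leaving a vertex of weight at least two gives the listed quiver `Y`. -/
theorem lab_le_three (hQ : Q.IsBare) {x y : V} (hx : 2 ≤ Q.K x) : Q.lab x y ≤ 3 := by
  by_contra! hcon
  have hadj : Q.graph.Adj x y := hQ.adj (by omega)
  refine hQ.no ⟨_, _, IsListed.Y (Q.lab x y) (Q.lab y x) hcon (coprime_of_adj hQ.no hadj.symm),
    contains_of_list hQ.no hQ.diag (fun i => [y, x].getD i y) rfl (by simp [IsTreeFrom])
    (List.pairwise_singleton _ _) ?_ fun i hi => ?_⟩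
  · intro e he
    rw [List.mem_singleton.1 he]
    exact ⟨lab_pos hadj.symm, rfl, rfl⟩
  · simp only [List.length_cons, List.length_nil] at hi
    interval_cases i
    exacts [⟨one_pos, Q.K_pos _⟩, ⟨two_pos, hx⟩]

/-- A second neighbour, reached with label 1, 2 or 3, completes `affG2`, `J23` or `J33`
respectively. -/
theorem unique_of_lab_three (hQ : Q.IsBare) {x y : V} (hx : 2 ≤ Q.K x) (hxy : Q.lab x y = 3) {w : V}
    (hw : 0 < Q.lab x w) : w = y := by
  by_contra hne
  have hy := hQ.adj (hxy.symm ▸ three_pos)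
  have hw' := hQ.adj hw
  have hc := coprime_at hQ.no hw' hy hne
  have hc1 := coprime_of_adj hQ.no hw'.symm
  have hc2 := coprime_of_adj hQ.no hy.symm
  rw [hxy] at hc2
  have hcon : ∀ {a b p : ℕ}, Q.lab w x = a → Q.lab y x = b → Q.lab x w = p →
      Q.Contains (ofEdges [1, 2, 1] [edge 0 1 a p, edge 1 2 3 b]) := by
    intro a b p ha hb hp
    refine contains_of_list hQ.no hQ.diag (fun i => [w, x, y].getD i y) rfl (by simp [IsTreeFrom])
      (by simp [Edge.LocInj, hne]) ?_ fun i hi => ?_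
    · intro e he
      simp only [List.mem_cons, List.not_mem_nil, or_false] at he
      rcases he with rfl | rfl
      · exact ⟨ha ▸ lab_pos hw'.symm, ha, hp⟩
      · exact ⟨three_pos, hxy, hb⟩
    · simp only [List.length_cons, List.length_nil] at hi
      interval_cases i
      exacts [⟨one_pos, Q.K_pos _⟩, ⟨two_pos, hx⟩, ⟨one_pos, Q.K_pos _⟩]
  have hle := hQ.lab_le_three (y := w) hx
  obtain h | h | h : Q.lab x w = 1 ∨ Q.lab x w = 2 ∨ Q.lab x w = 3 := by omega
  · exact hQ.no ⟨_, _, IsListed.affG2 _ _ (lab_pos hw'.symm) hc2 hc, hcon rfl rfl h⟩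
  · rw [h] at hc1
    exact hQ.no ⟨_, _, IsListed.J23 _ _ hc1 hc2 hc, hcon rfl rfl h⟩
  · rw [h] at hc1
    exact hQ.no ⟨_, _, IsListed.J33 _ _ hc1 hc2 hc, hcon rfl rfl h⟩

theorem not_lab_three_two (hQ : Q.IsBare) {x y : V} (hx : 2 ≤ Q.K x) (hy : 2 ≤ Q.K y)
    (hxy : Q.lab x y = 3) (hyx : Q.lab y x = 2) : False := by
  refine hQ.no ⟨_, _, IsListed.gc1,
    contains_of_list hQ.no hQ.diag (fun i => [x, y].getD i y) rfl (by simp [IsTreeFrom])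
    (List.pairwise_singleton _ _) ?_ fun i hi => ?_⟩
  · intro e he
    rw [List.mem_singleton.1 he]
    exact ⟨three_pos, hxy, hyx⟩
  · simp only [List.length_cons, List.length_nil] at hi
    interval_cases i
    exacts [⟨two_pos, hx⟩, ⟨two_pos, hy⟩]

/-- The vertex y is the only neighbour, so the balance at x gives the inequality and K(y) ≥ 2. The
reverse label is then at most 3; the value 2 gives `gc1` and 3 is not coprime to 3. -/
theorem lab_three (hQ : Q.IsBare) {x y : V} (hx : 2 ≤ Q.K x) (hxy : Q.lab x y = 3) :
    2 * Q.K x ≤ 3 * Q.K y ∧ 2 ≤ Q.K y ∧ Q.lab y x = 1 := by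
  have h1 := hQ.bal_one hx fun w hw => hQ.unique_of_lab_three hx hxy hw
  rw [hxy] at h1
  have h2 : 2 ≤ Q.K y := by omega
  refine ⟨h1, h2, ?_⟩
  have hadj := hQ.adj (hxy.symm ▸ three_pos)
  have h3 := hQ.lab_le_three (y := x) h2
  have h4 := lab_pos hadj.symm
  have h5 := coprime_of_adj hQ.no hadj
  obtain h | h | h : Q.lab y x = 1 ∨ Q.lab y x = 2 ∨ Q.lab y x = 3 := by omega
  · exact h
  · exact (hQ.not_lab_three_two hx h2 hxy h).elim
  · rw [hxy, h] at h5
    norm_num at h5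

/-- Two vertices of weight at least two joined by an edge with label two: the other label is one. -/
theorem lab_two (hQ : Q.IsBare) {x y : V} (hx : 2 ≤ Q.K x) (hy : 2 ≤ Q.K y)
    (hxy : Q.lab x y = 2) : Q.lab y x = 1 := by
  have hadj := hQ.adj (hxy.symm ▸ two_pos)
  have h3 := hQ.lab_le_three (y := x) hy
  have h4 := lab_pos hadj.symm
  have h5 := coprime_of_adj hQ.no hadj
  obtain h | h | h : Q.lab y x = 1 ∨ Q.lab y x = 2 ∨ Q.lab y x = 3 := by omega
  · exact h
  · rw [hxy, h] at h5
    norm_num at h5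
  · exact (hQ.not_lab_three_two hy hx h hxy).elim

/-- Two disjoint features at the same vertex are impossible. -/
theorem not_disjoint (hQ : Q.IsBare) {c : V} (hc : 2 ≤ Q.K c) {l l' : List V}
    (h : Q.IsFeature c l) (h' : Q.IsFeature c l') (hdis : l.Disjoint l') : False :=
  not_isFeature_isFeature hQ.no hQ.diag (r := 0) (s := fun _ => c)
    ⟨⟨fun i hi => by omega, fun i hi => by omega⟩, fun i hi => by omega, fun _ _ => hc⟩ h h'
    (fun _ => hdis) (fun h => by omega) fun h => by omega

/-- If no feature avoids the neighbour `p` of `v`, there is at most one further neighbour. -/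
theorem step (hQ : Q.IsBare) {v p : V} (hv : 2 ≤ Q.K v) (hp : 0 < Q.lab v p)
    (hnf : ∀ l, Q.IsFeature v l → p ∉ l → False) :
    (∀ y, 0 < Q.lab v y → y = p) ∨ ∃ w, w ≠ p ∧ Q.lab v w = 1 ∧
      (∀ y, 0 < Q.lab v y → y = p ∨ y = w) ∧ (2 ≤ Q.K w → Q.lab w v = 1) := by
  by_cases h : ∃ w, w ≠ p ∧ 0 < Q.lab v w
  · right
    obtain ⟨w, hwp, hw⟩ := h
    have h1 : ∀ y, y ≠ p → 0 < Q.lab v y → Q.lab v y = 1 := by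
      intro y hy hpos
      have h2 := hQ.lab_le_three (y := y) hv
      obtain h | h | h : Q.lab v y = 1 ∨ Q.lab v y = 2 ∨ Q.lab v y = 3 := by omega
      · exact h
      · exact (hnf _ (IsFeature.out h) (by simpa using hy.symm)).elim
      · exact absurd (hQ.unique_of_lab_three hv h hp) hy.symm
    refine ⟨w, hwp, h1 w hwp hw, fun y hy => ?_, fun hK => ?_⟩
    · by_contra! hcon
      exact hnf _ (IsFeature.fork hcon.2 (h1 y hcon.1 hy) (h1 w hwp hw))
        (by simp [hcon.1.symm, hwp.symm])
    · have h2 := hQ.lab_le_three (y := v) hK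
      have h3 := hQ.symm_pos hw
      obtain h | h | h : Q.lab w v = 1 ∨ Q.lab w v = 2 ∨ Q.lab w v = 3 := by omega
      · exact h
      · exact (hnf _ (IsFeature.in2 hK (h1 w hwp hw) h) (by simpa using hwp.symm)).elim
      · exact (hnf _ (IsFeature.in3 hK (h1 w hwp hw) h) (by simpa using hwp.symm)).elim
  · left
    intro y hy
    by_contra hcon
    exact h ⟨y, hcon, hy⟩

variable (Q) in
/-- A chain starting with the edge from `c` to `u` whose weights drop by at most `d` in each
step. -/
structure Leg (c u : V) (d j : ℕ) (z : ℕ → V) : Prop where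
  zero : z 0 = c
  one : z 1 = u
  nonBack : Q.IsNonBack j z
  lab_eq : ∀ i < j, Q.lab (z i) (z (i + 1)) = 1
  lab_eq' : ∀ i < j, 2 ≤ Q.K (z (i + 1)) → Q.lab (z (i + 1)) (z i) = 1
  le : ∀ i ≤ j, Q.K c ≤ Q.K (z i) + i * d
  drop : Q.K (z (j - 1)) ≤ Q.K (z j) + d

/-- The chain is prolonged one vertex at a time. At its last vertex no feature can point away from
the chain, so there is at most one further neighbour; non-negative balance shows that there is one
and that the weight drops by no more than at the previous step. -/
theorem exists_leg (hQ : Q.IsBare) {c u : V} {l : List V} (hc : 2 ≤ Q.K c) (hl : Q.IsFeature c l)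
    (hu : u ∉ l) (hcu : Q.lab c u = 1) {d : ℕ} (hd : Q.K c ≤ Q.K u + d) {j : ℕ} (hj : 1 ≤ j) :
    j * d < Q.K c → ∃ z, Leg Q c u d j z := by
  induction j, hj using Nat.le_induction with
  | base =>
    intro _
    refine ⟨fun i => if i = 0 then c else u, by simp, by simp, ⟨fun i hi => ?_, fun i hi => by omega⟩,
      fun i hi => ?_, fun i hi => ?_, fun i hi => ?_, by simpa using hd⟩
    · obtain rfl : i = 0 := by omega
      simpa using hQ.adj (hcu.symm ▸ one_pos)
    · obtain rfl : i = 0 := by omega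
      simpa using hcu
    · obtain rfl : i = 0 := by omega
      simp only [zero_add, one_ne_zero, if_false, if_true]
      intro hK
      have h2 := hQ.lab_le_three (y := c) hK
      have h3 := hQ.symm_pos (hcu.symm ▸ one_pos : 0 < Q.lab c u)
      have hdis : l.Disjoint [u] := by simpa using hu
      obtain h | h | h : Q.lab u c = 1 ∨ Q.lab u c = 2 ∨ Q.lab u c = 3 := by omega
      · exact h
      · exact (hQ.not_disjoint hc hl (IsFeature.in2 hK hcu h) hdis).elim
      · exact (hQ.not_disjoint hc hl (IsFeature.in3 hK hcu h) hdis).elim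
    · obtain rfl | rfl : i = 0 ∨ i = 1 := by omega
      · simp
      · simpa using hd
  | succ j hj ih =>
    intro hlt
    rw [Nat.succ_mul] at hlt
    obtain ⟨z, hz⟩ := ih (by omega)
    -- From (j + 1) d < K(c) one gets K(z i) > d; for d = 0 the weights stay at least K(c).
    have hbig : ∀ i ≤ j, 2 ≤ Q.K (z i) := fun i hi => by
      have h1 := hz.le i hi
      have h2 := Nat.mul_le_mul_right d hi
      rcases Nat.eq_zero_or_pos d with rfl | h0
      · rw [mul_zero] at h1
        omega
      · omega
    have hspine : Q.IsSpine j z := ⟨hz.nonBack, fun i hi =>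
      ⟨hz.lab_eq i hi, hz.lab_eq' i hi (hbig _ hi)⟩, hbig⟩
    have hj1 : j - 1 + 1 = j := by omega
    have hback := hspine.lab_eq (j - 1) (by omega)
    rw [hj1] at hback
    -- A feature at z j avoiding z (j - 1) would face the feature l along the spine.
    have hcase := hQ.step (hbig j le_rfl) (p := z (j - 1)) (by omega) fun l' hl' hn =>
      not_isFeature_isFeature hQ.no hQ.diag hspine (hz.zero.symm ▸ hl) hl' (fun h => by omega)
        (fun _ => hz.one.symm ▸ hu) fun _ => hn
    have hKj := hz.le j le_rfl
    have hdrop := hz.drop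
    rcases hcase with h | ⟨w, hwp, hw, hall, hwK⟩
    -- Dead end: 2 K(z j) ≤ K(z (j - 1)) ≤ K(z j) + d would give K(z j) ≤ d.
    · have h1 := hQ.bal_one (hbig j le_rfl) h
      rw [hback.2] at h1
      omega
    -- Convexity: K(z j) - K(w) ≤ K(z (j - 1)) - K(z j) ≤ d.
    · have h1 := hQ.bal_two (hbig j le_rfl) hwp.symm hall
      rw [hback.2, hw] at h1
      have hold : ∀ i ≤ j, (if i ≤ j then z i else w) = z i := fun i hi => if_pos hi
      have hnew : (if j + 1 ≤ j then z (j + 1) else w) = w := if_neg (by omega)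
      refine ⟨fun i => if i ≤ j then z i else w, ?_, ?_,
        hz.nonBack.snoc (hQ.adj (hw.symm ▸ one_pos)) fun _ => hwp.symm, fun i hi => ?_,
        fun i hi => ?_, fun i hi => ?_, ?_⟩
      · exact hz.zero
      · simp only [hold 1 hj]
        exact hz.one
      · by_cases h2 : i < j
        · simp only [hold i h2.le, hold (i + 1) h2]
          exact hz.lab_eq i h2
        · obtain rfl : i = j := by omega
          simp only [hold i le_rfl, hnew]
          exact hw
      · by_cases h2 : i < j
        · simp only [hold i h2.le, hold (i + 1) h2]
          exact hz.lab_eq' i h2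
        · obtain rfl : i = j := by omega
          simp only [hold i le_rfl, hnew]
          exact hwK
      · by_cases h2 : i ≤ j
        · simp only [hold i h2]
          exact hz.le i h2
        · obtain rfl : i = j + 1 := by omega
          simp only [hnew]
          rw [Nat.succ_mul]
          omega
      · simp only [Nat.add_sub_cancel, hnew, hold j le_rfl]
        omega

/-- The weights drop along an edge leading away from a feature. -/
theorem weight_lt (hQ : Q.IsBare) {c u : V} {l : List V} (hc : 2 ≤ Q.K c) (hl : Q.IsFeature c l)
    (hu : u ∉ l) (hcu : Q.lab c u = 1) : Q.K u < Q.K c := by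
  by_contra! hcon
  -- Without a drop one may take d = 0, and legs of every length exist, in particular one with more
  -- edges than there are vertices.
  obtain ⟨z, hz⟩ := hQ.exists_leg hc hl hu hcu (d := 0) (by omega) (j := Fintype.card V + 1)
    (by omega) (by omega)
  exact not_nonBack_card hQ.no (by omega) hz.nonBack

end IsBare

end Local

end GenQuiver
namespace GenQuiver

/-! ### Excluding features: the exceptional affine quivers -/

section Final

variable {V : Type*} {Q : GenQuiver V}

theorem embedding_of_list (hno : ¬ Q.HasListed)
    (hd : ∀ x, Q.A x x = -2) (f : ℕ → V) {K : List ℕ} {E : List Edge}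
    (hlen : K.length = 1 + E.length) (hE : IsTreeFrom 1 E) (hf : E.Pairwise (Edge.LocInj f))
    (hlab : ∀ e ∈ E, 0 < e.p ∧ Q.lab (f e.src) (f e.tgt) = e.p ∧
      Q.lab (f e.tgt) (f e.src) = e.q)
    (hK : ∀ i < K.length, 0 < K.getD i 0 ∧ K.getD i 0 ≤ Q.K (f i)) :
    Q.Contains (ofEdges K E) ∧ ∀ {i j i' j' : ℕ}, i ≠ j → i < K.length → j < K.length →
      (∀ k, EAdj E i k → k = i') → (∀ k, EAdj E j k → k = j') →
      Nat.Coprime (Q.lab (f i) (f i')) (Q.lab (f j) (f j')) := by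
  refine ⟨contains_of_list hno hd f hlen hE hf hlab hK, fun hij hi hj hi' hj' => ?_⟩
  exact coprime_of_leaves hno hE
    (fun e he => adj_of_lab hd ((hlab e he).1.trans_eq (hlab e he).2.1.symm))
    (locInj_of_pairwise hE hf) hij (hlen ▸ hi) (hlen ▸ hj) hi' hj'

namespace IsBare

theorem Leg.lab_one {c u : V} {d j : ℕ} {z : ℕ → V} (hz : Leg Q c u d j z) (hj : 1 ≤ j)
    (hu : 2 ≤ Q.K u) : Q.lab u c = 1 := by
  have := hz.lab_eq' 0 hj
  rw [zero_add, hz.zero, hz.one] at this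
  exact this hu

theorem Leg.two {c u : V} {d j : ℕ} {z : ℕ → V} (hz : Leg Q c u d j z) (hj : 2 ≤ j) :
    Q.lab u (z 2) = 1 ∧ 0 < Q.lab (z 2) u ∧ z 2 ≠ c := by
  have h1 := hz.lab_eq 1 hj
  have h2 := hz.nonBack.1 1 hj
  have h3 := hz.nonBack.2 0 hj
  rw [one_add_one_eq_two, hz.one] at h1 h2
  rw [zero_add, hz.zero] at h3
  exact ⟨h1, lab_pos h2.symm, h3.symm⟩

variable [Fintype V]

/-- The balance at w gives 2 K(w) ≤ 3 K(c), so w cannot be the only neighbour of c. A further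
neighbour u has smaller weight than c, whence K(w) > K(c), and the weights 1, 2, 3 of the listed
`twD4` fit. -/
theorem not_in3 (hQ : Q.IsBare) {c w : V} (hc : 2 ≤ Q.K c) (hK : 2 ≤ Q.K w) (hw : Q.lab c w = 1)
    (hw' : Q.lab w c = 3) : False := by
  have hf : Q.IsFeature c [w] := IsFeature.in3 hK hw hw'
  have h3 := (hQ.lab_three hK hw').1
  rcases hQ.step hc (p := w) (by omega) fun l hl h =>
    hQ.not_disjoint hc hf hl (by simpa using h) with h | ⟨u, huw, hu, hall, -⟩
  · have := hQ.bal_one hc h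
    rw [hw] at this
    omega
  · have h1 := hQ.bal_two hc huw.symm hall
    rw [hw, hu] at h1
    have h2 := hQ.weight_lt hc hf (by simpa using huw) hu
    have hcw := hQ.adj (hw.symm ▸ one_pos)
    have hcu := hQ.adj (hu.symm ▸ one_pos)
    have hcop := coprime_at hQ.no hcu hcw huw
    rw [hw'] at hcop
    refine hQ.no ⟨_, _, IsListed.twD4 (Q.lab u c) hcop,
      contains_of_list hQ.no hQ.diag (fun i => [u, c, w].getD i u) rfl (by simp [IsTreeFrom])
      (by simp [Edge.LocInj, huw]) ?_ fun i hi => ?_⟩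
    · intro e he
      simp only [List.mem_cons, List.not_mem_nil, or_false] at he
      rcases he with rfl | rfl
      · exact ⟨lab_pos hcu.symm, rfl, hu⟩
      · exact ⟨three_pos, hw', hw⟩
    · simp only [List.length_cons, List.length_nil] at hi
      interval_cases i
      exacts [⟨one_pos, Q.K_pos _⟩, ⟨two_pos, hc⟩, ⟨three_pos, by change 3 ≤ Q.K w; omega⟩]

/-- Each end of the double edge is itself a feature, so each has at most one more neighbour, of
smaller weight. The balances at x and y show that both exist, and the relative drop at y decides
between `affF4` and `twE6`. -/
theorem not_in2 (hQ : Q.IsBare) {x y : V} (hx : 2 ≤ Q.K x) (hy : 2 ≤ Q.K y) (hxy : Q.lab x y = 1)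
    (hyx : Q.lab y x = 2) : False := by
  have hfx : Q.IsFeature x [y] := IsFeature.in2 hy hxy hyx
  have hfy : Q.IsFeature y [x] := IsFeature.out hyx
  have hadj := hQ.adj (hxy.symm ▸ one_pos)
  have hstepx := hQ.step hx (p := y) (by omega) fun l hl h =>
    hQ.not_disjoint hx hfx hl (by simpa using h)
  have hstepy := hQ.step hy (p := x) (by omega) fun l hl h =>
    hQ.not_disjoint hy hfy hl (by simpa using h)
  have hKx : (∀ z, 0 < Q.lab x z → z = y) → 2 * Q.K x ≤ Q.K y := fun h => by
    have := hQ.bal_one hx h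
    rwa [hxy, one_mul] at this
  have hKy : (∀ z, 0 < Q.lab y z → z = x) → Q.K y ≤ Q.K x := fun h => by
    have := hQ.bal_one hy h
    rw [hyx] at this
    omega
  rcases hstepy with h | ⟨v, hvx, hv, hally, hvK⟩
  · have h1 := hKy h
    rcases hstepx with h' | ⟨u, huy, hu, hallx, -⟩
    · have := hKx h'
      omega
    · have h2 := hQ.bal_two hx huy.symm hallx
      have h3 := hQ.weight_lt hx hfx (by simpa using huy) hu
      rw [hxy, hu] at h2
      omega
  have h1 := hQ.bal_two hy hvx.symm hally
  rw [hyx, hv] at h1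
  have h2 := hQ.weight_lt hy hfy (by simpa using hvx) hv
  rcases hstepx with h | ⟨u, huy, hu, hallx, huK⟩
  · have := hKx h
    omega
  have h3 := hQ.bal_two hx huy.symm hallx
  rw [hxy, hu] at h3
  have h4 := hQ.weight_lt hx hfx (by simpa using huy) hu
  have hxu := hQ.adj (hu.symm ▸ one_pos)
  -- A leg of length two on the side of y gives weights 1, 2, 3, 2, 1. If the drop at y is too
  -- large, then 3 K(y) ≤ 4 K(x), the drop at x is at most K(x)/3, and a leg of length two exists on
  -- the side of x with weights 2, 4, 3, 2, 1.
  by_cases hcase : 2 * (Q.K y - Q.K v) < Q.K y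
  · obtain ⟨z, hz⟩ := hQ.exists_leg hy hfy (by simpa using hvx) hv (d := Q.K y - Q.K v) (by omega)
      (j := 2) (by omega) hcase
    obtain ⟨hz1, hz2, hz3⟩ := hz.two le_rfl
    have hemb := embedding_of_list hQ.no hQ.diag (fun i => [z 2, v, y, x, u].getD i u)
      (K := [1, 2, 3, 2, 1]) (E := [edge 0 1 (Q.lab (z 2) v) 1, edge 1 2 1 1, edge 2 3 2 1,
        edge 4 3 (Q.lab u x) 1]) rfl (by simp [IsTreeFrom])
      (by simp [Edge.LocInj, hz3, hvx, huy.symm]) (fun e he => by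
        simp only [List.mem_cons, List.not_mem_nil, or_false] at he
        rcases he with rfl | rfl | rfl | rfl
        · exact ⟨hz2, rfl, hz1⟩
        · exact ⟨one_pos, hvK (by omega), hv⟩
        · exact ⟨two_pos, hyx, hxy⟩
        · exact ⟨lab_pos hxu.symm, rfl, hu⟩) fun i hi => by
          simp only [List.length_cons, List.length_nil] at hi
          interval_cases i
          exacts [⟨one_pos, Q.K_pos _⟩, ⟨two_pos, by change 2 ≤ Q.K v; omega⟩,
            ⟨three_pos, by change 3 ≤ Q.K y; omega⟩, ⟨two_pos, hx⟩, ⟨one_pos, Q.K_pos _⟩]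
    have hb := coprime_at hQ.no hxu hadj huy
    rw [hyx] at hb
    exact hQ.no ⟨_, _, IsListed.affF4 _ _ hz2 hb (hemb.2 (i := 0) (j := 4) (i' := 1) (j' := 3)
      (by simp) (by simp) (by simp) (by simp [EAdj, Edge.Joins]) (by simp [EAdj, Edge.Joins])),
      hemb.1⟩
  · obtain ⟨z, hz⟩ := hQ.exists_leg hx hfx (by simpa using huy) hu (d := Q.K x - Q.K u) (by omega)
      (j := 2) (by omega) (by omega)
    obtain ⟨hz1, hz2, hz3⟩ := hz.two le_rfl
    have hcon := contains_of_list hQ.no hQ.diag (fun i => [v, y, x, u, z 2].getD i u)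
      (K := [2, 4, 3, 2, 1]) (E := [edge 0 1 1 1, edge 1 2 2 1, edge 2 3 1 1,
        edge 4 3 (Q.lab (z 2) u) 1]) rfl (by simp [IsTreeFrom])
      (by simp [Edge.LocInj, hz3.symm, hvx, huy.symm]) (fun e he => by
        simp only [List.mem_cons, List.not_mem_nil, or_false] at he
        rcases he with rfl | rfl | rfl | rfl
        · exact ⟨one_pos, hvK (by omega), hv⟩
        · exact ⟨two_pos, hyx, hxy⟩
        · exact ⟨one_pos, hu, huK (by omega)⟩
        · exact ⟨hz2, rfl, hz1⟩) fun i hi => by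
          simp only [List.length_cons, List.length_nil] at hi
          interval_cases i
          exacts [⟨two_pos, by change 2 ≤ Q.K v; omega⟩, ⟨four_pos, by change 4 ≤ Q.K y; omega⟩,
            ⟨three_pos, by change 3 ≤ Q.K x; omega⟩, ⟨two_pos, by change 2 ≤ Q.K u; omega⟩,
            ⟨one_pos, Q.K_pos _⟩]
    -- The walk z 2, u, x, y ends with the inward label 2, so the label at the other end is odd.
    have hcop := (hz.nonBack.reverse.snoc (z := y) (by simpa [hz.zero] using hadj)
      (by simpa [hz.one] using huy)).coprime hQ.no (by omega)
    simp only [Nat.zero_le, if_true, Nat.sub_zero, show (1 : ℕ) ≤ 2 by omega, hz.one, hz.zero,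
      show (2 : ℕ) - 1 = 1 from rfl, show ¬ (2 + 1 ≤ 2) by omega, if_false, hyx,
      Nat.add_sub_cancel, le_refl, Nat.sub_self] at hcop
    exact hQ.no ⟨_, _, IsListed.twE6 _ hcop, hcon⟩

/-- If K(u) ≥ 2, the reverse label is 1 and `not_in2` applies. If K(u) = 1, the balance at c is too
small, because the only possible further neighbour weighs less than c. -/
theorem not_out (hQ : Q.IsBare) {c u : V} (hc : 2 ≤ Q.K c) (hu : Q.lab c u = 2) : False := by
  have hf : Q.IsFeature c [u] := IsFeature.out hu
  by_cases hK : 2 ≤ Q.K u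
  · exact hQ.not_in2 hK hc (hQ.lab_two hc hK hu) hu
  · rcases hQ.step hc (p := u) (by omega) fun l hl h =>
      hQ.not_disjoint hc hf hl (by simpa using h) with h | ⟨w, hwu, hw, hall, -⟩
    · have := hQ.bal_one hc h
      rw [hu] at this
      omega
    · have h1 := hQ.bal_two hc hwu.symm hall
      rw [hu, hw] at h1
      have h2 := hQ.weight_lt hc hf (by simpa using hwu) hw
      omega

/-- A fourth neighbour would close a pair of forks, so the balance at c says that the three drops
satisfy du + dv + dw ≤ K(c), each being positive by `weight_lt`. Comparing them with K(c)/2 and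
K(c)/3 leaves three cases, realizing affine E6, E7 and E8 by legs of suitable lengths. -/
theorem not_fork_of_le (hQ : Q.IsBare) {c u v w : V} (hc : 2 ≤ Q.K c) (huv : u ≠ v) (huw : u ≠ w)
    (hvw : v ≠ w) (hu : Q.lab c u = 1) (hv : Q.lab c v = 1) (hw : Q.lab c w = 1)
    (h1 : Q.K w ≤ Q.K v) (h2 : Q.K v ≤ Q.K u) : False := by
  classical
  have hall : ∀ y, 0 < Q.lab c y → y ∈ ({u, v, w} : Finset V) := by
    intro y hy
    by_contra hcon
    simp only [Finset.mem_insert, Finset.mem_singleton, not_or] at hcon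
    obtain ⟨hyu, hyv, hyw⟩ := hcon
    have hle := hQ.lab_le_three (y := y) hc
    obtain h | h | h : Q.lab c y = 1 ∨ Q.lab c y = 2 ∨ Q.lab c y = 3 := by omega
    · exact hQ.not_disjoint hc (IsFeature.fork hyu h hu) (IsFeature.fork hvw hv hw)
        (by simp [Ne.symm hyv, Ne.symm hyw, huv.symm, huw.symm])
    · exact hQ.not_out hc h
    · exact hyu (hQ.unique_of_lab_three hc h (hu.symm ▸ one_pos)).symm
  have hbal := hQ.bal_le hc hall
  rw [Finset.sum_insert (by simp [huv, huw]), Finset.sum_pair hvw, hu, hv, hw] at hbal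
  have fu : Q.IsFeature c [v, w] := IsFeature.fork hvw hv hw
  have fv : Q.IsFeature c [u, w] := IsFeature.fork huw hu hw
  have fw : Q.IsFeature c [u, v] := IsFeature.fork huv hu hv
  have nu : u ∉ [v, w] := by simp [huv, huw]
  have nv : v ∉ [u, w] := by simp [huv.symm, hvw]
  have nw : w ∉ [u, v] := by simp [huw.symm, hvw.symm]
  have ku := hQ.weight_lt hc fu nu hu
  have kv := hQ.weight_lt hc fv nv hv
  have kw := hQ.weight_lt hc fw nw hw
  obtain ⟨du, hdu⟩ : ∃ d, Q.K c = Q.K u + d := ⟨_, (Nat.add_sub_cancel' ku.le).symm⟩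
  obtain ⟨dv, hdv⟩ : ∃ d, Q.K c = Q.K v + d := ⟨_, (Nat.add_sub_cancel' kv.le).symm⟩
  obtain ⟨dw, hdw⟩ : ∃ d, Q.K c = Q.K w + d := ⟨_, (Nat.add_sub_cancel' kw.le).symm⟩
  -- The largest drop is below K(c)/2: all three legs reach length 2.
  by_cases hE6 : 2 * dw < Q.K c
  · obtain ⟨a, ha⟩ := hQ.exists_leg hc fu nu hu hdu.le (j := 2) (by omega) (by omega)
    obtain ⟨b, hb⟩ := hQ.exists_leg hc fv nv hv hdv.le (j := 2) (by omega) (by omega)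
    obtain ⟨z, hz⟩ := hQ.exists_leg hc fw nw hw hdw.le (j := 2) (by omega) (by omega)
    obtain ⟨ha1, ha2, ha3⟩ := ha.two le_rfl
    obtain ⟨hb1, hb2, hb3⟩ := hb.two le_rfl
    obtain ⟨hz1, hz2, hz3⟩ := hz.two le_rfl
    have hemb := embedding_of_list hQ.no hQ.diag (fun i => [a 2, u, c, v, b 2, w, z 2].getD i u)
      (K := [1, 2, 3, 2, 1, 2, 1]) (E := [edge 0 1 (Q.lab (a 2) u) 1, edge 1 2 1 1, edge 2 3 1 1,
        edge 4 3 (Q.lab (b 2) v) 1, edge 2 5 1 1, edge 6 5 (Q.lab (z 2) w) 1]) rfl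
      (by simp [IsTreeFrom])
      (by simp [Edge.LocInj, ha3, hb3.symm, hz3.symm, huv, huw, hvw]) (fun e he => by
        simp only [List.mem_cons, List.not_mem_nil, or_false] at he
        rcases he with rfl | rfl | rfl | rfl | rfl | rfl
        · exact ⟨ha2, rfl, ha1⟩
        · exact ⟨one_pos, ha.lab_one (by omega) (by omega), hu⟩
        · exact ⟨one_pos, hv, hb.lab_one (by omega) (by omega)⟩
        · exact ⟨hb2, rfl, hb1⟩
        · exact ⟨one_pos, hw, hz.lab_one (by omega) (by omega)⟩
        · exact ⟨hz2, rfl, hz1⟩) fun i hi => by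
          simp only [List.length_cons, List.length_nil] at hi
          interval_cases i
          exacts [⟨one_pos, Q.K_pos _⟩, ⟨two_pos, by change 2 ≤ Q.K u; omega⟩,
            ⟨three_pos, by change 3 ≤ Q.K c; omega⟩, ⟨two_pos, by change 2 ≤ Q.K v; omega⟩,
            ⟨one_pos, Q.K_pos _⟩, ⟨two_pos, by change 2 ≤ Q.K w; omega⟩, ⟨one_pos, Q.K_pos _⟩]
    refine hQ.no ⟨_, _, IsListed.affE6 _ _ _ ⟨ha2, hb2, hz2⟩ ?_, hemb.1⟩
    simp only [List.pairwise_cons, List.mem_cons, List.not_mem_nil, or_false, forall_eq_or_imp,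
      forall_eq, false_imp_iff, implies_true, List.Pairwise.nil, and_true]
    exact ⟨⟨hemb.2 (i := 0) (j := 4) (i' := 1) (j' := 3) (by simp) (by simp) (by simp)
        (by simp [EAdj, Edge.Joins]) (by simp [EAdj, Edge.Joins]),
      hemb.2 (i := 0) (j := 6) (i' := 1) (j' := 5) (by simp) (by simp) (by simp)
        (by simp [EAdj, Edge.Joins]) (by simp [EAdj, Edge.Joins])⟩,
      hemb.2 (i := 4) (j := 6) (i' := 3) (j' := 5) (by simp) (by simp) (by simp)
        (by simp [EAdj, Edge.Joins]) (by simp [EAdj, Edge.Joins])⟩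
  -- Now dw ≥ K(c)/2. If dv < K(c)/3, then two legs reach length 3 and the third has length 1.
  by_cases hE7 : 3 * dv < Q.K c
  · obtain ⟨a, ha⟩ := hQ.exists_leg hc fu nu hu hdu.le (j := 3) (by omega) (by omega)
    obtain ⟨b, hb⟩ := hQ.exists_leg hc fv nv hv hdv.le (j := 3) (by omega) (by omega)
    obtain ⟨z, hz⟩ := hQ.exists_leg hc fw nw hw hdw.le (j := 1) (by omega) (by omega)
    obtain ⟨ha1, -, ha3⟩ := ha.two (by omega)
    obtain ⟨hb1, -, hb3⟩ := hb.two (by omega)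
    have ka := ha.le 2 (by omega)
    have kb := hb.le 2 (by omega)
    have ha4 := ha.nonBack.2 1 le_rfl
    have hb4 := hb.nonBack.2 1 le_rfl
    rw [ha.one] at ha4
    rw [hb.one] at hb4
    have ha5 := ha.lab_eq' 1 (by omega) (by change 2 ≤ Q.K (a 2); omega)
    have hb5 := hb.lab_eq' 1 (by omega) (by change 2 ≤ Q.K (b 2); omega)
    rw [ha.one] at ha5
    rw [hb.one] at hb5
    have pa := lab_pos (ha.nonBack.1 2 (by omega)).symm
    have pb := lab_pos (hb.nonBack.1 2 (by omega)).symm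
    have hemb := embedding_of_list hQ.no hQ.diag
      (fun i => [a 3, a 2, u, c, v, b 2, b 3, w].getD i u)
      (K := [1, 2, 3, 4, 3, 2, 1, 2]) (E := [edge 0 1 (Q.lab (a 3) (a 2)) 1, edge 1 2 1 1,
        edge 2 3 1 1, edge 3 4 1 1, edge 4 5 1 1, edge 6 5 (Q.lab (b 3) (b 2)) 1, edge 3 7 1 1]) rfl
      (by simp [IsTreeFrom])
      (by simp [Edge.LocInj, ha3, hb3.symm, ha4.symm, hb4, huv, huw, hvw]) (fun e he => by
        simp only [List.mem_cons, List.not_mem_nil, or_false] at he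
        rcases he with rfl | rfl | rfl | rfl | rfl | rfl | rfl
        · exact ⟨pa, rfl, ha.lab_eq 2 (by omega)⟩
        · exact ⟨one_pos, ha5, ha1⟩
        · exact ⟨one_pos, ha.lab_one (by omega) (by omega), hu⟩
        · exact ⟨one_pos, hv, hb.lab_one (by omega) (by omega)⟩
        · exact ⟨one_pos, hb1, hb5⟩
        · exact ⟨pb, rfl, hb.lab_eq 2 (by omega)⟩
        · exact ⟨one_pos, hw, hz.lab_one (by omega) (by omega)⟩) fun i hi => by
          simp only [List.length_cons, List.length_nil] at hi
          interval_cases i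
          exacts [⟨one_pos, Q.K_pos _⟩, ⟨two_pos, by change 2 ≤ Q.K (a 2); omega⟩,
            ⟨three_pos, by change 3 ≤ Q.K u; omega⟩, ⟨four_pos, by change 4 ≤ Q.K c; omega⟩,
            ⟨three_pos, by change 3 ≤ Q.K v; omega⟩, ⟨two_pos, by change 2 ≤ Q.K (b 2); omega⟩,
            ⟨one_pos, Q.K_pos _⟩, ⟨two_pos, by change 2 ≤ Q.K w; omega⟩]
    exact hQ.no ⟨_, _, IsListed.affE7 _ _ ⟨pa, pb⟩ (hemb.2 (i := 0) (j := 6) (i' := 1) (j' := 5)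
      (by simp) (by simp) (by simp) (by simp [EAdj, Edge.Joins]) (by simp [EAdj, Edge.Joins])),
      hemb.1⟩
  -- Here dw ≥ K(c)/2 and dv ≥ K(c)/3, so du ≤ K(c)/6 and in particular K(c) ≥ 6; the legs have
  -- lengths 5, 2, 1.
  · obtain ⟨a, ha⟩ := hQ.exists_leg hc fu nu hu hdu.le (j := 5) (by omega) (by omega)
    obtain ⟨b, hb⟩ := hQ.exists_leg hc fv nv hv hdv.le (j := 2) (by omega) (by omega)
    obtain ⟨z, hz⟩ := hQ.exists_leg hc fw nw hw hdw.le (j := 1) (by omega) (by omega)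
    obtain ⟨ha1, -, ha3⟩ := ha.two (by omega)
    obtain ⟨hb1, -, hb3⟩ := hb.two le_rfl
    have ka2 := ha.le 2 (by omega)
    have ka3 := ha.le 3 (by omega)
    have ka4 := ha.le 4 (by omega)
    have kb := hb.le 2 (by omega)
    have n1 := ha.nonBack.2 1 (by omega)
    have n2 := ha.nonBack.2 2 (by omega)
    have n3 := ha.nonBack.2 3 (by omega)
    rw [ha.one] at n1
    have l1 := ha.lab_eq' 1 (by omega) (by change 2 ≤ Q.K (a 2); omega)
    have l2 := ha.lab_eq' 2 (by omega) (by change 2 ≤ Q.K (a 3); omega)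
    have l3 := ha.lab_eq' 3 (by omega) (by change 2 ≤ Q.K (a 4); omega)
    have m1 := hb.lab_eq' 1 (by omega) (by change 2 ≤ Q.K (b 2); omega)
    rw [ha.one] at l1
    rw [hb.one] at m1
    have pa := lab_pos (ha.nonBack.1 4 (by omega)).symm
    refine hQ.no ⟨_, _, IsListed.affE8 (Q.lab (a 5) (a 4)) pa, contains_of_list hQ.no hQ.diag
      (fun i => [a 5, a 4, a 3, a 2, u, c, v, b 2, w].getD i u) rfl
      (by simp [IsTreeFrom])
      (by simp [Edge.LocInj, ha3, hb3.symm, n1.symm, n2.symm, n3.symm, huv, huw, hvw])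
      (fun e he => ?_) fun i hi => ?_⟩
    · simp only [List.mem_cons, List.not_mem_nil, or_false] at he
      rcases he with rfl | rfl | rfl | rfl | rfl | rfl | rfl | rfl
      · exact ⟨pa, rfl, ha.lab_eq 4 (by omega)⟩
      · exact ⟨one_pos, l3, ha.lab_eq 3 (by omega)⟩
      · exact ⟨one_pos, l2, ha.lab_eq 2 (by omega)⟩
      · exact ⟨one_pos, l1, ha1⟩
      · exact ⟨one_pos, ha.lab_one (by omega) (by omega), hu⟩
      · exact ⟨one_pos, hv, hb.lab_one (by omega) (by omega)⟩
      · exact ⟨one_pos, hb1, m1⟩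
      · exact ⟨one_pos, hw, hz.lab_one (by omega) (by omega)⟩
    · simp only [List.length_cons, List.length_nil] at hi
      interval_cases i
      exacts [⟨one_pos, Q.K_pos _⟩, ⟨two_pos, by change 2 ≤ Q.K (a 4); omega⟩,
        ⟨three_pos, by change 3 ≤ Q.K (a 3); omega⟩, ⟨four_pos, by change 4 ≤ Q.K (a 2); omega⟩,
        ⟨by change 0 < 5; omega, by change 5 ≤ Q.K u; omega⟩,
        ⟨by change 0 < 6; omega, by change 6 ≤ Q.K c; omega⟩,
        ⟨four_pos, by change 4 ≤ Q.K v; omega⟩, ⟨two_pos, by change 2 ≤ Q.K (b 2); omega⟩,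
        ⟨three_pos, by change 3 ≤ Q.K w; omega⟩]

theorem not_fork (hQ : Q.IsBare) {c u v w : V} (hc : 2 ≤ Q.K c) (huv : u ≠ v) (huw : u ≠ w)
    (hvw : v ≠ w) (hu : Q.lab c u = 1) (hv : Q.lab c v = 1) (hw : Q.lab c w = 1) : False := by
  rcases le_total (Q.K u) (Q.K v) with h1 | h1 <;> rcases le_total (Q.K v) (Q.K w) with h2 | h2 <;>
    rcases le_total (Q.K u) (Q.K w) with h3 | h3
  · exact hQ.not_fork_of_le hc hvw.symm huw.symm huv.symm hw hv hu h1 h2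
  · exact hQ.not_fork_of_le hc hvw.symm huw.symm huv.symm hw hv hu h1 h2
  · exact hQ.not_fork_of_le hc hvw huv.symm huw.symm hv hw hu h3 h2
  · exact hQ.not_fork_of_le hc huv.symm hvw huw hv hu hw h3 h1
  · exact hQ.not_fork_of_le hc huw.symm hvw.symm huv hw hu hv h1 h3
  · exact hQ.not_fork_of_le hc huw huv hvw.symm hu hw hv h2 h3
  · exact hQ.not_fork_of_le hc huv huw hvw hu hv hw h2 h1
  · exact hQ.not_fork_of_le hc huv huw hvw hu hv hw h2 h1

theorem not_isFeature (hQ : Q.IsBare) {c p : V} {l : List V} (hc : 2 ≤ Q.K c)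
    (hl : Q.IsFeature c l) (hp : 0 < Q.lab c p) (hpl : p ∉ l) : False := by
  cases hl with
  | @fork u v hne hu hv =>
    simp only [List.mem_cons, List.not_mem_nil, or_false, not_or] at hpl
    have hle := hQ.lab_le_three (y := p) hc
    obtain h | h | h : Q.lab c p = 1 ∨ Q.lab c p = 2 ∨ Q.lab c p = 3 := by omega
    · exact hQ.not_fork hc hpl.1 hpl.2 hne h hu hv
    · exact hQ.not_out hc h
    · exact hpl.1 (hQ.unique_of_lab_three hc h (hu.symm ▸ one_pos)).symm
  | out hu => exact hQ.not_out hc hu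
  | in2 hK hu hu' => exact hQ.not_in2 hc hK hu hu'
  | in3 hK hu hu' => exact hQ.not_in3 hc hK hu hu'

/-- All weights of a quiver that contains no quiver of the list are equal to one. -/
theorem weight_eq_one (hQ : Q.IsBare) (x : V) : Q.K x = 1 := by
  by_contra hx
  have hx2 : 2 ≤ Q.K x := by
    have := Q.K_pos x
    omega
  have : Nonempty V := ⟨x⟩
  obtain ⟨c, hc⟩ := Finite.exists_max Q.K
  have hc2 : 2 ≤ Q.K c := hx2.trans (hc x)
  -- At a vertex of maximal weight the labels are 1 and there are at most two neighbours, so the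
  -- balance forces two neighbours of the same maximal weight. A walk through such vertices never
  -- stops.
  have hext : ∀ v p, Q.K v = Q.K c → 0 < Q.lab v p → ∃ w, w ≠ p ∧ 0 < Q.lab v w ∧ Q.K w = Q.K c := by
    intro v p hv hp
    have hp1 : Q.lab v p = 1 := by
      have hle := hQ.lab_le_three (y := p) (hc2.trans_eq hv.symm)
      obtain h | h | h : Q.lab v p = 1 ∨ Q.lab v p = 2 ∨ Q.lab v p = 3 := by omega
      · exact h
      · exact (hQ.not_out (hc2.trans_eq hv.symm) h).elim
      · have h1 := hQ.lab_three (hc2.trans_eq hv.symm) h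
        exact (hQ.not_in3 h1.2.1 (hc2.trans_eq hv.symm) h1.2.2 h).elim
    rcases hQ.step (hc2.trans_eq hv.symm) hp fun l hl h =>
      hQ.not_isFeature (hc2.trans_eq hv.symm) hl hp h with h | ⟨w, hwp, hw, hall, -⟩
    · have h1 := hQ.bal_one (hc2.trans_eq hv.symm) h
      have h2 := hc p
      rw [hp1] at h1
      omega
    · have h1 := hQ.bal_two (hc2.trans_eq hv.symm) hwp.symm hall
      have h2 := hc p
      have h3 := hc w
      rw [hp1, hw] at h1
      exact ⟨w, hwp, by omega, by omega⟩
  exact false_of_extend hQ.no (p := fun v => Q.K v = Q.K c) rfl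
    ((hQ.exists_lab_pos hc2).imp fun _ => hQ.adj) fun v p hv hp =>
      (hext v p hv (lab_pos hp)).imp fun w hw => ⟨hw.1, hQ.adj hw.2.1, hw.2.2⟩

end IsBare

end Final

end GenQuiver
-- Necessary conditions from Δ ≥ 2
theorem sum_sum_star {ι : Type*} [Fintype ι] [DecidableEq ι] (T : ι → ι → ℤ) (x : ι)
    (hT : ∀ u v, T u v = T v u) (h0 : ∀ u v, u ≠ x → v ≠ x → T u v = 0) :
    ∑ u, ∑ v, T u v = T x x + 2 * ∑ v ∈ Finset.univ.erase x, T x v := by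
  have h1 : ∀ u, ∑ v, T u v = T u x + ∑ v ∈ Finset.univ.erase x, T u v := fun u =>
    (Finset.add_sum_erase _ _ (Finset.mem_univ x)).symm
  rw [← Finset.add_sum_erase _ _ (Finset.mem_univ x), h1 x]
  have h2 : ∑ u ∈ Finset.univ.erase x, ∑ v, T u v = ∑ u ∈ Finset.univ.erase x, T x u := by
    refine Finset.sum_congr rfl fun u hu => ?_
    rw [h1 u, hT u x, Finset.sum_eq_zero fun v hv =>
      h0 u v (Finset.ne_of_mem_erase hu) (Finset.ne_of_mem_erase hv), add_zero]
  rw [h2]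
  ring

theorem sum_sum_abs_indicator {n : ℕ} (a₀ : Fin n) :
    ∑ a, ∑ b, |(if a = a₀ then (1 : ℤ) else 0) - if b = a₀ then 1 else 0| = 2 * ((n : ℤ) - 1) := by
  rw [sum_sum_star _ a₀ (fun u v => abs_sub_comm _ _) fun u v hu hv => by simp [hu, hv]]
  have h1 : ∑ b ∈ Finset.univ.erase a₀, |(if a₀ = a₀ then (1 : ℤ) else 0) -
      if b = a₀ then 1 else 0| = ∑ b ∈ (Finset.univ : Finset (Fin n)).erase a₀, (1 : ℤ) :=
    Finset.sum_congr rfl fun b hb => by simp [Finset.ne_of_mem_erase hb]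
  rw [h1, Finset.sum_const, Finset.card_erase_of_mem (Finset.mem_univ _), Finset.card_univ,
    Fintype.card_fin]
  have := a₀.2
  simp only [sub_self, abs_zero, zero_add, nsmul_eq_mul, mul_one]
  push_cast [Nat.cast_sub (show 1 ≤ n by omega)]
  rfl

namespace GenQuiver

section Hilbert

variable {V : Type*} [Fintype V] [DecidableEq V]

/-- Only terms meeting x survive: the diagonal gives A(x,x)(K(x) - 1) and each neighbour v gives
A(x,v) K(v). -/
theorem confDim_single (Q : GenQuiver V) (x : V) (a₀ : Fin (Q.K x)) :
    Q.confDim (Pi.single ⟨x, a₀⟩ 1) = ((Q.toQuiverData.balance x - Q.A x x : ℤ) : ℝ) := by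
  set m : Q.Lattice := Pi.single ⟨x, a₀⟩ 1 with hm
  have hm0 : ∀ y, y ≠ x → ∀ b, m ⟨y, b⟩ = 0 := fun y hy b =>
    Pi.single_eq_of_ne (fun h => hy (congrArg Sigma.fst h)) _
  have hmx : ∀ a, m ⟨x, a⟩ = if a = a₀ then 1 else 0 := by
    intro a
    by_cases h : a = a₀
    · subst h
      simp [hm]
    · rw [if_neg h, hm, Pi.single_eq_of_ne]
      exact fun h' => h (eq_of_heq (Sigma.mk.inj h').2)
  rw [confDim_eq_pairSum, sum_sum_star (fun x y => (Q.A x y).sign * Q.pairSum m x y) x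
    (fun u v => by rw [Q.sign_comm, Q.pairSum_comm]) fun u v hu hv => by
      simp [pairSum, hm0 u hu, hm0 v hv]]
  have h1 : (Q.A x x).sign * Q.pairSum m x x = Q.A x x * (2 * ((Q.K x : ℤ) - 1)) := by
    rw [Q.sign_mul_pairSum_self]
    simp only [hmx]
    rw [sum_sum_abs_indicator]
  have h2 : ∑ v ∈ Finset.univ.erase x, (Q.A x v).sign * Q.pairSum m x v =
      ∑ v ∈ Finset.univ.erase x, Q.A x v * Q.K v := by
    refine Finset.sum_congr rfl fun v hv => ?_
    have hvx := Finset.ne_of_mem_erase hv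
    rw [Q.sign_mul_pairSum_of_ne m hvx.symm]
    unfold pairSum
    have h3 : ∀ (a : Fin (Q.K x)) (b : Fin (Q.K v)), |m ⟨x, a⟩ * Q.A x v - m ⟨v, b⟩ * Q.A v x| =
        if a = a₀ then Q.A x v else 0 := by
      intro a b
      rw [hmx, hm0 v hvx, zero_mul, sub_zero]
      split_ifs
      · rw [one_mul, abs_of_nonneg (Q.offdiag_nonneg x v hvx.symm)]
      · simp
    simp only [h3, Finset.sum_const, Finset.card_univ, Fintype.card_fin, nsmul_eq_mul]
    rw [← Finset.mul_sum, Finset.sum_ite_eq' Finset.univ a₀, if_pos (Finset.mem_univ _), mul_comm]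
  simp only [h1, h2]
  have h4 : Q.toQuiverData.balance x =
      Q.A x x * Q.K x + ∑ v ∈ Finset.univ.erase x, Q.A x v * Q.K v :=
    (Finset.add_sum_erase _ (fun v => Q.A x v * (Q.K v : ℤ)) (Finset.mem_univ x)).symm
  rw [h4]
  push_cast
  ring

theorem HilbertGood.two_le {Q : GenQuiver V} (hQ : Q.HilbertGood) :
    ∃ S : Q.Shift, ∀ m ∉ AddSubgroup.zmultiples S.vec, 2 ≤ Q.confDim m := by
  obtain ⟨S, hs, a, ha, -, ha1⟩ := hQ
  have h1 : ∀ m ∉ AddSubgroup.zmultiples S.vec, 1 ≤ Q.confDim m := by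
    intro m hm
    have h2 := Q.confDim_pos_of_summable S (t := 1 / 2) ⟨by norm_num, by norm_num⟩
      (hs _ ⟨by norm_num, by norm_num⟩) hm
    obtain ⟨z, hz, -⟩ := Q.exists_confDim_eq m
    rw [hz] at h2 ⊢
    exact_mod_cast h2
  refine ⟨S, fun m hm => ?_⟩
  have h2 := h1 m hm
  have h3 := Q.confDim_ne_one S h1 hs ha ha1 hm
  obtain ⟨z, hz, -⟩ := Q.exists_confDim_eq m
  rw [hz] at h2 h3 ⊢
  have h4 : (1 : ℤ) ≤ z := by exact_mod_cast h2
  have h5 : z ≠ 1 := by exact_mod_cast h3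
  exact_mod_cast (show (2 : ℤ) ≤ z by omega)

/-- A unit vector at a vertex of weight at least two takes two values there, so it lies outside ℤL,
and its Δ is the balance plus 2. -/
theorem HilbertGood.balance_nonneg {Q : GenQuiver V} (hQ : Q.HilbertGood) {x : V}
    (hx : 2 ≤ Q.K x) (hxx : Q.A x x = -2) : 0 ≤ Q.toQuiverData.balance x := by
  obtain ⟨S, hS⟩ := hQ.two_le
  have h1 := hS (Pi.single ⟨x, ⟨0, by omega⟩⟩ 1) fun hmem => by
    obtain ⟨k, hk⟩ := AddSubgroup.mem_zmultiples_iff.1 hmem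
    have h2 := congrFun hk ⟨x, ⟨0, by omega⟩⟩
    have h3 := congrFun hk ⟨x, ⟨1, by omega⟩⟩
    rw [Pi.single_eq_same] at h2
    rw [Pi.single_eq_of_ne (fun h => by simpa using eq_of_heq (Sigma.mk.inj h).2)] at h3
    simp only [Pi.smul_apply, Shift.vec] at h2 h3
    omega
  rw [confDim_single, hxx] at h1
  have h2 : (2 : ℤ) ≤ Q.toQuiverData.balance x - -2 := by exact_mod_cast h1
  omega

theorem HilbertGood.confDim_ne_one {Q : GenQuiver V} (hQ : Q.HilbertGood) (m : Q.Lattice) :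
    Q.confDim m ≠ 1 := by
  obtain ⟨S, hS⟩ := hQ.two_le
  by_cases hm : m ∈ AddSubgroup.zmultiples S.vec
  · obtain ⟨k, rfl⟩ := AddSubgroup.mem_zmultiples_iff.1 hm
    have := Q.confDim_add_shift S k 0
    rw [add_zero, confDim_zero] at this
    rw [this]
    norm_num
  · have := hS m hm
    intro h
    rw [h] at this
    norm_num at this

end Hilbert

/-! ### A vector with Δ = 1 on an Abelian tree -/

section Abelian

variable {V : Type*} {Q : GenQuiver V}

theorem IsNonBack.mono {n k : ℕ} {v : ℕ → V} (hv : Q.IsNonBack n v) (hk : k ≤ n) :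
    Q.IsNonBack k v :=
  ⟨fun i hi => hv.1 i (by omega), fun i hi => hv.2 i (by omega)⟩

theorem exists_nonBack_of_reachable {x z : V} (h : Q.graph.Reachable x z) :
    ∃ n v, Q.IsNonBack n v ∧ v 0 = x ∧ v n = z := by
  rw [SimpleGraph.reachable_iff_reflTransGen] at h
  induction h with
  | refl => exact ⟨0, fun _ => x, ⟨fun i hi => by omega, fun i hi => by omega⟩, rfl, rfl⟩
  | @tail z w _ hzw ih =>
    obtain ⟨n, v, hv, h0, hn⟩ := ih
    by_cases hw : 1 ≤ n ∧ v (n - 1) = w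
    · exact ⟨n - 1, v, hv.mono (by omega), h0, hw.2⟩
    · refine ⟨n + 1, _, hv.snoc (z := w) (hn ▸ hzw) fun h1 h2 => hw ⟨h1, h2⟩, by simpa using h0,
        by simp⟩

variable [Fintype V] [DecidableEq V]

/-- A connected quiver with weights one that contains no quiver of the list has a vector of
conformal dimension one. -/
theorem IsBare.exists_confDim_eq_one [Nontrivial V] (hQ : Q.IsBare) (hconn : Q.graph.Connected)
    (hK : ∀ x, Q.K x = 1) : ∃ m, Q.confDim m = 1 := by
  have hnbr : ∀ x, ∃ y, Q.graph.Adj x y := by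
    intro x
    obtain ⟨z, hz⟩ := exists_ne x
    obtain ⟨n, v, hv, h0, hn⟩ := exists_nonBack_of_reachable (hconn.preconnected x z)
    have hn0 : 0 < n := by
      rcases Nat.eq_zero_or_pos n with rfl | h
      · exact absurd (hn.symm.trans h0) hz
      · exact h
    exact ⟨v 1, h0 ▸ hv.1 0 hn0⟩
  -- A leaf exists, since otherwise walks without backtracking could be extended for ever.
  obtain ⟨x, y, hxy, hx⟩ : ∃ x y, Q.graph.Adj x y ∧ ∀ w, Q.graph.Adj x w → w = y := by
    by_contra! hcon
    obtain ⟨c⟩ := hconn.nonempty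
    refine false_of_extend hQ.no (p := fun _ => True) (c := c) trivial (hnbr c) fun v u _ hu => ?_
    obtain ⟨w, hw, hwu⟩ := hcon v u hu
    exact ⟨w, hwu, hw, trivial⟩
  obtain ⟨L, hL0, hL⟩ := Q.length
  have hL' : ∀ u v, u ≠ v → Q.lab u v * L v = Q.lab v u * L u := fun u v huv => by
    have := hL u v
    rw [A_eq_lab huv, A_eq_lab huv.symm] at this
    exact_mod_cast this
  obtain ⟨l, hlpos, hl⟩ : ∃ l : V → ℕ, (∀ v, 0 < l v) ∧
      ∀ u v, u ≠ v → l u * Q.lab u v = l v * Q.lab v u := by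
    refine ⟨fun v => ∏ w ∈ Finset.univ.erase v, L w, fun v => Finset.prod_pos fun w _ => hL0 w,
      fun u v huv => ?_⟩
    have h1 : ∀ v, L v * ∏ w ∈ Finset.univ.erase v, L w = ∏ w, L w := fun v =>
      Finset.mul_prod_erase _ _ (Finset.mem_univ v)
    refine Nat.eq_of_mul_eq_mul_right (Nat.mul_pos (hL0 u) (hL0 v)) ?_
    have h2 := h1 u
    have h3 := h1 v
    calc _ = (L u * ∏ w ∈ Finset.univ.erase u, L w) * (Q.lab u v * L v) := by ring
      _ = (L v * ∏ w ∈ Finset.univ.erase v, L w) * (Q.lab v u * L u) := by rw [h2, h3, hL' u v huv]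
      _ = _ := by ring
  -- Away from the leaf, l / g is a primitive solution μ of the edge equations.
  set g := (Finset.univ.erase x).gcd l with hg
  have hgdvd : ∀ v, v ≠ x → g ∣ l v := fun v hv =>
    Finset.gcd_dvd (Finset.mem_erase.2 ⟨hv, Finset.mem_univ v⟩)
  have hgpos : 0 < g := Nat.pos_of_dvd_of_pos (hgdvd y hxy.1.symm) (hlpos y)
  let μ : V → ℕ := fun v => l v / g
  have hμ : ∀ v, v ≠ x → μ v * g = l v := fun v hv => Nat.div_mul_cancel (hgdvd v hv)
  have hμeq : ∀ u v, u ≠ v → u ≠ x → v ≠ x → μ u * Q.lab u v = μ v * Q.lab v u := by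
    intro u v huv hu hv
    refine Nat.eq_of_mul_eq_mul_right hgpos ?_
    have := hl u v huv
    rw [← hμ u hu, ← hμ v hv] at this
    linarith
  -- A prime r dividing both `lab x y` and μ(y) divides μ at every vertex reached from x: along a
  -- walk from x it is coprime to each label pointing back, so the edge equation passes it on. This
  -- contradicts primitivity.
  have hcop : Nat.Coprime (Q.lab x y) (μ y * Q.lab y x) := by
    refine Nat.Coprime.mul_right ?_ (coprime_of_adj hQ.no hxy)
    refine Nat.coprime_of_dvd fun r hr hrp hry => ?_
    have hall : ∀ z, z ≠ x → r ∣ μ z := by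
      intro z hz
      obtain ⟨n, v, hv, h0, hn⟩ := exists_nonBack_of_reachable (hconn.preconnected x z)
      have hind := hv.induced hQ.no
      have hnx : ∀ i, 0 < i → i ≤ n → v i ≠ x := fun i h1 h2 => h0 ▸ (hind 0 i h1 h2).1.symm
      have hstep : ∀ i, 1 ≤ i → i ≤ n → r ∣ μ (v i) := by
        intro i hi
        induction i, hi using Nat.le_induction with
        | base =>
          intro h1
          rwa [hx (v 1) (h0 ▸ hv.1 0 h1)]
        | succ i hi ih =>
          intro h1
          have h2 := ih (by omega)
          have h3 := hv.1 i (by omega)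
          have h4 := hμeq _ _ h3.1 (hnx i (by omega) (by omega)) (hnx (i + 1) (by omega) h1)
          have h5 := (hv.mono h1).coprime hQ.no (by omega)
          rw [h0, Nat.add_sub_cancel, hx _ (h0 ▸ hv.1 0 (by omega) : Q.graph.Adj x (v 1))] at h5
          have h6 : Nat.Coprime r (Q.lab (v (i + 1)) (v i)) := Nat.Coprime.coprime_dvd_left hrp h5
          exact h6.dvd_of_dvd_mul_right (h4 ▸ Dvd.dvd.mul_right h2 _)
      have hn0 : 1 ≤ n := by
        rcases Nat.eq_zero_or_pos n with rfl | h
        · exact absurd (hn.symm.trans h0) hz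
        · exact h
      exact hn ▸ hstep n hn0 le_rfl
    have h1 : r * g ∣ g := Finset.dvd_gcd fun z hz => by
      have hzx := Finset.ne_of_mem_erase hz
      rw [← hμ z hzx]
      exact Nat.mul_dvd_mul_right (hall z hzx) g
    have h2 := Nat.le_of_dvd hgpos h1
    have h3 := Nat.mul_le_mul_right g hr.two_le
    omega
  -- With value s at x and -t μ elsewhere, every edge except xy is balanced, and the Bézout relation
  -- says that xy contributes exactly 1.
  obtain ⟨s, t, hst⟩ := Nat.isCoprime_iff_coprime.2 hcop
  let m : Q.Lattice := fun i => if i.1 = x then s else -t * μ i.1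
  have hmx : Q.coord m x = s := if_pos rfl
  have hmz : ∀ z, z ≠ x → Q.coord m z = -t * μ z := fun z hz => if_neg hz
  refine ⟨m, ?_⟩
  rw [confDim_eq_pairSum, sum_sum_star (fun x y => (Q.A x y).sign * Q.pairSum m x y) x
    (fun u v => by rw [Q.sign_comm, Q.pairSum_comm]) fun u v hu hv => ?_]
  · have h1 : (Q.A x x).sign * Q.pairSum m x x = 0 := by
      rw [pairSum_of_abelian hK]
      simp
    have h2 : ∑ v ∈ Finset.univ.erase x, (Q.A x v).sign * Q.pairSum m x v = 1 := by
      rw [Finset.sum_eq_single_of_mem y (Finset.mem_erase.2 ⟨hxy.1.symm, Finset.mem_univ y⟩)]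
      · rw [Q.sign_mul_pairSum_of_ne m hxy.1, pairSum_of_abelian hK, hmx, hmz y hxy.1.symm,
          A_eq_lab hxy.1, A_eq_lab hxy.1.symm]
        have h3 : s * (Q.lab x y : ℤ) - -t * μ y * (Q.lab y x : ℤ) = 1 := by
          rw [← hst]
          push_cast
          ring
        rw [h3, abs_one]
      · intro v hv hvy
        have hA : Q.A x v = 0 := A_eq_zero (Finset.ne_of_mem_erase hv).symm fun h => hvy (hx v h)
        rw [hA]
        simp
    simp only [h1, h2]
    norm_num
  · rw [pairSum_of_abelian hK, hmz u hu, hmz v hv]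
    by_cases huv : u = v
    · subst huv
      simp
    · have h1 := hμeq u v huv hu hv
      have h2 : -t * μ u * Q.A u v - -t * μ v * Q.A v u = 0 := by
        rw [A_eq_lab huv, A_eq_lab (Ne.symm huv)]
        have h3 : (μ u : ℤ) * Q.lab u v = μ v * Q.lab v u := by exact_mod_cast h1
        linear_combination (-t) * h3
      rw [h2]
      simp

theorem hasListed_of_hilbertGood (hconn : Q.graph.Connected) (hQ : Q.HilbertGood) :
    Q.HasListed := by
  by_contra hno
  have hdiag : ∀ x, Q.A x x = -2 := by
    intro x
    by_cases hx : Q.K x = 1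
    · exact Q.abelian_no_loop x hx
    · obtain ⟨g, hg⟩ := Q.loops x
      rcases Nat.eq_zero_or_pos g with rfl | h
      · simpa using hg
      -- A loop requires weight at least two, so lowering the weight to two gives the listed
      -- one-vertex quiver.
      · refine absurd ⟨_, _, IsListed.D g h, fun _ => x, fun i j _ => Subsingleton.elim i j,
          fun i j hij => absurd (Subsingleton.elim i j) hij, fun i => ⟨two_pos, ?_⟩, fun i => ?_⟩ hno
        · have := Q.K_pos x
          change 2 ≤ Q.K x
          omega
        · rw [hg]
          rfl
  have hbare : Q.IsBare := ⟨hno, hdiag, fun x hx => hQ.balance_nonneg hx (hdiag x)⟩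
  have hK := hbare.weight_eq_one
  have := nontrivial_of_abelian hQ hK
  obtain ⟨m, hm⟩ := hbare.exists_confDim_eq_one hconn hK
  exact hQ.confDim_ne_one m hm

end Abelian

end GenQuiver
-- From containment to decay products
namespace GenQuiver

variable {V : Type*}

theorem Contains.of_sub {W : Type*} [DecidableEq V] {Q : GenQuiver V} {K' : V → ℕ}
    (hK' : K' ≤ Q.K) {R : QuiverData W} (h : (Q.sub K').Contains R) : Q.Contains R := by
  obtain ⟨f, hf, hA, hK, hd⟩ := h
  refine ⟨fun i => (f i).1, Subtype.val_injective.comp hf, fun i j hij => ?_,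
    fun i => ⟨(hK i).1, (hK i).2.trans (hK' _)⟩, fun i => ?_⟩
  · rw [← hA i j hij]
    exact (if_neg fun h => hij (hf h.1)).symm
  · rw [hd i]
    split_ifs with h
    · rfl
    · have h1 := hK i
      refine if_neg fun h2 => h ?_
      have h3 : R.K i ≤ 1 := h1.2.trans_eq h2.2
      omega

end GenQuiver

theorem IsSimplyLacedAffine.isListed {W : Type} {X : QuiverData W} (hX : IsSimplyLacedAffine X) :
    IsListed X ∧ ∀ i, 0 < X.K i ∧ X.A i i = -2 := by
  have key : ∀ {K : List ℕ} {E : List Edge}, (∀ k ∈ K, 0 < k) →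
      ∀ i, 0 < (ofEdges K E).K i ∧ (ofEdges K E).A i i = -2 := fun {K E} h i =>
    ⟨h _ (List.get_mem K i), if_pos rfl⟩
  cases hX with
  | A1 => exact ⟨IsListed.A 2 1 le_rfl le_rfl, key (by simp)⟩
  | A n hn =>
    refine ⟨IsListed.hbar n _ _ hn (fun i _ => ⟨le_rfl, le_rfl⟩) rfl fun _ _ _ _ _ _ =>
      Nat.coprime_one_left 1, key (by simp)⟩
  | D r => exact ⟨IsListed.affD r 1 1 1 1 (by simp) (by simp), key (by simp)⟩
  | E6 => exact ⟨IsListed.affE6 1 1 1 (by simp) (by simp), key (K := [1, 2, 3, 2, 1, 2, 1]) (by simp)⟩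
  | E7 =>
    exact ⟨IsListed.affE7 1 1 (by simp) (by simp), key (K := [1, 2, 3, 4, 3, 2, 1, 2]) (by simp)⟩
  | E8 => exact ⟨IsListed.affE8 1 le_rfl, key (K := [1, 2, 3, 4, 5, 6, 4, 2, 3]) (by simp)⟩

namespace GenQuiver

theorem hasListed_of_isMultipleOfAffine {V : Type*} {Q : GenQuiver V} (hQ : Q.IsMultipleOfAffine) :
    Q.HasListed := by
  rcases hQ with ⟨N, hN, e, hA, hK⟩ | ⟨N, hN, W, X, hX, h⟩
  · refine ⟨_, _, IsListed.D 1 le_rfl, e.symm, e.symm.injective,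
      fun i j hij => absurd (Subsingleton.elim i j) hij, fun i => ⟨two_pos, ?_⟩, fun i => ?_⟩
    · rw [← hK]
      exact hN
    · rw [← hA]
      rfl
  · exact ⟨W, X, hX.isListed.1, Contains.of_iso_mul hN hX.isListed.2 h⟩

variable {V : Type*} [Fintype V] [DecidableEq V]

theorem isGoodConnected_of_isListed {W : Type} {R : QuiverData W} (hR : IsListed R)
    {P : GenQuiver V} (h : P.toQuiverData.Iso R) : P.IsGoodConnected := by
  -- Coprimality to some p ≥ 2 rules out the parameter 0; this is how positivity is encoded in
  -- several listed families.
  have hpos : ∀ {a p : ℕ}, 2 ≤ p → Nat.Coprime a p → 0 < a := fun {a p} hp ha =>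
    Nat.pos_of_ne_zero fun h0 => by
      subst h0
      rw [Nat.coprime_zero_left] at ha
      omega
  cases hR with
  -- This is the path with a single edge, whose end labels Nℓ and N have gcd N > 1.
  | A N ℓ hN hℓ =>
    refine good_h (n := 1) (ℓ := fun _ => N * ℓ) (k := fun _ => N) le_rfl
      (fun i _ => ⟨Nat.mul_pos (by omega) hℓ, by omega⟩) ?_ (fun i j _ _ _ => by omega) h
    rw [Nat.gcd_eq_right (Dvd.intro ℓ rfl)]
    omega
  | h n ℓ k hn pos hδ cop => exact good_h hn pos hδ cop h
  | hbar n ℓ k hn pos len cop => exact good_hbar hn pos h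
  | twA2even r a ha => exact good_twA2even r a (hpos le_rfl ha) h
  | twA2odd r a b ha hb hab => exact good_twA2odd r a b (hpos le_rfl ha) (hpos le_rfl hb) h
  | affB r a b c pos hc cop => exact good_affB r a b c pos.1 pos.2 (hpos le_rfl hc) h
  | affD r a b c d pos cop => exact good_affD r a b c d pos.1 pos.2.1 pos.2.2.1 pos.2.2.2 h
  | twD r a b ha hb hab => exact good_twD r a b (hpos le_rfl ha) (hpos le_rfl hb) h
  | twD4 a ha => exact good_twD4 a (hpos (by omega) ha) h
  | affE6 a b c pos cop => exact good_affE6 a b c pos.1 pos.2.1 pos.2.2 h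
  | twE6 a ha => exact good_twE6 a (hpos le_rfl ha) h
  | affE7 a b pos cop => exact good_affE7 a b pos.1 pos.2 h
  | affE8 a pos => exact good_affE8 a pos h
  | affF4 a b pos hb cop => exact good_affF4 a b pos (hpos le_rfl hb) h
  | affG2 a b pos hb cop => exact good_affG2 a b pos (hpos (by omega) hb) h
  | D g hg => exact good_oneVertex hg h
  | Y ℓ a hℓ ha => exact good_Y (hpos (by omega) ha) hℓ h
  | gc r => exact good_gc r h
  | gc1 => exact good_gc1 h
  | gb r a ha => exact good_gb r a (hpos (by omega) ha) h
  | gd r a b ha hb hab => exact good_gd r a b (hpos (by omega) ha) (hpos (by omega) hb) h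
  | J23 a b ha hb hab => exact good_J23 (hpos (by omega) ha) (hpos (by omega) hb) h
  | J33 a b ha hb hab => exact good_J33 a b (hpos (by omega) ha) (hpos (by omega) hb) h

end GenQuiver
end CoulombQuiver
end

theorem mainTheorem7 {V : Type*} [Fintype V] [DecidableEq V] (Q : CoulombQuiver.GenQuiver V)
    (hQ : Q.IsGood) :
    ∃ (W : Type) (R : CoulombQuiver.QuiverData W), CoulombQuiver.IsListed R ∧ Q.Decays R := by
  obtain ⟨⟨x⟩, hQ⟩ := hQ
  obtain ⟨hconn, hgood⟩ := hQ x
  have hle : Q.componentWeight x ≤ Q.K := fun y => by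
    unfold CoulombQuiver.GenQuiver.componentWeight
    split_ifs
    · exact le_rfl
    · exact Nat.zero_le _
  obtain ⟨W, R, hR, hcon⟩ : (Q.sub (Q.componentWeight x)).HasListed :=
    hgood.elim (CoulombQuiver.GenQuiver.hasListed_of_hilbertGood hconn)
      CoulombQuiver.GenQuiver.hasListed_of_isMultipleOfAffine
  obtain ⟨K', hK', hiso⟩ := (hcon.of_sub hle).exists_sub
  refine ⟨W, R, hR, K', ⟨fun K'' h => ?_, ?_⟩, hiso⟩
  · rw [Multiset.mem_singleton.1 h]
    exact ⟨hK', CoulombQuiver.GenQuiver.isGoodConnected_of_isListed hR hiso⟩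
  · rwa [Multiset.sum_singleton]
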